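/- **Theorem (NB-I structure).** Let $(M,J)$ be a smooth finite-dimensional almost complex manifold (Hausdorff, $\sigma$-compact) and let $L\subset M$ be a smooth embedded pseudoholomorphic submanifold, i.e. $J(TL)\subset TL$. Let $N_LM=TM|_L/TL$ be its normal bundle, $\pi:N_LM\to L$ the projection and $\rho:L\to N_LM$ the zero section. *Conventions.* The Nijenhuis tensor is $N_J(X,Y)=[JX,JY]-J[JX,Y]-J[X,JY]-[X,Y]$. A smooth linear connection $\nabla$ on an open set $U\subset M$ is *minimal* if $\nabla J=0$ and its torsion is $T_\nabla=\tfrac14N_J$. $L$ is *totally geodesic* for $\nabla$ if $\nabla_XY$ is tangent to $L$ along $L\cap U$ whenever $X,Y$ are (parallel transport along $L$ preserves $TL$); then $\hat\nabla_X[\Theta]=[\nabla_X\Theta]$ is a linear connection on $N_LM$ over $L\cap U$, with horizontal spaces $H_a\cong T_{\pi(a)}L$ in $T_a(N_LM)=H_a\oplus V_a$, where $V_a\cong T_{\pi(a)}M/T_{\pi(a)}L$ is the vertical space. $\nabla$ is *flat on $L$* if its restriction to $TL$ has zero curvature. For the curvature $R_\nabla$ put $$R_\nabla^{--}(X,Y)=\tfrac14\big[R_\nabla(X,Y)+JR_\nabla(JX,Y)+JR_\nabla(X,JY)-R_\nabla(JX,JY)\big].$$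 An almost complex structure is *integrable* if every point has a neighbourhood with holomorphic coordinates (smooth coordinates in which the structure is constant). *Claim.* There are an open set $U\supset L$ (with $U=M$ if $L$ is closed) and a minimal connection on $U$ for which $L$ is totally geodesic. There is a smooth almost complex structure $\hat J$ on the total space $N_LM$ such that for every minimal connection $\nabla$ on an open set $U\subset M$ for which $L$ is totally geodesic, and every $a\in N_LM$ over $L\cap U$, $\hat J_a$ is the direct sum of $J|_L$ on $H_a\cong T_{\pi(a)}L$ and of the structure induced by $J$ on $V_a\cong T_{\pi(a)}M/T_{\pi(a)}L$ (so $\hat J$ is unique and independent of $\nabla$). Moreover: 1. The maps $\pi:N_LM\to L$ and $\rho:L\to N_LM$ are pseudoholomorphic. 2. $\hat J$ is integrable if and only if $J|_L$ is integrable and every point of $L$ has an open neighbourhood $U$ in $M$ with a minimal connection $\nabla$ on $U$, totally geodesic and flat on $L$, such that for all $x\in L\cap U$ and $X,Y\in T_xL$ the operator $R_\nabla^{--}(X,Y)$ vanishes on the normal bundle, i.e. $R_\nabla^{--}(X,Y)Z\in T_xL$ for all $Z\in T_xM$. -/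

import Mathlib

open Bundle Set Manifold Topology VectorField
open scoped ContDiff

noncomputable section

namespace AlmostComplexNormalBundle

/-! ### Almost complex structures -/

section AlmostComplex

variable {E : Type*} [NormedAddCommGroup E] [NormedSpace ℝ E]
  {H : Type*} [TopologicalSpace H] (I : ModelWithCorners ℝ E H)
  (M : Type*) [TopologicalSpace M] [ChartedSpace H M]

/-- Fields of endomorphisms of the tangent spaces of `M` (no regularity imposed). -/
abbrev EndField : Type _ := Π x : M, TangentSpace I x →L[ℝ] TangentSpace I x

/-- Operators sending a vector field `Y` to the field `X ↦ ∇_X Y` of endomorphisms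
(the value `cov Y x v` is `∇_v Y` at the point `x`). -/
abbrev ConnectionOp : Type _ :=
  (Π x : M, TangentSpace I x) → (Π x : M, TangentSpace I x →L[ℝ] TangentSpace I x)

variable {I M}

/-- The vector field `J X`. -/
def EndField.app (J : EndField I M) (X : Π x : M, TangentSpace I x) :
    Π x : M, TangentSpace I x := fun x => J x (X x)

/-- `J` is an almost complex structure: a smooth field of endomorphisms with `J² = -1`. -/
structure IsAlmostComplex [IsManifold I ∞ M] (J : EndField I M) : Prop where
  sq : ∀ (x : M) (v : TangentSpace I x), J x (J x v) = -v
  smooth : ContMDiff I (I.prod 𝓘(ℝ, E →L[ℝ] E)) ∞ fun x =>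
    (⟨x, J x⟩ : TotalSpace (E →L[ℝ] E) fun x : M => TangentSpace I x →L[ℝ] TangentSpace I x)

/-- `J` is integrable: around every point there are smooth coordinates identifying `J` with a
constant complex structure `J₀` of the model vector space, i.e. holomorphic coordinates. -/
def IsIntegrable (J : EndField I M) : Prop :=
  ∀ x : M, ∃ φ ∈ IsManifold.maximalAtlas I ∞ M, x ∈ φ.source ∧
    ∃ J₀ : E →L[ℝ] E, (∀ w, J₀ (J₀ w) = -w) ∧
      ∀ y ∈ φ.source, ∀ v : TangentSpace I y,
        mfderiv I 𝓘(ℝ, E) (φ.extend I) y (J y v) = J₀ (mfderiv I 𝓘(ℝ, E) (φ.extend I) y v)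

/-- The Nijenhuis tensor `[JX, JY] - J[JX, Y] - J[X, JY] - [X, Y]`. -/
def nijenhuis (J : EndField I M) (X Y : Π x : M, TangentSpace I x) (x : M) : TangentSpace I x :=
  mlieBracket I (J.app X) (J.app Y) x - J x (mlieBracket I (J.app X) Y x)
    - J x (mlieBracket I X (J.app Y) x) - mlieBracket I X Y x

/-- A smooth linear connection on `U` is minimal if `∇J = 0` and its torsion is `N_J / 4`. -/
structure IsMinimalConnectionOn [IsManifold I ∞ M] (J : EndField I M) (U : Set M)
    (cov : ConnectionOp I M) : Prop where
  isCovariantDerivativeOn : IsCovariantDerivativeOn E cov U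
  smooth : ContMDiffCovariantDerivativeOn E ∞ cov U
  parallel : ∀ x ∈ U, ∀ Y : Π x : M, TangentSpace I x, MDiffAt (T% Y) x →
    ∀ v : TangentSpace I x, cov (J.app Y) x v = J x (cov Y x v)
  torsion : ∀ x ∈ U, ∀ X Y : Π x : M, TangentSpace I x, MDiffAt (T% X) x → MDiffAt (T% Y) x →
    cov Y x (X x) - cov X x (Y x) - mlieBracket I X Y x = (1 / 4 : ℝ) • nijenhuis J X Y x

/-- The curvature `R(X, Y)Z = ∇_X ∇_Y Z - ∇_Y ∇_X Z - ∇_[X,Y] Z`. -/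
def curvature (cov : ConnectionOp I M) (X Y Z : Π x : M, TangentSpace I x) (x : M) :
    TangentSpace I x :=
  cov (fun y => cov Z y (Y y)) x (X x) - cov (fun y => cov Z y (X y)) x (Y x)
    - cov Z x (mlieBracket I X Y x)

/-- The part `R⁻⁻(X, Y)Z` of the curvature which is `J`-antilinear in `X` and in `Y`. -/
def curvatureAntilinear (J : EndField I M) (cov : ConnectionOp I M)
    (X Y Z : Π x : M, TangentSpace I x) (x : M) : TangentSpace I x :=
  (1 / 4 : ℝ) • (curvature cov X Y Z x + J x (curvature cov (J.app X) Y Z x)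
    + J x (curvature cov X (J.app Y) Z x) - curvature cov (J.app X) (J.app Y) Z x)

variable {E' : Type*} [NormedAddCommGroup E'] [NormedSpace ℝ E']
  {H' : Type*} [TopologicalSpace H'] {I' : ModelWithCorners ℝ E' H'}
  {M' : Type*} [TopologicalSpace M'] [ChartedSpace H' M']

/-- Pseudoholomorphic maps: smooth maps whose differential intertwines the structures. -/
def IsPseudoholomorphic (J : EndField I M) (J' : EndField I' M') (f : M → M') : Prop :=
  ContMDiff I I' ∞ f ∧
    ∀ (x : M) (v : TangentSpace I x), mfderiv I I' f x (J x v) = J' (f x) (mfderiv I I' f x v)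

end AlmostComplex

/-! ### The normal bundle -/

section NormalBundle

variable {E E' F : Type*} [NormedAddCommGroup E] [NormedSpace ℝ E]
  [NormedAddCommGroup E'] [NormedSpace ℝ E'] [NormedAddCommGroup F] [NormedSpace ℝ F]
  {M : Type*} [TopologicalSpace M] [ChartedSpace E M]
  {L : Type*} [TopologicalSpace L] [ChartedSpace E' L]

/-- The subspace `T_x L`, seen inside `T_{ι x} M`. -/
def tangentImage (ι : L → M) (x : L) : Submodule ℝ (TangentSpace 𝓘(ℝ, E) (ι x)) :=
  LinearMap.range (mfderiv 𝓘(ℝ, E') 𝓘(ℝ, E) ι x).toLinearMap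

variable {ι : L → M}

/-- The fibre `T_{ι x} M / T_x L` of the normal bundle of the immersed submanifold `ι : L → M`.
The type `F` is a model for the fibres; the immersion `hι` enters only through the vector bundle
structure below. -/
def NormalFibre (_hι : IsImmersionOfComplement F 𝓘(ℝ, E') 𝓘(ℝ, E) ∞ ι) (x : L) : Type _ :=
  TangentSpace 𝓘(ℝ, E) (ι x) ⧸ tangentImage (E := E) (E' := E') ι x

variable (hι : IsImmersionOfComplement F 𝓘(ℝ, E') 𝓘(ℝ, E) ∞ ι)

instance (x : L) : AddCommGroup (NormalFibre hι x) :=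
  inferInstanceAs (AddCommGroup (TangentSpace 𝓘(ℝ, E) (ι x) ⧸ tangentImage (E' := E') ι x))

instance (x : L) : Module ℝ (NormalFibre hι x) :=
  inferInstanceAs (Module ℝ (TangentSpace 𝓘(ℝ, E) (ι x) ⧸ tangentImage (E' := E') ι x))

instance (x : L) : TopologicalSpace (NormalFibre hι x) :=
  inferInstanceAs (TopologicalSpace (TangentSpace 𝓘(ℝ, E) (ι x) ⧸ tangentImage (E' := E') ι x))

/-- The projection `T_{ι x} M → (N_L M)_x`. -/
def normalMk (x : L) : TangentSpace 𝓘(ℝ, E) (ι x) →ₗ[ℝ] NormalFibre hι x :=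
  (tangentImage (E := E) (E' := E') ι x).mkQ

theorem normalMk_surjective (x : L) : Function.Surjective (normalMk hι x) :=
  Submodule.mkQ_surjective _

theorem continuous_normalMk (x : L) : Continuous (normalMk hι x) :=
  continuous_quot_mk

theorem normalMk_eq_zero {x : L} {v : TangentSpace 𝓘(ℝ, E) (ι x)} :
    normalMk hι x v = 0 ↔ v ∈ tangentImage (E := E) (E' := E') ι x :=
  Submodule.Quotient.mk_eq_zero _

/-- The differential of the slice chart of `M` at `p`, in which `L` is `E' × 0`, followed by the
projection to the transversal factor `F`. -/
def sliceFwd (p x : L) : TangentSpace 𝓘(ℝ, E) (ι x) →L[ℝ] F :=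
  ((ContinuousLinearMap.snd ℝ E' F).comp ((hι.isImmersionAt p).equiv.symm : E →L[ℝ] E' × F)).comp
    (mfderiv 𝓘(ℝ, E) 𝓘(ℝ, E) (hι.isImmersionAt p).codChart (ι x) : E →L[ℝ] E)

/-- A right inverse of `sliceFwd`: the differential of the inverse slice chart on `0 × F`. -/
def sliceBwd (p x : L) : F →L[ℝ] TangentSpace 𝓘(ℝ, E) (ι x) :=
  (mfderiv 𝓘(ℝ, E) 𝓘(ℝ, E) (hι.isImmersionAt p).codChart.symm ((hι.isImmersionAt p).codChart (ι x)) : E →L[ℝ] E).comp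
    (((hι.isImmersionAt p).equiv : E' × F →L[ℝ] E).comp (ContinuousLinearMap.inr ℝ E' F))

theorem mdifferentiable_of_mem_maximalAtlas {e : OpenPartialHomeomorph M E}
    (h : e ∈ IsManifold.maximalAtlas 𝓘(ℝ, E) ∞ M) : e.MDifferentiable 𝓘(ℝ, E) 𝓘(ℝ, E) :=
  ⟨(contMDiffOn_of_mem_maximalAtlas h).mdifferentiableOn (by simp),
    (contMDiffOn_symm_of_mem_maximalAtlas h).mdifferentiableOn (by simp)⟩

theorem map_mem_codChart {p x : L} (hx : x ∈ (hι.isImmersionAt p).domChart.source) :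
    ι x ∈ (hι.isImmersionAt p).codChart.source := (hι.isImmersionAt p).source_subset_preimage_source hx

theorem sliceFwd_sliceBwd {p x : L} (hx : x ∈ (hι.isImmersionAt p).domChart.source) (w : F) :
    sliceFwd hι p x (sliceBwd hι p x w) = w := by
  have hd := mdifferentiable_of_mem_maximalAtlas (hι.isImmersionAt p).codChart_mem_maximalAtlas
  have hx' := map_mem_codChart hι hx
  have h := (hd.mfderiv hx').apply_symm_apply ((hι.isImmersionAt p).equiv (0, w))
  have h2 : sliceFwd hι p x (sliceBwd hι p x w) = ((hι.isImmersionAt p).equiv.symm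
    ((hd.mfderiv hx') ((hd.mfderiv hx').symm ((hι.isImmersionAt p).equiv (0, w))))).2 := rfl
  rw [h2, h]
  simp

theorem sliceFwd_eq_zero {p x : L} (hx : x ∈ (hι.isImmersionAt p).domChart.source)
    (v : TangentSpace 𝓘(ℝ, E) (ι x)) :
    sliceFwd hι p x v = 0 ↔ v ∈ tangentImage (E := E) (E' := E') ι x := by
  have hd := mdifferentiable_of_mem_maximalAtlas (hι.isImmersionAt p).codChart_mem_maximalAtlas
  have hd' := mdifferentiable_of_mem_maximalAtlas (hι.isImmersionAt p).domChart_mem_maximalAtlas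
  have hx' := map_mem_codChart hι hx
  have hmd : MDifferentiableAt 𝓘(ℝ, E') 𝓘(ℝ, E) ι x :=
    (hι.contMDiff x).mdifferentiableAt (by simp)
  have key : ∀ u : E', (hd.mfderiv hx' (mfderiv 𝓘(ℝ, E') 𝓘(ℝ, E) ι x u) : E) =
      (hι.isImmersionAt p).equiv ((hd'.mfderiv hx u : E'), (0 : F)) := by
    intro u
    have hev : (hι.isImmersionAt p).codChart ∘ ι =ᶠ[𝓝 x]
        fun y => ((hι.isImmersionAt p).equiv : E' × F →L[ℝ] E).comp (ContinuousLinearMap.inl ℝ E' F)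
          ((hι.isImmersionAt p).domChart y) := by
      filter_upwards [(hι.isImmersionAt p).domChart.open_source.mem_nhds hx] with y hy
      have := (hι.isImmersionAt p).writtenInCharts
        (((hι.isImmersionAt p).domChart.extend 𝓘(ℝ, E')).map_source
          (by simpa using hy))
      simpa [hy] using this
    have h1 : mfderiv 𝓘(ℝ, E') 𝓘(ℝ, E) ((hι.isImmersionAt p).codChart ∘ ι) x =
        (mfderiv 𝓘(ℝ, E) 𝓘(ℝ, E) (hι.isImmersionAt p).codChart (ι x)).comp
          (mfderiv 𝓘(ℝ, E') 𝓘(ℝ, E) ι x) :=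
      mfderiv_comp x (hd.mdifferentiableAt hx') hmd
    have h2 : mfderiv 𝓘(ℝ, E') 𝓘(ℝ, E)
        (fun y => ((hι.isImmersionAt p).equiv : E' × F →L[ℝ] E).comp (ContinuousLinearMap.inl ℝ E' F)
          ((hι.isImmersionAt p).domChart y)) x =
        (((hι.isImmersionAt p).equiv : E' × F →L[ℝ] E).comp (ContinuousLinearMap.inl ℝ E' F)).comp
          (mfderiv 𝓘(ℝ, E') 𝓘(ℝ, E') (hι.isImmersionAt p).domChart x) := by
      have := (((hι.isImmersionAt p).equiv : E' × F →L[ℝ] E).comp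
        (ContinuousLinearMap.inl ℝ E' F)).hasMFDerivAt (x := (hι.isImmersionAt p).domChart x)
      exact (this.comp x (hd'.mdifferentiableAt hx).hasMFDerivAt).mfderiv
    rw [hev.mfderiv_eq, h2] at h1
    exact (DFunLike.congr_fun h1 u).symm
  constructor
  · intro h
    set z : E' × F := (hι.isImmersionAt p).equiv.symm (hd.mfderiv hx' v) with hz
    have hz2 : z.2 = 0 := h
    have hz3 : (hι.isImmersionAt p).equiv (z.1, 0) = (hd.mfderiv hx' v : E) := by
      rw [← hz2, Prod.mk.eta]
      exact ContinuousLinearEquiv.apply_symm_apply _ _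
    refine ⟨(hd'.mfderiv hx).symm z.1, ?_⟩
    apply (hd.mfderiv hx').injective
    refine (key _).trans (Eq.trans ?_ hz3)
    exact congrArg (fun t => (hι.isImmersionAt p).equiv (t, (0 : F)))
      ((hd'.mfderiv hx).apply_symm_apply z.1)
  · rintro ⟨u, rfl⟩
    have h2 : sliceFwd hι p x (mfderiv 𝓘(ℝ, E') 𝓘(ℝ, E) ι x u) = ((hι.isImmersionAt p).equiv.symm
      (hd.mfderiv hx' (mfderiv 𝓘(ℝ, E') 𝓘(ℝ, E) ι x u))).2 := rfl
    exact h2.trans (by rw [key u]; simp)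

/-- The fibrewise coordinate in the slice charts at `p`: on the domain of the slice charts it
sends the class of `v` to `sliceFwd hι p x v`. -/
def sliceCoord (p x : L) (n : NormalFibre hι x) : F :=
  sliceFwd hι p x (Function.surjInv (normalMk_surjective hι x) n)

theorem sliceCoord_mk {p x : L} (hx : x ∈ (hι.isImmersionAt p).domChart.source)
    (v : TangentSpace 𝓘(ℝ, E) (ι x)) :
    sliceCoord hι p x (normalMk hι x v) = sliceFwd hι p x v := by
  rw [← sub_eq_zero]
  refine ((sliceFwd hι p x).map_sub _ _).symm.trans ?_
  rw [sliceFwd_eq_zero hι hx, ← normalMk_eq_zero hι, map_sub, Function.surjInv_eq (normalMk_surjective hι x), sub_self]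

theorem mk_sliceBwd {p x : L} (hx : x ∈ (hι.isImmersionAt p).domChart.source)
    (n : NormalFibre hι x) :
    normalMk hι x (sliceBwd hι p x (sliceCoord hι p x n)) = n := by
  obtain ⟨v, rfl⟩ := normalMk_surjective hι x n
  rw [sliceCoord_mk hι hx, ← sub_eq_zero, ← map_sub, normalMk_eq_zero, ← sliceFwd_eq_zero hι hx]
  refine ((sliceFwd hι p x).map_sub _ _).trans ?_
  rw [sliceFwd_sliceBwd hι hx, sub_self]

/-- The trivialization of the normal bundle over the slice chart at `p`. -/
def slicePretrivialization (p : L) : Pretrivialization F (π F (NormalFibre hι)) where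
  toFun a := (a.1, sliceCoord hι p a.1 a.2)
  invFun b := ⟨b.1, normalMk hι b.1 (sliceBwd hι p b.1 b.2)⟩
  source := π F (NormalFibre hι) ⁻¹' (hι.isImmersionAt p).domChart.source
  target := (hι.isImmersionAt p).domChart.source ×ˢ univ
  map_source' a ha := ⟨ha, mem_univ _⟩
  map_target' b hb := hb.1
  left_inv' := by
    rintro ⟨x, n⟩ hx
    have := mk_sliceBwd hι hx n
    exact congrArg (TotalSpace.mk x) this
  right_inv' := by
    rintro ⟨x, w⟩ ⟨hx, -⟩
    simp only [sliceCoord_mk hι hx, sliceFwd_sliceBwd hι hx]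
  open_target := (hι.isImmersionAt p).domChart.open_source.prod isOpen_univ
  baseSet := (hι.isImmersionAt p).domChart.source
  open_baseSet := (hι.isImmersionAt p).domChart.open_source
  source_eq := rfl
  target_eq := rfl
  proj_toFun _ _ := rfl

/-- The transition functions. -/
def sliceChange (p q x : L) : F →L[ℝ] F := (sliceFwd hι q x).comp (sliceBwd hι p x)

theorem slice_coordChange {p q x : L}
    (hx : x ∈ (hι.isImmersionAt p).domChart.source ∩ (hι.isImmersionAt q).domChart.source)
    (w : F) : sliceChange hι p q x w =
      (slicePretrivialization hι q ⟨x, (slicePretrivialization hι p).symm x w⟩).2 := by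
  have : (slicePretrivialization hι p).symm x w = normalMk hι x (sliceBwd hι p x w) :=
    (slicePretrivialization hι p).symm_apply (b := x) hx.1 w
  rw [this]
  exact (sliceCoord_mk hι hx.2 _).symm

theorem contMDiffOn_sliceChange (p q : L) :
    ContMDiffOn 𝓘(ℝ, E') 𝓘(ℝ, F →L[ℝ] F) ∞ (sliceChange hι p q)
      ((hι.isImmersionAt p).domChart.source ∩ (hι.isImmersionAt q).domChart.source) := by
  set ψ := (hι.isImmersionAt p).codChart with hψ
  set ψ' := (hι.isImmersionAt q).codChart with hψ'
  have hmem := (hι.isImmersionAt p).codChart_mem_maximalAtlas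
  have hmem' := (hι.isImmersionAt q).codChart_mem_maximalAtlas
  have hd := mdifferentiable_of_mem_maximalAtlas hmem
  have hd' := mdifferentiable_of_mem_maximalAtlas hmem'
  have hs : ContDiffOn ℝ ∞ (ψ' ∘ ψ.symm) (ψ.symm.trans ψ').source := by
    rw [← contMDiffOn_iff_contDiffOn]
    refine (contMDiffOn_of_mem_maximalAtlas hmem').comp
      ((contMDiffOn_symm_of_mem_maximalAtlas hmem).mono ?_) ?_
    · intro y hy; exact hy.1
    · intro y hy; exact hy.2
  have hfd : ContDiffOn ℝ ∞ (fderiv ℝ (ψ' ∘ ψ.symm)) (ψ.symm.trans ψ').source :=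
    hs.fderiv_of_isOpen (ψ.symm.trans ψ').open_source (by simp)
  have hb : ContMDiffOn 𝓘(ℝ, E') 𝓘(ℝ, E) ∞ (ψ ∘ ι)
      ((hι.isImmersionAt p).domChart.source ∩ (hι.isImmersionAt q).domChart.source) :=
    (contMDiffOn_of_mem_maximalAtlas hmem).comp hι.contMDiff.contMDiffOn
      (fun x hx => map_mem_codChart hι hx.1)
  have hc : ContMDiffOn 𝓘(ℝ, E') 𝓘(ℝ, E →L[ℝ] E) ∞ (fderiv ℝ (ψ' ∘ ψ.symm) ∘ (ψ ∘ ι))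
      ((hι.isImmersionAt p).domChart.source ∩ (hι.isImmersionAt q).domChart.source) := by
    refine hfd.contMDiffOn.comp hb ?_
    intro x hx
    have h1 : ι x ∈ ψ.source := map_mem_codChart hι hx.1
    have h2 : ι x ∈ ψ'.source := map_mem_codChart hι hx.2
    simp [h1, h2]
  have hlin : ContMDiff 𝓘(ℝ, E →L[ℝ] E) 𝓘(ℝ, F →L[ℝ] F) ∞ (fun A : E →L[ℝ] E =>
      ((ContinuousLinearMap.snd ℝ E' F).comp
        ((hι.isImmersionAt q).equiv.symm : E →L[ℝ] E' × F)).comp (A.comp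
        (((hι.isImmersionAt p).equiv : E' × F →L[ℝ] E).comp
          (ContinuousLinearMap.inr ℝ E' F)))) := by
    rw [contMDiff_iff_contDiff]
    exact contDiff_const.clm_comp (contDiff_id.clm_comp contDiff_const)
  refine (hlin.comp_contMDiffOn hc).congr ?_
  intro x hx
  have h1 : ι x ∈ ψ.source := map_mem_codChart hι hx.1
  have h2 : ι x ∈ ψ'.source := map_mem_codChart hι hx.2
  have h3 : mfderiv 𝓘(ℝ, E) 𝓘(ℝ, E) (ψ' ∘ ψ.symm) (ψ (ι x)) =
      (mfderiv 𝓘(ℝ, E) 𝓘(ℝ, E) ψ' (ψ.symm (ψ (ι x)))).comp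
        (mfderiv 𝓘(ℝ, E) 𝓘(ℝ, E) ψ.symm (ψ (ι x))) :=
    mfderiv_comp _ (hd'.mdifferentiableAt (by rw [ψ.left_inv h1]; exact h2))
      (hd.mdifferentiableAt_symm (ψ.map_source h1))
  rw [mfderiv_eq_fderiv, ψ.left_inv h1] at h3
  simp only [Function.comp_apply]
  rw [Function.comp_def] at h3 ⊢
  rw [h3]
  rfl

/-- The normal bundle as a smooth vector bundle over `L`, glued from the slice charts. -/
def normalPrebundle : VectorPrebundle ℝ F (NormalFibre hι) where
  pretrivializationAtlas := range (slicePretrivialization hι)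
  pretrivialization_linear' := by
    rintro _ ⟨p, rfl⟩
    refine ⟨fun x hx => ⟨fun m n => ?_, fun c n => ?_⟩⟩
    · obtain ⟨v, rfl⟩ := normalMk_surjective hι x m
      obtain ⟨w, rfl⟩ := normalMk_surjective hι x n
      rw [← map_add]
      refine (sliceCoord_mk hι hx _).trans ?_
      refine Eq.trans ?_ (congrArg₂ _ (sliceCoord_mk hι hx v) (sliceCoord_mk hι hx w)).symm
      exact (sliceFwd hι p x).map_add v w
    · obtain ⟨v, rfl⟩ := normalMk_surjective hι x n
      rw [← map_smul]
      refine (sliceCoord_mk hι hx _).trans ?_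
      refine Eq.trans ?_ (congrArg _ (sliceCoord_mk hι hx v)).symm
      exact (sliceFwd hι p x).map_smul c v
  pretrivializationAt := slicePretrivialization hι
  mem_base_pretrivializationAt p := (hι.isImmersionAt p).mem_domChart_source
  pretrivialization_mem_atlas p := ⟨p, rfl⟩
  exists_coordChange := by
    rintro _ ⟨p, rfl⟩ _ ⟨q, rfl⟩
    exact ⟨sliceChange hι p q, (contMDiffOn_sliceChange hι p q).continuousOn,
      fun x hx w => slice_coordChange hι hx w⟩
  totalSpaceMk_isInducing p := by
    have hp := (hι.isImmersionAt p).mem_domChart_source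
    have hcoord : Continuous (sliceCoord hι p p) := by
      refine continuous_coinduced_dom.2 ?_
      exact (sliceFwd hι p p).continuous.congr fun v => (sliceCoord_mk hι hp v).symm
    have hinv : Continuous fun w : F => normalMk hι p (sliceBwd hι p p w) :=
      (continuous_normalMk hι p).comp (sliceBwd hι p p).continuous
    have h1 : IsInducing (sliceCoord hι p p) :=
      (Homeomorph.mk ⟨sliceCoord hι p p, fun w => normalMk hι p (sliceBwd hι p p w),
        fun n => mk_sliceBwd hι hp n, fun w => by
          rw [sliceCoord_mk hι hp, sliceFwd_sliceBwd hι hp]⟩ hcoord hinv).isInducing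
    exact (isInducing_const_prod (x := p)).2 h1

instance : (normalPrebundle hι).IsContMDiff 𝓘(ℝ, E') ∞ where
  exists_contMDiffCoordChange := by
    rintro _ ⟨p, rfl⟩ _ ⟨q, rfl⟩
    exact ⟨sliceChange hι p q, contMDiffOn_sliceChange hι p q,
      fun x hx w => slice_coordChange hι hx w⟩

instance : TopologicalSpace (TotalSpace F (NormalFibre hι)) :=
  (normalPrebundle hι).totalSpaceTopology

instance : FiberBundle F (NormalFibre hι) := (normalPrebundle hι).toFiberBundle

instance : VectorBundle ℝ F (NormalFibre hι) := (normalPrebundle hι).toVectorBundle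

instance : ContMDiffVectorBundle ∞ F (NormalFibre hι) 𝓘(ℝ, E') :=
  (normalPrebundle hι).contMDiffVectorBundle 𝓘(ℝ, E')

end NormalBundle

/-! ### Connections along a submanifold and the structure they induce on its normal bundle -/

section Induced

variable {E E' F : Type*} [NormedAddCommGroup E] [NormedSpace ℝ E]
  [NormedAddCommGroup E'] [NormedSpace ℝ E'] [NormedAddCommGroup F] [NormedSpace ℝ F]
  {M : Type*} [TopologicalSpace M] [ChartedSpace E M]
  {L : Type*} [TopologicalSpace L] [ChartedSpace E' L]

/-- The restriction `J|_L` of `J` to a submanifold `ι : L → M` with `J`-invariant tangent spaces: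
`dι (J|_L u) = J (dι u)`. -/
def restrictedStructure [FiniteDimensional ℝ E'] (J : EndField 𝓘(ℝ, E) M) (ι : L → M) :
    EndField 𝓘(ℝ, E') L := fun x =>
  let dι : E' →L[ℝ] E := mfderiv 𝓘(ℝ, E') 𝓘(ℝ, E) ι x
  let Jx : E →L[ℝ] E := J (ι x)
  let JL : E' →L[ℝ] E' := LinearMap.toContinuousLinearMap
    (dι.toLinearMap.leftInverse ∘ₗ Jx.toLinearMap ∘ₗ dι.toLinearMap)
  JL

/-- `L` is totally geodesic for the connection `cov` on `U`: `∇_X Y` is tangent to `L` for `X`, `Y`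
tangent to `L`, i.e. `∇`-parallel transport along `L` preserves `TL`. -/
def IsTotallyGeodesicOn [IsManifold 𝓘(ℝ, E) ∞ M] (ι : L → M) (U : Set M) (cov : ConnectionOp 𝓘(ℝ, E) M) : Prop :=
  ∀ x : L, ι x ∈ U → ∀ Y : Π y : M, TangentSpace 𝓘(ℝ, E) y,
    MDiffAt (T% Y) (ι x) →
    (∀ᶠ z in 𝓝 x, Y (ι z) ∈ tangentImage (E := E) (E' := E') ι z) →
    ∀ v ∈ tangentImage (E := E) (E' := E') ι x,
      cov Y (ι x) v ∈ tangentImage (E := E) (E' := E') ι x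

/-- The connection is flat on `L`: its restriction to `TL` has vanishing curvature. -/
def IsFlatAlong [IsManifold 𝓘(ℝ, E) ∞ M] (ι : L → M) (U : Set M)
    (cov : ConnectionOp 𝓘(ℝ, E) M) : Prop :=
  ∀ X Y Z : Π y : M, TangentSpace 𝓘(ℝ, E) y,
    CMDiff[U] ∞ (T% X) →
    CMDiff[U] ∞ (T% Y) →
    CMDiff[U] ∞ (T% Z) →
    ∀ x : L, ι x ∈ U →
      X (ι x) ∈ tangentImage (E := E) (E' := E') ι x →
      Y (ι x) ∈ tangentImage (E := E) (E' := E') ι x →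
      Z (ι x) ∈ tangentImage (E := E) (E' := E') ι x →
      curvature cov X Y Z (ι x) = 0

variable {ι : L → M} (hι : IsImmersionOfComplement F 𝓘(ℝ, E') 𝓘(ℝ, E) ∞ ι)

/-- For `X`, `Y` tangent to `L` the operator `R⁻⁻(X, Y)` vanishes on the normal bundle of `L`. -/
def NormalCurvatureAntilinearVanishes [IsManifold 𝓘(ℝ, E) ∞ M] (J : EndField 𝓘(ℝ, E) M)
    (U : Set M) (cov : ConnectionOp 𝓘(ℝ, E) M) : Prop :=
  ∀ X Y Z : Π y : M, TangentSpace 𝓘(ℝ, E) y,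
    CMDiff[U] ∞ (T% X) →
    CMDiff[U] ∞ (T% Y) →
    CMDiff[U] ∞ (T% Z) →
    ∀ x : L, ι x ∈ U →
      X (ι x) ∈ tangentImage (E := E) (E' := E') ι x →
      Y (ι x) ∈ tangentImage (E := E) (E' := E') ι x →
      normalMk hι x (curvatureAntilinear J cov X Y Z (ι x)) = 0

/-- The vertical tangent vector at `a` defined by an element `w` of the fibre through `a`. -/
def verticalLift (a : TotalSpace F (NormalFibre hι)) (w : NormalFibre hι a.proj) :
    TangentSpace (𝓘(ℝ, E').prod 𝓘(ℝ, F)) a :=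
  mfderiv 𝓘(ℝ, ℝ) (𝓘(ℝ, E').prod 𝓘(ℝ, F))
    (fun t : ℝ => (⟨a.proj, a.2 + t • w⟩ : TotalSpace F (NormalFibre hι))) 0 (1 : ℝ)

/-- `ξ ∈ T_a (N_L M)` is the horizontal lift of `u ∈ T_x L`, `x = π a`, for the connection that
`cov` induces on the normal bundle: there is a vector field `Θ` whose class along `L` is a section
of the normal bundle through `a` with velocity `ξ` in the direction `u`, and whose class is parallel
at `x` in this direction, i.e. `[∇_u Θ] = 0`. -/
def IsHorizontalLift [IsManifold 𝓘(ℝ, E) ∞ M] (cov : ConnectionOp 𝓘(ℝ, E) M)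
    (a : TotalSpace F (NormalFibre hι))
    (u : TangentSpace 𝓘(ℝ, E') a.proj) (ξ : TangentSpace (𝓘(ℝ, E').prod 𝓘(ℝ, F)) a) : Prop :=
  ∃ Θ : Π y : M, TangentSpace 𝓘(ℝ, E) y,
    MDiffAt (T% Θ) (ι a.proj) ∧
    normalMk hι a.proj (Θ (ι a.proj)) = a.2 ∧
    normalMk hι a.proj (cov Θ (ι a.proj) (mfderiv 𝓘(ℝ, E') 𝓘(ℝ, E) ι a.proj u)) = 0 ∧
    ξ = mfderiv 𝓘(ℝ, E') (𝓘(ℝ, E').prod 𝓘(ℝ, F))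
      (fun z : L => (⟨z, normalMk hι z (Θ (ι z))⟩ : TotalSpace F (NormalFibre hι))) a.proj u

/-- The endomorphism `K` of `T_a (N_L M) = H_a ⊕ V_a` is the direct sum of the complex structure
of `H_a ≅ T_x L` given by `J|_L` and the complex structure of `V_a ≅ T_x M / T_x L` given by `J`,
for the horizontal space `H_a` of the connection induced by `cov`. -/
def IsSplitStructureAt [IsManifold 𝓘(ℝ, E) ∞ M] [FiniteDimensional ℝ E'] (J : EndField 𝓘(ℝ, E) M)
    (cov : ConnectionOp 𝓘(ℝ, E) M) (a : TotalSpace F (NormalFibre hι))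
    (K : TangentSpace (𝓘(ℝ, E').prod 𝓘(ℝ, F)) a →L[ℝ]
      TangentSpace (𝓘(ℝ, E').prod 𝓘(ℝ, F)) a) : Prop :=
  (∀ v : TangentSpace 𝓘(ℝ, E) (ι a.proj),
    K (verticalLift hι a (normalMk hι a.proj v)) =
      verticalLift hι a (normalMk hι a.proj (J (ι a.proj) v))) ∧
  (∀ (u : TangentSpace 𝓘(ℝ, E') a.proj) (ξ : TangentSpace (𝓘(ℝ, E').prod 𝓘(ℝ, F)) a),
    IsHorizontalLift hι cov a u ξ →
      IsHorizontalLift hι cov a (restrictedStructure J ι a.proj u) (K ξ))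

end Induced

end AlmostComplexNormalBundle

end

open AlmostComplexNormalBundle

/-!
Near a point of `L` choose slice coordinates of `M` with values in `E' × F`, in which `L` is the
slice `E' × 0` (`IsSliceCoord`). They induce coordinates of `L` and of the total space of the normal
bundle, and everything is computed in these.

*Minimal connections.* The Kobayashi–Nomizu formula (`minimalSymbol`) corrects the flat connection
of any coordinates to a minimal one. Along `L` it involves only derivatives of `J` in directions
tangent to `L`, applied to vectors tangent to `L`, so in slice coordinates `L` is totally geodesic
(`minimalSymbol_slice`). Both conditions are affine, hence survive gluing by a partition of unity
(`exists_isMinimalConnectionOn_isTotallyGeodesicOn`).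

*The structure of the normal bundle.* Let `j` and `k` be the tangential and normal parts of `J`
along the slice and `Γ` the Christoffel symbol of the connection induced on the normal bundle. The
direct sum structure on horizontal and vertical vectors sends `(u, v)` at `(y, w)` to
`(j u, k v + (k Γ_u - Γ_{j u}) w)`. Two minimal connections differ by a symmetric tensor which is
complex linear, and this does not change `k Γ_u - Γ_{j u}` (`normalTwist_eq_of_isMinimalSymbolAt`).
So the structure is independent of the connection, and it is smooth because `minimalSymbol` is.

*Integrability implies the curvature condition.* If holomorphic coordinates `G` of the normal bundle
exist near a point of the zero section, a complex linear projection onto the tangent space of the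
zero section, composed with `G`, gives holomorphic coordinates of `L`. In slice coordinates
extending these, `J` is constant on vectors tangent to the slice, so the minimal connection of the
coordinates is flat on `L`. Moreover the vertical component of the Nijenhuis tensor of the
structure on the normal bundle, evaluated on coordinate vectors `(u, 0)`, is four times `R⁻⁻`
(`snd_nijenhuisSymbol_splitMatrix`, together with the Gauss equation `snd_curvatureSymbol`), and it
vanishes by the symmetry of the second derivative of `G` (`nijenhuisSymbol_eq_zero`).

*The converse.* In slice coordinates which are holomorphic on `L`, the normal bundle is a complex
vector bundle with a connection whose curvature has no antilinear part. By the theorem of Koszul and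
Malgrange it has a local holomorphic frame (`exists_holomorphic_frame`), whose fibre coordinates
complete the coordinates of `L` to holomorphic coordinates of the total space. The frame solves
`∂̄ h = h α` for a flat antilinear form `α`. This is achieved one complex direction at a time: along
a complex line, `h = 1 + T (h α)` for the Cauchy transform `T`, a right inverse of `∂̄` by the
Cauchy–Pompeiu formula. For small `α` this is solved by a Neumann series
(`exists_dbar_eq_mul_of_small`), and cutoffs and rescaling make `α` small
(`exists_dbar_eq_mul_local`). Flatness keeps the directions already treated solved
(`exists_dbar_eq_mul`).
-/

noncomputable section

set_option linter.unusedSectionVars false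

namespace AlmostComplexNormalBundle

/-! ### Smooth coordinates and the coordinate expressions of tensor fields -/

section Coordinates

variable {E : Type*} [NormedAddCommGroup E] [NormedSpace ℝ E]
  {H : Type*} [TopologicalSpace H]
  {M : Type*} [TopologicalSpace M] [ChartedSpace H M]
  {V : Type*} [NormedAddCommGroup V] [NormedSpace ℝ V]
  {V' : Type*} [NormedAddCommGroup V'] [NormedSpace ℝ V']
  {W : Type*} [NormedAddCommGroup W] [NormedSpace ℝ W]

/-- Smooth coordinates on an open subset of `M`, with values in an arbitrary normed space `V`
(not necessarily the model space of `M`). -/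
structure IsSmoothCoord (I : ModelWithCorners ℝ E H) (Ψ : OpenPartialHomeomorph M V) : Prop where
  contMDiffOn : ContMDiffOn I 𝓘(ℝ, V) ∞ Ψ Ψ.source
  contMDiffOn_symm : ContMDiffOn 𝓘(ℝ, V) I ∞ Ψ.symm Ψ.target

variable (I : ModelWithCorners ℝ E H)

/-- The differential of coordinates at `x`, as a map into the coordinate space. -/
def coordDeriv (Ψ : OpenPartialHomeomorph M V) (x : M) : TangentSpace I x →L[ℝ] V :=
  mfderiv I 𝓘(ℝ, V) Ψ x

/-- The inverse of the differential of coordinates (meaningful on the coordinate domain). -/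
def coordInv (Ψ : OpenPartialHomeomorph M V) (x : M) : V →L[ℝ] TangentSpace I x :=
  (coordDeriv I Ψ x).inverse

/-- The coordinate expression of a vector field. -/
def coordField (Ψ : OpenPartialHomeomorph M V) (Y : Π x : M, TangentSpace I x) (z : V) : V :=
  coordDeriv I Ψ (Ψ.symm z) (Y (Ψ.symm z))

/-- The coordinate expression of a field of endomorphisms. -/
def coordEnd (Ψ : OpenPartialHomeomorph M V)
    (K : Π x : M, TangentSpace I x →L[ℝ] TangentSpace I x) (z : V) : V →L[ℝ] V :=
  (coordDeriv I Ψ (Ψ.symm z)).comp ((K (Ψ.symm z)).comp (coordInv I Ψ (Ψ.symm z)))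

variable {I}
variable {Ψ : OpenPartialHomeomorph M V} {Ψ' : OpenPartialHomeomorph M V'}

namespace IsSmoothCoord

theorem contMDiffAt (h : IsSmoothCoord I Ψ) {x : M} (hx : x ∈ Ψ.source) :
    ContMDiffAt I 𝓘(ℝ, V) ∞ Ψ x :=
  h.contMDiffOn.contMDiffAt (Ψ.open_source.mem_nhds hx)

theorem contMDiffAt_symm (h : IsSmoothCoord I Ψ) {z : V} (hz : z ∈ Ψ.target) :
    ContMDiffAt 𝓘(ℝ, V) I ∞ Ψ.symm z :=
  h.contMDiffOn_symm.contMDiffAt (Ψ.open_target.mem_nhds hz)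

theorem mdifferentiable (h : IsSmoothCoord I Ψ) : Ψ.MDifferentiable I 𝓘(ℝ, V) :=
  ⟨h.contMDiffOn.mdifferentiableOn (by simp), h.contMDiffOn_symm.mdifferentiableOn (by simp)⟩

theorem mdifferentiableAt (h : IsSmoothCoord I Ψ) {x : M} (hx : x ∈ Ψ.source) :
    MDifferentiableAt I 𝓘(ℝ, V) Ψ x :=
  (h.contMDiffAt hx).mdifferentiableAt (by simp)

/-- The differential of smooth coordinates as an isomorphism. -/
def derivEquiv (h : IsSmoothCoord I Ψ) {x : M} (hx : x ∈ Ψ.source) : TangentSpace I x ≃L[ℝ] V :=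
  h.mdifferentiable.mfderiv hx

theorem coe_derivEquiv (h : IsSmoothCoord I Ψ) {x : M} (hx : x ∈ Ψ.source) :
    (h.derivEquiv hx : TangentSpace I x →L[ℝ] V) = coordDeriv I Ψ x := rfl

theorem coordInv_eq (h : IsSmoothCoord I Ψ) {x : M} (hx : x ∈ Ψ.source) :
    coordInv I Ψ x = ((h.derivEquiv hx).symm : V →L[ℝ] TangentSpace I x) := by
  rw [coordInv, ← h.coe_derivEquiv hx, ContinuousLinearMap.inverse_equiv]

theorem coordInv_coordDeriv (h : IsSmoothCoord I Ψ) {x : M} (hx : x ∈ Ψ.source)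
    (v : TangentSpace I x) : coordInv I Ψ x (coordDeriv I Ψ x v) = v := by
  rw [h.coordInv_eq hx, ← h.coe_derivEquiv hx]
  exact (h.derivEquiv hx).symm_apply_apply v

theorem coordDeriv_coordInv (h : IsSmoothCoord I Ψ) {x : M} (hx : x ∈ Ψ.source)
    (v : V) : coordDeriv I Ψ x (coordInv I Ψ x v) = v := by
  rw [h.coordInv_eq hx, ← h.coe_derivEquiv hx]
  exact (h.derivEquiv hx).apply_symm_apply v

theorem coordDeriv_injective (h : IsSmoothCoord I Ψ) {x : M} (hx : x ∈ Ψ.source) :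
    Function.Injective (coordDeriv I Ψ x) :=
  Function.LeftInverse.injective (h.coordInv_coordDeriv hx)

theorem coordInv_eq_mfderiv_symm (h : IsSmoothCoord I Ψ) {z : V} (hz : z ∈ Ψ.target) :
    coordInv I Ψ (Ψ.symm z) = mfderiv 𝓘(ℝ, V) I Ψ.symm z := by
  ext v
  apply h.coordDeriv_injective (Ψ.map_target hz)
  rw [h.coordDeriv_coordInv (Ψ.map_target hz)]
  exact (congrArg (fun A : V →L[ℝ] V => A v) (h.mdifferentiable.comp_symm_deriv hz)).symm

theorem coordEnd_apply (h : IsSmoothCoord I Ψ) {x : M} (hx : x ∈ Ψ.source)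
    (K : Π x : M, TangentSpace I x →L[ℝ] TangentSpace I x) (v : TangentSpace I x) :
    coordEnd I Ψ K (Ψ x) (coordDeriv I Ψ x v) = coordDeriv I Ψ x (K x v) := by
  have : ∀ y, y = x → ∀ v : TangentSpace I x, coordDeriv I Ψ y (K y (coordInv I Ψ y
      (coordDeriv I Ψ x v))) = coordDeriv I Ψ x (K x v) := by
    rintro y rfl v
    rw [h.coordInv_coordDeriv hx]
  exact this _ (Ψ.left_inv hx) v

theorem coordField_apply {x : M} (hx : x ∈ Ψ.source) (Y : Π x : M, TangentSpace I x) :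
    coordField I Ψ Y (Ψ x) = coordDeriv I Ψ x (Y x) := by
  have : ∀ y, y = x → coordDeriv I Ψ y (Y y) = coordDeriv I Ψ x (Y x) := by
    rintro y rfl; rfl
  exact this _ (Ψ.left_inv hx)

theorem coordField_app (h : IsSmoothCoord I Ψ) {z : V} (hz : z ∈ Ψ.target)
    (K : EndField I M) (Y : Π x : M, TangentSpace I x) :
    coordField I Ψ (EndField.app K Y) z = coordEnd I Ψ K z (coordField I Ψ Y z) := by
  simp only [coordField, coordEnd, EndField.app, ContinuousLinearMap.comp_apply,
    h.coordInv_coordDeriv (Ψ.map_target hz)]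

/-- Smoothness of a map out of `M`, read in coordinates. -/
theorem contMDiffAt_iff (h : IsSmoothCoord I Ψ) {n : ℕ∞} {x : M} (hx : x ∈ Ψ.source)
    {f : M → W} :
    ContMDiffAt I 𝓘(ℝ, W) n f x ↔ ContDiffAt ℝ n (f ∘ Ψ.symm) (Ψ x) := by
  have hn : ((n : ℕ∞) : ℕ∞ω) ≤ ∞ := by exact_mod_cast le_top
  have hΨx := Ψ.map_source hx
  rw [← contMDiffAt_iff_contDiffAt]
  constructor
  · intro hf
    refine ContMDiffAt.comp (I' := I) (Ψ x) ?_ ((h.contMDiffAt_symm hΨx).of_le hn)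
    rwa [Ψ.left_inv hx]
  · intro hf
    refine (hf.comp x ((h.contMDiffAt hx).of_le hn)).congr_of_eventuallyEq ?_
    filter_upwards [Ψ.open_source.mem_nhds hx] with y hy
    simp [Ψ.left_inv hy]

theorem mdifferentiableAt_iff (h : IsSmoothCoord I Ψ) {x : M} (hx : x ∈ Ψ.source)
    {f : M → W} :
    MDifferentiableAt I 𝓘(ℝ, W) f x ↔ DifferentiableAt ℝ (f ∘ Ψ.symm) (Ψ x) := by
  have hΨx := Ψ.map_source hx
  rw [← mdifferentiableAt_iff_differentiableAt]
  constructor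
  · intro hf
    refine MDifferentiableAt.comp (I' := I) (Ψ x) ?_ (h.mdifferentiable.mdifferentiableAt_symm hΨx)
    rwa [Ψ.left_inv hx]
  · intro hf
    refine (hf.comp x (h.mdifferentiableAt hx)).congr_of_eventuallyEq ?_
    filter_upwards [Ψ.open_source.mem_nhds hx] with y hy
    simp [Ψ.left_inv hy]

/-! Changes of coordinates. -/

theorem contDiffOn_change (h : IsSmoothCoord I Ψ) (h' : IsSmoothCoord I Ψ') :
    ContDiffOn ℝ ∞ (Ψ' ∘ Ψ.symm) (Ψ.symm.trans Ψ').source := by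
  rw [← contMDiffOn_iff_contDiffOn]
  exact h'.contMDiffOn.comp (h.contMDiffOn_symm.mono fun y hy => by simpa using hy.1)
    fun y hy => hy.2

theorem coordDeriv_coordInv_change (h : IsSmoothCoord I Ψ) (h' : IsSmoothCoord I Ψ') {z : V}
    (hz : z ∈ (Ψ.symm.trans Ψ').source) :
    (coordDeriv I Ψ' (Ψ.symm z)).comp (coordInv I Ψ (Ψ.symm z)) =
      fderiv ℝ (Ψ' ∘ Ψ.symm) z := by
  rw [h.coordInv_eq_mfderiv_symm (by simpa using hz.1), ← mfderiv_eq_fderiv]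
  exact (mfderiv_comp z (h'.mdifferentiable.mdifferentiableAt hz.2)
    (h.mdifferentiable.mdifferentiableAt_symm (by simpa using hz.1))).symm

theorem contDiffAt_fderiv_change (h : IsSmoothCoord I Ψ) (h' : IsSmoothCoord I Ψ') {z : V}
    (hz : z ∈ (Ψ.symm.trans Ψ').source) :
    ContDiffAt ℝ ∞ (fderiv ℝ (Ψ' ∘ Ψ.symm)) z :=
  ((h.contDiffOn_change h').fderiv_of_isOpen (Ψ.symm.trans Ψ').open_source (by simp)).contDiffAt
    ((Ψ.symm.trans Ψ').open_source.mem_nhds hz)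

theorem contDiffAt_change (h : IsSmoothCoord I Ψ) (h' : IsSmoothCoord I Ψ') {z : V}
    (hz : z ∈ (Ψ.symm.trans Ψ').source) :
    ContDiffAt ℝ ∞ (Ψ' ∘ Ψ.symm) z :=
  (h.contDiffOn_change h').contDiffAt ((Ψ.symm.trans Ψ').open_source.mem_nhds hz)

theorem coordField_change (h : IsSmoothCoord I Ψ) (h' : IsSmoothCoord I Ψ') {z : V}
    (hz : z ∈ (Ψ.symm.trans Ψ').source) (Y : Π x : M, TangentSpace I x) :
    coordField I Ψ' Y (Ψ' (Ψ.symm z)) = fderiv ℝ (Ψ' ∘ Ψ.symm) z (coordField I Ψ Y z) := by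
  rw [coordField_apply (x := Ψ.symm z) hz.2, ← h.coordDeriv_coordInv_change h' hz, coordField,
    ContinuousLinearMap.comp_apply, h.coordInv_coordDeriv (Ψ.map_target (by simpa using hz.1))]

theorem coordEnd_change (h : IsSmoothCoord I Ψ) (h' : IsSmoothCoord I Ψ') {z : V}
    (hz : z ∈ (Ψ.symm.trans Ψ').source)
    (K : Π x : M, TangentSpace I x →L[ℝ] TangentSpace I x) :
    coordEnd I Ψ' K (Ψ' (Ψ.symm z)) = (fderiv ℝ (Ψ' ∘ Ψ.symm) z).comp ((coordEnd I Ψ K z).comp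
      (fderiv ℝ (Ψ ∘ Ψ'.symm) (Ψ' (Ψ.symm z)))) := by
  have hz1 : z ∈ Ψ.target := by simpa using hz.1
  have hz2 : Ψ.symm z ∈ Ψ'.source := hz.2
  have hz' : Ψ' (Ψ.symm z) ∈ (Ψ'.symm.trans Ψ).source := by
    refine ⟨by simpa using Ψ'.map_source hz2, ?_⟩
    simp [Ψ'.left_inv hz2, Ψ.map_target hz1]
  rw [← h.coordDeriv_coordInv_change h' hz, ← h'.coordDeriv_coordInv_change h hz']
  ext v
  simp only [ContinuousLinearMap.comp_apply, coordEnd]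
  have hl := Ψ'.left_inv hz2
  generalize Ψ'.symm (Ψ' (Ψ.symm z)) = y at hl
  subst hl
  rw [h.coordInv_coordDeriv (Ψ.map_target hz1), h.coordInv_coordDeriv (Ψ.map_target hz1)]

theorem contDiffAt_coordField_change (h : IsSmoothCoord I Ψ) (h' : IsSmoothCoord I Ψ') {n : ℕ∞}
    {x : M} (hx : x ∈ Ψ.source) (hx' : x ∈ Ψ'.source) {Y : Π x : M, TangentSpace I x}
    (hY : ContDiffAt ℝ n (coordField I Ψ Y) (Ψ x)) :
    ContDiffAt ℝ n (coordField I Ψ' Y) (Ψ' x) := by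
  have hn : ((n : ℕ∞) : ℕ∞ω) ≤ ∞ := by exact_mod_cast le_top
  have hz : Ψ x ∈ (Ψ.symm.trans Ψ').source :=
    ⟨by simpa using Ψ.map_source hx, by simpa [Ψ.left_inv hx] using hx'⟩
  have hz' : Ψ' x ∈ (Ψ'.symm.trans Ψ).source :=
    ⟨by simpa using Ψ'.map_source hx', by simpa [Ψ'.left_inv hx'] using hx⟩
  have hxx : (Ψ ∘ Ψ'.symm) (Ψ' x) = Ψ x := by simp [Ψ'.left_inv hx']
  have key : ContDiffAt ℝ n ((fun z => fderiv ℝ (Ψ' ∘ Ψ.symm) z (coordField I Ψ Y z)) ∘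
      (Ψ ∘ Ψ'.symm)) (Ψ' x) := by
    refine ContDiffAt.comp _ ?_ ((h'.contDiffAt_change h hz').of_le hn)
    rw [hxx]
    exact ((h.contDiffAt_fderiv_change h' hz).of_le hn).clm_apply hY
  refine key.congr_of_eventuallyEq ?_
  filter_upwards [(Ψ'.symm.trans Ψ).open_source.mem_nhds hz'] with w hw
  have hw1 : w ∈ Ψ'.target := by simpa using hw.1
  have hw2 : Ψ'.symm w ∈ Ψ.source := hw.2
  have := h.coordField_change h' (z := Ψ (Ψ'.symm w)) ⟨by simpa using Ψ.map_source hw2, by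
    simpa [Ψ.left_inv hw2] using Ψ'.map_target hw1⟩ Y
  rw [Ψ.left_inv hw2, Ψ'.right_inv hw1] at this
  simpa using this

theorem differentiableAt_coordField_change (h : IsSmoothCoord I Ψ) (h' : IsSmoothCoord I Ψ')
    {x : M} (hx : x ∈ Ψ.source) (hx' : x ∈ Ψ'.source) {Y : Π x : M, TangentSpace I x}
    (hY : DifferentiableAt ℝ (coordField I Ψ Y) (Ψ x)) :
    DifferentiableAt ℝ (coordField I Ψ' Y) (Ψ' x) := by
  have hz : Ψ x ∈ (Ψ.symm.trans Ψ').source :=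
    ⟨by simpa using Ψ.map_source hx, by simpa [Ψ.left_inv hx] using hx'⟩
  have hz' : Ψ' x ∈ (Ψ'.symm.trans Ψ).source :=
    ⟨by simpa using Ψ'.map_source hx', by simpa [Ψ'.left_inv hx'] using hx⟩
  have hxx : (Ψ ∘ Ψ'.symm) (Ψ' x) = Ψ x := by simp [Ψ'.left_inv hx']
  have key : DifferentiableAt ℝ ((fun z => fderiv ℝ (Ψ' ∘ Ψ.symm) z (coordField I Ψ Y z)) ∘
      (Ψ ∘ Ψ'.symm)) (Ψ' x) := by
    refine DifferentiableAt.comp _ ?_ ((h'.contDiffAt_change h hz').differentiableAt (by simp))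
    rw [hxx]
    exact ((h.contDiffAt_fderiv_change h' hz).differentiableAt (by simp)).clm_apply hY
  refine key.congr_of_eventuallyEq ?_
  filter_upwards [(Ψ'.symm.trans Ψ).open_source.mem_nhds hz'] with w hw
  have hw1 : w ∈ Ψ'.target := by simpa using hw.1
  have hw2 : Ψ'.symm w ∈ Ψ.source := hw.2
  have := h.coordField_change h' (z := Ψ (Ψ'.symm w)) ⟨by simpa using Ψ.map_source hw2, by
    simpa [Ψ.left_inv hw2] using Ψ'.map_target hw1⟩ Y
  rw [Ψ.left_inv hw2, Ψ'.right_inv hw1] at this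
  simpa using this

theorem contDiffAt_coordEnd_change (h : IsSmoothCoord I Ψ) (h' : IsSmoothCoord I Ψ') {n : ℕ∞}
    {x : M} (hx : x ∈ Ψ.source) (hx' : x ∈ Ψ'.source)
    {K : Π x : M, TangentSpace I x →L[ℝ] TangentSpace I x}
    (hY : ContDiffAt ℝ n (coordEnd I Ψ K) (Ψ x)) :
    ContDiffAt ℝ n (coordEnd I Ψ' K) (Ψ' x) := by
  have hn : ((n : ℕ∞) : ℕ∞ω) ≤ ∞ := by exact_mod_cast le_top
  have hz : Ψ x ∈ (Ψ.symm.trans Ψ').source :=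
    ⟨by simpa using Ψ.map_source hx, by simpa [Ψ.left_inv hx] using hx'⟩
  have hz' : Ψ' x ∈ (Ψ'.symm.trans Ψ).source :=
    ⟨by simpa using Ψ'.map_source hx', by simpa [Ψ'.left_inv hx'] using hx⟩
  have hxx : (Ψ ∘ Ψ'.symm) (Ψ' x) = Ψ x := by simp [Ψ'.left_inv hx']
  have hc := (h'.contDiffAt_change h hz').of_le hn
  have key : ContDiffAt ℝ n (fun w => (fderiv ℝ (Ψ' ∘ Ψ.symm) ((Ψ ∘ Ψ'.symm) w)).comp
      ((coordEnd I Ψ K ((Ψ ∘ Ψ'.symm) w)).comp (fderiv ℝ (Ψ ∘ Ψ'.symm) w))) (Ψ' x) := by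
    refine ContDiffAt.clm_comp ?_ (ContDiffAt.clm_comp ?_
      ((h'.contDiffAt_fderiv_change h hz').of_le hn))
    · refine ContDiffAt.comp (g := fderiv ℝ (Ψ' ∘ Ψ.symm)) (f := Ψ ∘ Ψ'.symm) (Ψ' x) ?_ hc
      rw [hxx]; exact (h.contDiffAt_fderiv_change h' hz).of_le hn
    · refine ContDiffAt.comp (g := coordEnd I Ψ K) (f := Ψ ∘ Ψ'.symm) (Ψ' x) ?_ hc
      rwa [hxx]
  refine key.congr_of_eventuallyEq ?_
  filter_upwards [(Ψ'.symm.trans Ψ).open_source.mem_nhds hz'] with w hw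
  have hw1 : w ∈ Ψ'.target := by simpa using hw.1
  have hw2 : Ψ'.symm w ∈ Ψ.source := hw.2
  have := h.coordEnd_change h' (z := Ψ (Ψ'.symm w)) ⟨by simpa using Ψ.map_source hw2, by
    simpa [Ψ.left_inv hw2] using Ψ'.map_target hw1⟩ K
  rw [Ψ.left_inv hw2, Ψ'.right_inv hw1] at this
  simpa using this

end IsSmoothCoord

theorem isSmoothCoord_iff_mem_maximalAtlas [IsManifold I ∞ M] {e : OpenPartialHomeomorph M H}
    [I.Boundaryless] :
    IsSmoothCoord I (e.trans I.toHomeomorph.toOpenPartialHomeomorph) ↔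
      e ∈ IsManifold.maximalAtlas I ∞ M := by
  rw [IsManifold.mem_maximalAtlas_iff_contMDiffOn]
  constructor
  · rintro ⟨h1, h2⟩
    constructor
    · have : ContMDiffOn I I ∞ (I.symm ∘ (I ∘ e)) e.source := by
        refine (I.contMDiffOn_symm (n := ∞)).comp (h1.mono (by simp)) fun x _ => ?_
        simp
      exact this.congr fun x hx => by simp
    · have : ContMDiffOn I I ∞ ((e.symm ∘ I.symm) ∘ I) e.target := by
        refine h2.comp (I.contMDiff.contMDiffOn) fun x hx => ?_
        simpa using hx
      exact this.congr fun x hx => by simp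
  · rintro ⟨h1, h2⟩
    constructor
    · exact (I.contMDiff.comp_contMDiffOn h1).mono (by simp)
    · refine h2.comp ((I.contMDiffOn_symm (n := ∞)).mono ?_) fun x hx => ?_
      · intro x _; simp [I.range_eq_univ]
      · simpa using hx

variable (I) in
/-- The preferred chart at `x₀` as smooth coordinates with values in the model vector space. -/
def chartCoord [I.Boundaryless] (x₀ : M) : OpenPartialHomeomorph M E :=
  (chartAt H x₀).trans I.toHomeomorph.toOpenPartialHomeomorph

theorem isSmoothCoord_chartCoord [IsManifold I ∞ M] [I.Boundaryless] (x₀ : M) :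
    IsSmoothCoord I (chartCoord I x₀) :=
  isSmoothCoord_iff_mem_maximalAtlas.2 (IsManifold.chart_mem_maximalAtlas x₀)

theorem chartCoord_source [I.Boundaryless] (x₀ : M) :
    (chartCoord I x₀).source = (chartAt H x₀).source := by
  simp [chartCoord]

theorem mem_chartCoord_source [I.Boundaryless] (x₀ : M) : x₀ ∈ (chartCoord I x₀).source := by
  simp [chartCoord]

theorem coordDeriv_chartCoord [IsManifold I ∞ M] [I.Boundaryless] {x₀ x : M}
    (hx : x ∈ (chartAt H x₀).source) :
    coordDeriv I (chartCoord I x₀) x =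
      (trivializationAt E (TangentSpace I) x₀).continuousLinearMapAt ℝ x := by
  have : IsManifold I 1 M := IsManifold.of_le (n := ∞) (by simp)
  exact (TangentBundle.continuousLinearMapAt_trivializationAt hx).symm

theorem coordInv_chartCoord [IsManifold I ∞ M] [I.Boundaryless] {x₀ x : M}
    (hx : x ∈ (chartAt H x₀).source) :
    coordInv I (chartCoord I x₀) x =
      (trivializationAt E (TangentSpace I) x₀).symmL ℝ x := by
  have : IsManifold I 1 M := IsManifold.of_le (n := ∞) (by simp)
  have hb : x ∈ (trivializationAt E (TangentSpace I) x₀).baseSet := by simpa using hx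
  have hx' : x ∈ (chartCoord I x₀).source := by rwa [chartCoord_source]
  ext v
  apply (isSmoothCoord_chartCoord (I := I) x₀).coordDeriv_injective hx'
  rw [(isSmoothCoord_chartCoord (I := I) x₀).coordDeriv_coordInv hx', coordDeriv_chartCoord hx,
    Trivialization.continuousLinearMapAt_symmL _ hb]

namespace IsSmoothCoord

theorem mlieBracket_vectorSpace (X Y : Π z : V, TangentSpace 𝓘(ℝ, V) z) (z : V) :
    mlieBracket 𝓘(ℝ, V) X Y z = lieBracket ℝ X Y z := by
  rw [← mlieBracketWithin_univ, mlieBracketWithin_eq_lieBracketWithin]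
  exact congrFun (lieBracketWithin_univ (𝕜 := ℝ) (V := X) (W := Y)) z

/-- The Lie bracket in coordinates. -/
theorem coordDeriv_mlieBracket [IsManifold I ∞ M] [FiniteDimensional ℝ E] [FiniteDimensional ℝ V]
    (h : IsSmoothCoord I Ψ) {x : M} (hx : x ∈ Ψ.source)
    {X Y : Π x : M, TangentSpace I x} (hX : MDiffAt (T% X) x) (hY : MDiffAt (T% Y) x) :
    coordDeriv I Ψ x (mlieBracket I X Y x) =
      fderiv ℝ (coordField I Ψ Y) (Ψ x) (coordField I Ψ X (Ψ x)) -
        fderiv ℝ (coordField I Ψ X) (Ψ x) (coordField I Ψ Y (Ψ x)) := by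
  have : CompleteSpace E := FiniteDimensional.complete ℝ E
  have : CompleteSpace V := FiniteDimensional.complete ℝ V
  have : IsManifold I (minSmoothness ℝ 3) M := IsManifold.of_le (n := ∞) (by
    rw [minSmoothness_of_isRCLikeNormedField]; exact ENat.LEInfty.out)
  have hz := Ψ.map_source hx
  have hpull : ∀ Z : Π x : M, TangentSpace I x, ∀ z ∈ Ψ.target,
      mpullback 𝓘(ℝ, V) I Ψ.symm Z z = coordField I Ψ Z z := by
    intro Z z hz
    have h1 : mfderiv 𝓘(ℝ, V) I Ψ.symm z = ((h.derivEquiv (Ψ.map_target hz)).symm :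
        V →L[ℝ] TangentSpace I (Ψ.symm z)) := by
      rw [← h.coordInv_eq_mfderiv_symm hz, h.coordInv_eq]
    rw [mpullback_apply, h1]
    exact DFunLike.congr_fun (ContinuousLinearMap.inverse_equiv
      (h.derivEquiv (Ψ.map_target hz)).symm) (Z (Ψ.symm z))
  have hev : ∀ Z : Π x : M, TangentSpace I x,
      mpullback 𝓘(ℝ, V) I Ψ.symm Z =ᶠ[𝓝 (Ψ x)] coordField I Ψ Z := fun Z => by
    filter_upwards [Ψ.open_target.mem_nhds hz] with z hz using hpull Z z hz
  have hl := Ψ.left_inv hx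
  have key := mpullback_mlieBracket (I := 𝓘(ℝ, V)) (I' := I) (f := Ψ.symm) (x₀ := Ψ x)
    (n := minSmoothness ℝ 2) (V := X) (W := Y) (by rwa [hl]) (by rwa [hl])
    ((h.contMDiffAt_symm hz).of_le (n := ∞)
      (by rw [minSmoothness_of_isRCLikeNormedField]; exact ENat.LEInfty.out)) le_rfl
  rw [hpull _ _ hz, (hev X).mlieBracket_vectorField_eq (hev Y), coordField_apply hx] at key
  rw [key]
  exact mlieBracket_vectorSpace (coordField I Ψ X) (coordField I Ψ Y) (Ψ x)

variable [IsManifold I ∞ M] [I.Boundaryless]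

theorem contMDiffAt_field_iff (h : IsSmoothCoord I Ψ) {n : ℕ∞} {x : M} (hx : x ∈ Ψ.source)
    {Y : Π x : M, TangentSpace I x} :
    CMDiffAt n (T% Y) x ↔ ContDiffAt ℝ n (coordField I Ψ Y) (Ψ x) := by
  have : IsManifold I 1 M := IsManifold.of_le (n := ∞) (by simp)
  have hc := isSmoothCoord_chartCoord (I := I) x
  have hxc := mem_chartCoord_source (I := I) x
  trans ContDiffAt ℝ n (coordField I (chartCoord I x) Y) (chartCoord I x x)
  · rw [contMDiffAt_section, hc.contMDiffAt_iff hxc]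
    have : (fun y => (trivializationAt E (TangentSpace I) x ⟨y, Y y⟩).2) ∘ (chartCoord I x).symm
        =ᶠ[𝓝 (chartCoord I x x)] coordField I (chartCoord I x) Y := by
      filter_upwards [(chartCoord I x).open_target.mem_nhds ((chartCoord I x).map_source hxc)]
        with z hz
      have hz' := (chartCoord I x).map_target hz
      rw [chartCoord_source] at hz'
      simp only [Function.comp_apply, coordField]
      rw [coordDeriv_chartCoord hz', Trivialization.continuousLinearMapAt_apply,
        Trivialization.linearMapAt_apply, if_pos (by simpa using hz')]
    exact ⟨fun h => h.congr_of_eventuallyEq this.symm, fun h => h.congr_of_eventuallyEq this⟩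
  · exact ⟨fun H => hc.contDiffAt_coordField_change h hxc hx H,
      fun H => h.contDiffAt_coordField_change hc hx hxc H⟩

theorem mdifferentiableAt_field_iff (h : IsSmoothCoord I Ψ) {x : M} (hx : x ∈ Ψ.source)
    {Y : Π x : M, TangentSpace I x} :
    MDiffAt (T% Y) x ↔ DifferentiableAt ℝ (coordField I Ψ Y) (Ψ x) := by
  have : IsManifold I 1 M := IsManifold.of_le (n := ∞) (by simp)
  have hc := isSmoothCoord_chartCoord (I := I) x
  have hxc := mem_chartCoord_source (I := I) x
  trans DifferentiableAt ℝ (coordField I (chartCoord I x) Y) (chartCoord I x x)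
  · rw [mdifferentiableAt_section, hc.mdifferentiableAt_iff hxc]
    have : (fun y => (trivializationAt E (TangentSpace I) x ⟨y, Y y⟩).2) ∘ (chartCoord I x).symm
        =ᶠ[𝓝 (chartCoord I x x)] coordField I (chartCoord I x) Y := by
      filter_upwards [(chartCoord I x).open_target.mem_nhds ((chartCoord I x).map_source hxc)]
        with z hz
      have hz' := (chartCoord I x).map_target hz
      rw [chartCoord_source] at hz'
      simp only [Function.comp_apply, coordField]
      rw [coordDeriv_chartCoord hz', Trivialization.continuousLinearMapAt_apply,
        Trivialization.linearMapAt_apply, if_pos (by simpa using hz')]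
    exact ⟨fun h => h.congr_of_eventuallyEq this.symm, fun h => h.congr_of_eventuallyEq this⟩
  · exact ⟨fun H => hc.differentiableAt_coordField_change h hxc hx H,
      fun H => h.differentiableAt_coordField_change hc hx hxc H⟩

theorem contMDiffAt_end_iff (h : IsSmoothCoord I Ψ) {n : ℕ∞} {x : M} (hx : x ∈ Ψ.source)
    {K : Π x : M, TangentSpace I x →L[ℝ] TangentSpace I x} :
    ContMDiffAt I (I.prod 𝓘(ℝ, E →L[ℝ] E)) n (fun x =>
      (⟨x, K x⟩ : TotalSpace (E →L[ℝ] E) fun x : M => TangentSpace I x →L[ℝ] TangentSpace I x)) x ↔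
      ContDiffAt ℝ n (coordEnd I Ψ K) (Ψ x) := by
  have : IsManifold I 1 M := IsManifold.of_le (n := ∞) (by simp)
  have hc := isSmoothCoord_chartCoord (I := I) x
  have hxc := mem_chartCoord_source (I := I) x
  trans ContDiffAt ℝ n (coordEnd I (chartCoord I x) K) (chartCoord I x x)
  · rw [contMDiffAt_hom_bundle]
    refine (and_iff_right contMDiffAt_id).trans ?_
    rw [hc.contMDiffAt_iff hxc]
    have : (fun y => ContinuousLinearMap.inCoordinates E (TangentSpace I : M → Type _) E
          (TangentSpace I : M → Type _) x y x y (K y)) ∘ (chartCoord I x).symm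
        =ᶠ[𝓝 (chartCoord I x x)] coordEnd I (chartCoord I x) K := by
      filter_upwards [(chartCoord I x).open_target.mem_nhds ((chartCoord I x).map_source hxc)]
        with z hz
      have hz' := (chartCoord I x).map_target hz
      rw [chartCoord_source] at hz'
      simp only [Function.comp_apply, coordEnd]
      rw [coordDeriv_chartCoord hz', coordInv_chartCoord hz']
      rfl
    exact ⟨fun h => h.congr_of_eventuallyEq this.symm, fun h => h.congr_of_eventuallyEq this⟩
  · exact ⟨fun H => hc.contDiffAt_coordEnd_change h hxc hx H,
      fun H => h.contDiffAt_coordEnd_change hc hx hxc H⟩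

end IsSmoothCoord

end Coordinates

/-! ### Minimal connections on open subsets of a vector space -/

section LocalConnection

variable {V : Type*} [NormedAddCommGroup V] [NormedSpace ℝ V]

/-- The Nijenhuis tensor of an almost complex structure on an open subset of a vector space,
evaluated at constant vector fields. -/
def nijenhuisSymbol (J : V → V →L[ℝ] V) (z X Y : V) : V :=
  fderiv ℝ J z (J z X) Y - fderiv ℝ J z (J z Y) X + J z (fderiv ℝ J z Y X)
    - J z (fderiv ℝ J z X Y)

/-- The Christoffel symbol of the Kobayashi–Nomizu connection
`∇_X Y = D_X Y - ¼ ((D_{JY} J) X + J (D_Y J) X + 2 J (D_X J) Y)`, which is minimal. -/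
def minimalSymbol (J : V → V →L[ℝ] V) (z : V) : V →L[ℝ] V →L[ℝ] V :=
  (-(1 / 4) : ℝ) • (((fderiv ℝ J z).comp (J z)).flip +
    (ContinuousLinearMap.compL ℝ V V V (J z)).comp (fderiv ℝ J z).flip +
    (2 : ℝ) • (ContinuousLinearMap.compL ℝ V V V (J z)).comp (fderiv ℝ J z))

theorem minimalSymbol_apply (J : V → V →L[ℝ] V) (z X Y : V) :
    minimalSymbol J z X Y = (-(1 / 4) : ℝ) • (fderiv ℝ J z (J z Y) X + J z (fderiv ℝ J z Y X) +
      (2 : ℝ) • J z (fderiv ℝ J z X Y)) := rfl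

set_option synthInstance.maxHeartbeats 200000 in
theorem contDiffAt_minimalSymbol {J : V → V →L[ℝ] V} {z : V} (hJ : ContDiffAt ℝ ∞ J z) :
    ContDiffAt ℝ ∞ (minimalSymbol J) z := by
  have hD : ContDiffAt ℝ ∞ (fderiv ℝ J) z := hJ.fderiv_right (m := ∞) (by simp)
  have hflip : ∀ {A : V → V →L[ℝ] V →L[ℝ] V}, ContDiffAt ℝ ∞ A z →
      ContDiffAt ℝ ∞ (fun y => (A y).flip) z := fun hA =>
    (ContinuousLinearMap.flipₗᵢ ℝ V V V).contDiff.contDiffAt.comp z hA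
  have hc : ContDiffAt ℝ ∞ (fun y => ContinuousLinearMap.compL ℝ V V V (J y)) z :=
    (ContinuousLinearMap.compL ℝ V V V).contDiff.contDiffAt.comp z hJ
  exact (((hflip (hD.clm_comp hJ)).add (hc.clm_comp (hflip hD))).add
    ((hc.clm_comp hD).const_smul _)).const_smul _

/-- Differentiating `J² = -1`. -/
theorem fderiv_sq_eq_neg {J : V → V →L[ℝ] V} {z : V} (hJ : DifferentiableAt ℝ J z)
    (hsq : ∀ᶠ y in 𝓝 z, ∀ v, J y (J y v) = -v) (u v : V) :
    fderiv ℝ J z u (J z v) = -J z (fderiv ℝ J z u v) := by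
  have h1 : (fun y => (J y).comp (J y)) =ᶠ[𝓝 z] fun _ => -ContinuousLinearMap.id ℝ V := by
    filter_upwards [hsq] with y hy
    ext v
    simp [hy]
  have h2 := h1.fderiv_eq (𝕜 := ℝ)
  rw [fderiv_clm_comp hJ hJ] at h2
  have h3 := congrArg (fun A : V →L[ℝ] V →L[ℝ] V => A u v) h2
  simp only [fderiv_fun_const] at h3
  simp at h3
  exact eq_neg_of_add_eq_zero_right h3

variable {J : V → V →L[ℝ] V} {z : V}

theorem minimalSymbol_parallel (hJ : DifferentiableAt ℝ J z)
    (hsq : ∀ᶠ y in 𝓝 z, ∀ v, J y (J y v) = -v) (X Y : V) :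
    fderiv ℝ J z X Y + minimalSymbol J z X (J z Y) = J z (minimalSymbol J z X Y) := by
  have h := fderiv_sq_eq_neg hJ hsq
  have hz := hsq.self_of_nhds
  simp only [minimalSymbol_apply, h, hz, map_smul, map_add, map_neg, neg_apply]
  module

theorem minimalSymbol_torsion (X Y : V) :
    minimalSymbol J z X Y - minimalSymbol J z Y X = (1 / 4 : ℝ) • nijenhuisSymbol J z X Y := by
  simp only [minimalSymbol_apply, nijenhuisSymbol]
  module

/-- The curvature tensor of the connection with Christoffel symbol `Γ`. -/
def curvatureSymbol (Γ : V → V →L[ℝ] V →L[ℝ] V) (z X Y Z : V) : V :=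
  fderiv ℝ Γ z X Y Z - fderiv ℝ Γ z Y X Z + Γ z X (Γ z Y Z) - Γ z Y (Γ z X Z)

end LocalConnection

/-! ### Christoffel symbols -/

section Symbols

variable {E : Type*} [NormedAddCommGroup E] [NormedSpace ℝ E] [FiniteDimensional ℝ E]
  {H : Type*} [TopologicalSpace H] {I : ModelWithCorners ℝ E H} [I.Boundaryless]
  {M : Type*} [TopologicalSpace M] [ChartedSpace H M] [IsManifold I ∞ M]
  {V : Type*} [NormedAddCommGroup V] [NormedSpace ℝ V] [FiniteDimensional ℝ V]
  {Ψ : OpenPartialHomeomorph M V}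

variable (I) in
/-- The connection with Christoffel symbol `Γ` in the coordinates `Ψ`. -/
def coordConnection (Ψ : OpenPartialHomeomorph M V) (Γ : V → V →L[ℝ] V →L[ℝ] V) :
    ConnectionOp I M := fun Y x =>
  (coordInv I Ψ x).comp ((fderiv ℝ (coordField I Ψ Y) (Ψ x) +
    (Γ (Ψ x)).flip (coordField I Ψ Y (Ψ x))).comp (coordDeriv I Ψ x))

variable (I) in
/-- `Γ` is the Christoffel symbol of `cov` in the coordinates `Ψ`, on the set `U`. -/
def HasSymbolOn (Ψ : OpenPartialHomeomorph M V) (cov : ConnectionOp I M) (U : Set M)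
    (Γ : V → V →L[ℝ] V →L[ℝ] V) : Prop :=
  ∀ x ∈ U, x ∈ Ψ.source → ∀ Y : Π x : M, TangentSpace I x, MDiffAt (T% Y) x →
    ∀ v : TangentSpace I x, coordDeriv I Ψ x (cov Y x v) =
      fderiv ℝ (coordField I Ψ Y) (Ψ x) (coordDeriv I Ψ x v) +
        Γ (Ψ x) (coordDeriv I Ψ x v) (coordField I Ψ Y (Ψ x))

theorem hasSymbolOn_coordConnection (h : IsSmoothCoord I Ψ) (Γ : V → V →L[ℝ] V →L[ℝ] V)
    (U : Set M) : HasSymbolOn I Ψ (coordConnection I Ψ Γ) U Γ := by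
  intro x _ hx Y _ v
  simp [coordConnection, h.coordDeriv_coordInv hx]

theorem isCovariantDerivativeOn_coordConnection (h : IsSmoothCoord I Ψ)
    (Γ : V → V →L[ℝ] V →L[ℝ] V) :
    IsCovariantDerivativeOn E (coordConnection I Ψ Γ) Ψ.source where
  add {σ σ' x} hσ hσ' hx := by
    rw [h.mdifferentiableAt_field_iff hx] at hσ hσ'
    have : coordField I Ψ (σ + σ') = coordField I Ψ σ + coordField I Ψ σ' := by
      ext z; simp [coordField]
    ext v
    simp only [coordConnection, this, fderiv_add hσ hσ']
    simp
    abel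
  leibniz {σ g x} hσ hg hx := by
    have hg' := (h.mdifferentiableAt_iff hx).1 hg
    rw [h.mdifferentiableAt_field_iff hx] at hσ
    have : coordField I Ψ (g • σ) = fun z => (g ∘ Ψ.symm) z • coordField I Ψ σ z := by
      ext z; simp [coordField]
    have hdg : ∀ v : TangentSpace I x,
        fderiv ℝ (g ∘ Ψ.symm) (Ψ x) (coordDeriv I Ψ x v) = mvfderiv I g x v := by
      intro v
      have h1 : g =ᶠ[𝓝 x] (g ∘ Ψ.symm) ∘ Ψ := by
        filter_upwards [Ψ.open_source.mem_nhds hx] with y hy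
        simp [Ψ.left_inv hy]
      have h2 := mfderiv_comp x hg'.mdifferentiableAt (h.mdifferentiableAt hx)
      rw [mvfderiv, h1.mfderiv_eq, h2, mfderiv_eq_fderiv]
      rfl
    have hgs : (g ∘ Ψ.symm) (Ψ x) = g x := by simp [Ψ.left_inv hx]
    ext v
    apply h.coordDeriv_injective hx
    simp only [coordConnection, this, fderiv_fun_smul hg' hσ]
    simp only [ContinuousLinearMap.comp_apply, h.coordDeriv_coordInv hx, add_apply, smul_apply,
      ContinuousLinearMap.smulRight_apply, map_add, map_smul, hdg, hgs,
      ContinuousLinearMap.flip_apply, IsSmoothCoord.coordField_apply hx]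
    simp only [smul_add]
    abel

theorem contMDiffCovariantDerivativeOn_coordConnection (h : IsSmoothCoord I Ψ)
    {Γ : V → V →L[ℝ] V →L[ℝ] V} {U : Set M} (hU : IsOpen U) (hUs : U ⊆ Ψ.source)
    (hΓ : ∀ x ∈ U, ContDiffAt ℝ ∞ Γ (Ψ x)) :
    ContMDiffCovariantDerivativeOn E ∞ (coordConnection I Ψ Γ) U where
  contMDiff {σ} hσ x hx := by
    have hσx : CMDiffAt ∞ (T% σ) x := ((hσ x hx).contMDiffAt (hU.mem_nhds hx)).of_le (by simp)
    have hs := (h.contMDiffAt_field_iff (n := ⊤) (hUs hx)).1 hσx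
    refine ((h.contMDiffAt_end_iff (n := ⊤) (hUs hx)).2 ?_).contMDiffWithinAt
    have key : ContDiffAt ℝ ∞ (fun z => fderiv ℝ (coordField I Ψ σ) z +
        (Γ z).flip (coordField I Ψ σ z)) (Ψ x) := by
      refine ContDiffAt.add (hs.fderiv_right (m := ∞) (by simp)) (ContDiffAt.clm_apply ?_ hs)
      exact (ContinuousLinearMap.flipₗᵢ ℝ V V V).contDiff.contDiffAt.comp _ (hΓ x hx)
    refine key.congr_of_eventuallyEq ?_
    filter_upwards [Ψ.open_target.mem_nhds (Ψ.map_source (hUs hx))] with z hz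
    ext v
    simp only [coordEnd, coordConnection, ContinuousLinearMap.comp_apply,
      h.coordDeriv_coordInv (Ψ.map_target hz), Ψ.right_inv hz]

/-- Smooth vector fields on `M` with prescribed constant coordinate expression near a point. -/
theorem exists_field_const [T2Space M] (h : IsSmoothCoord I Ψ) {x₀ : M} (hx₀ : x₀ ∈ Ψ.source)
    (w : V) :
    ∃ σ : Π x : M, TangentSpace I x, (∀ x, CMDiffAt ∞ (T% σ) x) ∧
      ∀ᶠ z in 𝓝 (Ψ x₀), coordField I Ψ σ z = w := by
  classical
  obtain ⟨r, hr, hrs⟩ := Metric.isOpen_iff.1 Ψ.open_target (Ψ x₀) (Ψ.map_source hx₀)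
  let f : ContDiffBump (Ψ x₀) := ⟨r / 4, r / 2, by positivity, by linarith⟩
  have hball : Metric.closedBall (Ψ x₀) (r / 2) ⊆ Ψ.target :=
    (Metric.closedBall_subset_ball (by linarith)).trans hrs
  let σ : Π x : M, TangentSpace I x := fun x =>
    if x ∈ Ψ.source then f (Ψ x) • coordInv I Ψ x w else 0
  have hσ : ∀ z ∈ Ψ.target, coordField I Ψ σ z = f z • w := by
    intro z hz
    simp only [coordField, σ, if_pos (Ψ.map_target hz), Ψ.right_inv hz, map_smul,
      h.coordDeriv_coordInv (Ψ.map_target hz)]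
  refine ⟨σ, fun x => ?_, ?_⟩
  · by_cases hx : x ∈ Ψ.source
    · refine (h.contMDiffAt_field_iff (n := ⊤) hx).2 ?_
      refine ContDiffAt.congr_of_eventuallyEq (f := fun z => f z • w)
        (f.contDiff.contDiffAt.smul contDiffAt_const) ?_
      filter_upwards [Ψ.open_target.mem_nhds (Ψ.map_source hx)] with z hz using hσ z hz
    · -- off the coordinate domain the field vanishes near the point: its support is compact
      have hcpt : IsCompact (Ψ.symm '' Metric.closedBall (Ψ x₀) (r / 2)) :=
        (isCompact_closedBall _ _).image_of_continuousOn (Ψ.continuousOn_symm.mono hball)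
      have hxn : x ∉ Ψ.symm '' Metric.closedBall (Ψ x₀) (r / 2) := by
        rintro ⟨z, hz, rfl⟩
        exact hx (Ψ.map_target (hball hz))
      have h0 : CMDiffAt ∞ (T% (0 : Π x : M, TangentSpace I x)) x :=
        (contMDiff_zeroSection ℝ (TangentSpace I : M → Type _)).contMDiffAt
      refine h0.congr_of_eventuallyEq ?_
      filter_upwards [hcpt.isClosed.isOpen_compl.mem_nhds hxn] with y hy
      have : σ y = 0 := by
        by_cases hys : y ∈ Ψ.source
        · have : f (Ψ y) = 0 := by
            apply f.zero_of_le_dist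
            by_contra! hlt
            exact hy ⟨Ψ y, Metric.mem_closedBall.2 hlt.le, Ψ.left_inv hys⟩
          simp [σ, this]
        · simp [σ, hys]
      simp [this]
  · filter_upwards [Ψ.open_target.mem_nhds (Ψ.map_source hx₀),
      Metric.closedBall_mem_nhds (Ψ x₀) (show 0 < r / 4 by positivity)] with z hz hz'
    rw [hσ z hz, f.one_of_mem_closedBall hz', one_smul]

/-- A smooth connection has smooth Christoffel symbols. -/
theorem exists_symbol [T2Space M] (h : IsSmoothCoord I Ψ) {cov : ConnectionOp I M} {U : Set M}
    (hU : IsOpen U) (hcov : IsCovariantDerivativeOn E cov U)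
    (hsm : ContMDiffCovariantDerivativeOn E ∞ cov U) :
    ∃ Γ : V → V →L[ℝ] V →L[ℝ] V, HasSymbolOn I Ψ cov U Γ ∧
      ∀ x ∈ U, x ∈ Ψ.source → ContDiffAt ℝ ∞ Γ (Ψ x) := by
  have : IsManifold I 1 M := IsManifold.of_le (n := ∞) (by simp)
  have hc : IsCovariantDerivativeOn E cov (U ∩ Ψ.source) := hcov.mono inter_subset_left
  have hf : IsCovariantDerivativeOn E (coordConnection I Ψ 0) (U ∩ Ψ.source) :=
    (isCovariantDerivativeOn_coordConnection h 0).mono inter_subset_right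
  let A := IsCovariantDerivativeOn.difference hc hf
  let Γ : V → V →L[ℝ] V →L[ℝ] V := fun z =>
    (LinearMap.toContinuousLinearMap (LinearMap.mk₂ ℝ (fun w v : V =>
      coordDeriv I Ψ (Ψ.symm z) (A (Ψ.symm z) (coordInv I Ψ (Ψ.symm z) w)
        (coordInv I Ψ (Ψ.symm z) v))) (by simp) (by simp) (by simp) (by simp) |>.compr₂ 
          LinearMap.id |> fun B => (LinearMap.toContinuousLinearMap : (V →ₗ[ℝ] V) ≃ₗ[ℝ] _).toLinearMap ∘ₗ B)).flip
  have hΓ : ∀ x v w, x ∈ Ψ.source → Γ (Ψ x) (coordDeriv I Ψ x v) w =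
      coordDeriv I Ψ x (A x (coordInv I Ψ x w) v) := by
    intro x v w hx
    have : ∀ y, y = x → coordDeriv I Ψ y (A y (coordInv I Ψ y w)
        (coordInv I Ψ y (coordDeriv I Ψ x v))) = coordDeriv I Ψ x (A x (coordInv I Ψ x w) v) := by
      rintro y rfl; rw [h.coordInv_coordDeriv hx]
    exact this _ (Ψ.left_inv hx)
  have hsymb : HasSymbolOn I Ψ cov U Γ := by
    intro x hxU hx Y hY v
    have h1 := IsCovariantDerivativeOn.difference_apply hc hf (x := x) ⟨hxU, hx⟩ hY
    have h2 := hasSymbolOn_coordConnection h 0 U x hxU hx Y hY v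
    rw [hΓ x v _ hx, IsSmoothCoord.coordField_apply hx, h.coordInv_coordDeriv hx]
    have h3 : A x (Y x) v = cov Y x v - coordConnection I Ψ 0 Y x v := by
      have := congrArg (fun B : TangentSpace I x →L[ℝ] TangentSpace I x => B v) h1
      simpa using this
    rw [h3, map_sub, h2]
    simp
  refine ⟨Γ, hsymb, fun x hxU hx => ?_⟩
  -- the columns of `Γ` are derivatives of vector fields which are constant in the coordinates
  have hcol : ∀ w, ∀ x ∈ U, x ∈ Ψ.source → ContDiffAt ℝ ∞ (fun z => (Γ z).flip w) (Ψ x) := by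
    intro w x hxU hx
    obtain ⟨σ, hσ, hσw⟩ := exists_field_const h hx w
    have h1 := (hsm.contMDiff (σ := σ) fun y _ => (hσ y).contMDiffWithinAt.of_le (by simp)) x hxU
    have h2 := (h.contMDiffAt_end_iff (n := ⊤) hx).1 (h1.contMDiffAt (hU.mem_nhds hxU))
    refine h2.congr_of_eventuallyEq ?_
    have hUn : ∀ᶠ z in 𝓝 (Ψ x), Ψ.symm z ∈ U :=
      (Ψ.continuousAt_symm (Ψ.map_source hx)).eventually (by
        rw [Ψ.left_inv hx]; exact hU.mem_nhds hxU)
    filter_upwards [Ψ.open_target.mem_nhds (Ψ.map_source hx), hUn, hσw.eventually_nhds]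
      with z hz hzU hzw
    have hd : fderiv ℝ (coordField I Ψ σ) z = 0 := by
      rw [Filter.EventuallyEq.fderiv_eq (f := fun _ => w) hzw]; simp
    ext v
    have := hsymb (Ψ.symm z) hzU (Ψ.map_target hz) σ ((hσ _).mdifferentiableAt (by simp))
      (coordInv I Ψ (Ψ.symm z) v)
    rw [h.coordDeriv_coordInv (Ψ.map_target hz), Ψ.right_inv hz, hd, hzw.self_of_nhds] at this
    simpa [coordEnd] using this.symm
  have hopen : IsOpen (Ψ.target ∩ Ψ.symm ⁻¹' U) := Ψ.symm.isOpen_inter_preimage hU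
  have hflip : ContDiffOn ℝ ∞ (fun z => (Γ z).flip) (Ψ.target ∩ Ψ.symm ⁻¹' U) := by
    refine contDiffOn_clm_apply.2 fun w z hz => ContDiffAt.contDiffWithinAt ?_
    have := hcol w (Ψ.symm z) hz.2 (Ψ.map_target hz.1)
    rwa [Ψ.right_inv hz.1] at this
  have hflipx := hflip.contDiffAt (hopen.mem_nhds
    (show Ψ x ∈ _ from ⟨Ψ.map_source hx, by simpa [Ψ.left_inv hx] using hxU⟩))
  exact ((ContinuousLinearMap.flipₗᵢ ℝ V V V).contDiff.contDiffAt.comp _ hflipx)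

end Symbols

/-! ### Minimal connections in coordinates -/

section MinimalSymbols

variable {E : Type*} [NormedAddCommGroup E] [NormedSpace ℝ E] [FiniteDimensional ℝ E]
  {H : Type*} [TopologicalSpace H] {I : ModelWithCorners ℝ E H} [I.Boundaryless]
  {M : Type*} [TopologicalSpace M] [ChartedSpace H M] [IsManifold I ∞ M]
  {V : Type*} [NormedAddCommGroup V] [NormedSpace ℝ V] [FiniteDimensional ℝ V]
  {Ψ : OpenPartialHomeomorph M V} {J : EndField I M}

/-- The Christoffel symbol `Γ` satisfies the equations of a minimal connection for `J` at `z`: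
`J` is parallel and the torsion is a quarter of the Nijenhuis tensor. -/
structure IsMinimalSymbolAt (J : V → V →L[ℝ] V) (Γ : V →L[ℝ] V →L[ℝ] V) (z : V) : Prop where
  parallel : ∀ X Y, fderiv ℝ J z X Y + Γ X (J z Y) = J z (Γ X Y)
  torsion : ∀ X Y, Γ X Y - Γ Y X = (1 / 4 : ℝ) • nijenhuisSymbol J z X Y

theorem IsAlmostComplex.contDiffAt_coordEnd (hJ : IsAlmostComplex J) (h : IsSmoothCoord I Ψ)
    {z : V} (hz : z ∈ Ψ.target) : ContDiffAt ℝ ∞ (coordEnd I Ψ J) z := by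
  have := (h.contMDiffAt_end_iff (n := ⊤) (Ψ.map_target hz)).1 (hJ.smooth (Ψ.symm z))
  rwa [Ψ.right_inv hz] at this

theorem IsAlmostComplex.coordEnd_sq (hJ : IsAlmostComplex J) (h : IsSmoothCoord I Ψ)
    {z : V} (hz : z ∈ Ψ.target) (v : V) :
    coordEnd I Ψ J z (coordEnd I Ψ J z v) = -v := by
  have hz' := Ψ.map_target hz
  simp only [coordEnd, ContinuousLinearMap.comp_apply, h.coordInv_coordDeriv hz', hJ.sq, map_neg,
    h.coordDeriv_coordInv hz']

theorem coordField_app_eventuallyEq (h : IsSmoothCoord I Ψ) {x : M} (hx : x ∈ Ψ.source)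
    (J : EndField I M) (Y : Π x : M, TangentSpace I x) :
    coordField I Ψ (J.app Y) =ᶠ[𝓝 (Ψ x)] fun z => coordEnd I Ψ J z (coordField I Ψ Y z) := by
  filter_upwards [Ψ.open_target.mem_nhds (Ψ.map_source hx)] with z hz
  exact h.coordField_app hz J Y

theorem IsAlmostComplex.mdifferentiableAt_app (hJ : IsAlmostComplex J) (h : IsSmoothCoord I Ψ)
    {x : M} (hx : x ∈ Ψ.source) {Y : Π x : M, TangentSpace I x} (hY : MDiffAt (T% Y) x) :
    MDiffAt (T% (J.app Y)) x := by
  rw [h.mdifferentiableAt_field_iff hx] at hY ⊢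
  exact (((hJ.contDiffAt_coordEnd h (Ψ.map_source hx)).differentiableAt (by simp)).clm_apply
    hY).congr_of_eventuallyEq (coordField_app_eventuallyEq h hx J Y)

theorem IsAlmostComplex.contMDiffAt_app (hJ : IsAlmostComplex J) (h : IsSmoothCoord I Ψ)
    {x : M} (hx : x ∈ Ψ.source) {Y : Π x : M, TangentSpace I x} (hY : CMDiffAt ∞ (T% Y) x) :
    CMDiffAt ∞ (T% (J.app Y)) x := by
  refine (h.contMDiffAt_field_iff (n := ⊤) hx).2 ?_
  have hY' := (h.contMDiffAt_field_iff (n := ⊤) hx).1 hY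
  exact ((hJ.contDiffAt_coordEnd h (Ψ.map_source hx)).clm_apply
    hY').congr_of_eventuallyEq (coordField_app_eventuallyEq h hx J Y)

theorem IsAlmostComplex.fderiv_coordField_app (hJ : IsAlmostComplex J) (h : IsSmoothCoord I Ψ)
    {x : M} (hx : x ∈ Ψ.source) {Y : Π x : M, TangentSpace I x} (hY : MDiffAt (T% Y) x) (v : V) :
    fderiv ℝ (coordField I Ψ (J.app Y)) (Ψ x) v =
      coordEnd I Ψ J (Ψ x) (fderiv ℝ (coordField I Ψ Y) (Ψ x) v) +
        fderiv ℝ (coordEnd I Ψ J) (Ψ x) v (coordField I Ψ Y (Ψ x)) := by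
  rw [h.mdifferentiableAt_field_iff hx] at hY
  rw [(coordField_app_eventuallyEq h hx J Y).fderiv_eq, fderiv_clm_apply
    ((hJ.contDiffAt_coordEnd h (Ψ.map_source hx)).differentiableAt (by simp)) hY]
  simp

theorem coordDeriv_nijenhuis (hJ : IsAlmostComplex J) (h : IsSmoothCoord I Ψ)
    {x : M} (hx : x ∈ Ψ.source) {X Y : Π x : M, TangentSpace I x} (hX : MDiffAt (T% X) x)
    (hY : MDiffAt (T% Y) x) :
    coordDeriv I Ψ x (nijenhuis J X Y x) =
      nijenhuisSymbol (coordEnd I Ψ J) (Ψ x) (coordField I Ψ X (Ψ x))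
        (coordField I Ψ Y (Ψ x)) := by
  have hJX := hJ.mdifferentiableAt_app h hx hX
  have hJY := hJ.mdifferentiableAt_app h hx hY
  have hz := Ψ.map_source hx
  simp only [nijenhuis, map_sub, ← h.coordEnd_apply hx, h.coordDeriv_mlieBracket hx hJX hJY,
    h.coordDeriv_mlieBracket hx hJX hY, h.coordDeriv_mlieBracket hx hX hJY,
    h.coordDeriv_mlieBracket hx hX hY, hJ.fderiv_coordField_app h hx hX,
    hJ.fderiv_coordField_app h hx hY, h.coordField_app hz, nijenhuisSymbol, map_add,
    hJ.coordEnd_sq h hz]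
  module

/-- A connection with minimal Christoffel symbol is minimal at the point. -/
theorem HasSymbolOn.parallel_torsion (hJ : IsAlmostComplex J) (h : IsSmoothCoord I Ψ)
    {cov : ConnectionOp I M} {U : Set M} {Γ : V → V →L[ℝ] V →L[ℝ] V}
    (hΓ : HasSymbolOn I Ψ cov U Γ) {x : M} (hxU : x ∈ U) (hx : x ∈ Ψ.source)
    (hmin : IsMinimalSymbolAt (coordEnd I Ψ J) (Γ (Ψ x)) (Ψ x)) :
    (∀ Y : Π x : M, TangentSpace I x, MDiffAt (T% Y) x →
      ∀ v : TangentSpace I x, cov (J.app Y) x v = J x (cov Y x v)) ∧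
    (∀ X Y : Π x : M, TangentSpace I x, MDiffAt (T% X) x → MDiffAt (T% Y) x →
      cov Y x (X x) - cov X x (Y x) - mlieBracket I X Y x =
        (1 / 4 : ℝ) • nijenhuis J X Y x) := by
  have hz := Ψ.map_source hx
  constructor
  · intro Y hY v
    apply h.coordDeriv_injective hx
    rw [← h.coordEnd_apply hx J, hΓ x hxU hx Y hY, hΓ x hxU hx _ (hJ.mdifferentiableAt_app h hx hY),
      hJ.fderiv_coordField_app h hx hY, h.coordField_app hz, map_add, ← hmin.parallel]
    abel
  · intro X Y hX hY
    apply h.coordDeriv_injective hx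
    rw [map_sub, map_sub, map_smul, coordDeriv_nijenhuis hJ h hx hX hY, ← hmin.torsion,
      h.coordDeriv_mlieBracket hx hX hY, hΓ x hxU hx Y hY, hΓ x hxU hx X hX,
      ← IsSmoothCoord.coordField_apply hx, ← IsSmoothCoord.coordField_apply hx]
    abel

/-- The Christoffel symbol of a minimal connection is minimal. -/
theorem HasSymbolOn.isMinimalSymbolAt [T2Space M] (hJ : IsAlmostComplex J)
    (h : IsSmoothCoord I Ψ) {cov : ConnectionOp I M} {U : Set M} {Γ : V → V →L[ℝ] V →L[ℝ] V}
    (hΓ : HasSymbolOn I Ψ cov U Γ) {x : M} (hxU : x ∈ U) (hx : x ∈ Ψ.source)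
    (hmin : IsMinimalConnectionOn J U cov) :
    IsMinimalSymbolAt (coordEnd I Ψ J) (Γ (Ψ x)) (Ψ x) := by
  have hz := Ψ.map_source hx
  have hfield : ∀ w : V, ∃ σ : Π x : M, TangentSpace I x, MDiffAt (T% σ) x ∧
      fderiv ℝ (coordField I Ψ σ) (Ψ x) = 0 ∧ coordField I Ψ σ (Ψ x) = w := by
    intro w
    obtain ⟨σ, hσ, hw⟩ := exists_field_const h hx w
    refine ⟨σ, (hσ x).mdifferentiableAt (by simp), ?_, hw.self_of_nhds⟩
    rw [Filter.EventuallyEq.fderiv_eq (f := fun _ => w) hw]; simp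
  constructor
  · intro X Y
    obtain ⟨σ, hσ, hd, hw⟩ := hfield Y
    have := congrArg (coordDeriv I Ψ x) (hmin.parallel x hxU σ hσ (coordInv I Ψ x X))
    rw [← h.coordEnd_apply hx J, hΓ x hxU hx σ hσ, hΓ x hxU hx _ (hJ.mdifferentiableAt_app h hx hσ),
      hJ.fderiv_coordField_app h hx hσ, h.coordField_app hz, h.coordDeriv_coordInv hx, hd, hw]
      at this
    simpa using this
  · intro X Y
    obtain ⟨σ, hσ, hd, hw⟩ := hfield X
    obtain ⟨τ, hτ, hd', hw'⟩ := hfield Y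
    have := congrArg (coordDeriv I Ψ x) (hmin.torsion x hxU σ τ hσ hτ)
    rw [map_sub, map_sub, map_smul, coordDeriv_nijenhuis hJ h hx hσ hτ,
      h.coordDeriv_mlieBracket hx hσ hτ, hΓ x hxU hx σ hσ, hΓ x hxU hx τ hτ,
      ← IsSmoothCoord.coordField_apply hx, ← IsSmoothCoord.coordField_apply hx, hd, hd', hw, hw']
      at this
    simpa using this

theorem isMinimalSymbolAt_minimalSymbol (hJ : IsAlmostComplex J) (h : IsSmoothCoord I Ψ)
    {z : V} (hz : z ∈ Ψ.target) :
    IsMinimalSymbolAt (coordEnd I Ψ J) (minimalSymbol (coordEnd I Ψ J) z) z where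
  parallel := minimalSymbol_parallel ((hJ.contDiffAt_coordEnd h hz).differentiableAt (by simp)) (by
    filter_upwards [Ψ.open_target.mem_nhds hz] with y hy using hJ.coordEnd_sq h hy)
  torsion := minimalSymbol_torsion

variable (J) in
/-- The minimal connection of the coordinates `Ψ`. -/
def minimalConnection (Ψ : OpenPartialHomeomorph M V) : ConnectionOp I M :=
  coordConnection I Ψ (minimalSymbol (coordEnd I Ψ J))

theorem hasSymbolOn_minimalConnection (h : IsSmoothCoord I Ψ) (U : Set M) :
    HasSymbolOn I Ψ (minimalConnection J Ψ) U (minimalSymbol (coordEnd I Ψ J)) :=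
  hasSymbolOn_coordConnection h _ _

theorem isMinimalConnectionOn_minimalConnection (hJ : IsAlmostComplex J) (h : IsSmoothCoord I Ψ) :
    IsMinimalConnectionOn J Ψ.source (minimalConnection J Ψ) where
  isCovariantDerivativeOn := isCovariantDerivativeOn_coordConnection h _
  smooth := contMDiffCovariantDerivativeOn_coordConnection h Ψ.open_source subset_rfl
    fun _ hx => contDiffAt_minimalSymbol (hJ.contDiffAt_coordEnd h (Ψ.map_source hx))
  parallel x hx := ((hasSymbolOn_minimalConnection h univ).parallel_torsion hJ h (mem_univ x) hx
    (isMinimalSymbolAt_minimalSymbol hJ h (Ψ.map_source hx))).1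
  torsion x hx := ((hasSymbolOn_minimalConnection h univ).parallel_torsion hJ h (mem_univ x) hx
    (isMinimalSymbolAt_minimalSymbol hJ h (Ψ.map_source hx))).2

/-- The curvature in coordinates. -/
theorem HasSymbolOn.coordDeriv_curvature (h : IsSmoothCoord I Ψ)
    {cov : ConnectionOp I M} {U : Set M} (hU : IsOpen U) {Γ : V → V →L[ℝ] V →L[ℝ] V}
    (hΓ : HasSymbolOn I Ψ cov U Γ) {x : M} (hxU : x ∈ U) (hx : x ∈ Ψ.source)
    (hd : DifferentiableAt ℝ Γ (Ψ x)) {X Y Z : Π x : M, TangentSpace I x}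
    (hX : CMDiffAt ∞ (T% X) x) (hY : CMDiffAt ∞ (T% Y) x) (hZ : CMDiffAt ∞ (T% Z) x) :
    coordDeriv I Ψ x (curvature cov X Y Z x) =
      curvatureSymbol Γ (Ψ x) (coordField I Ψ X (Ψ x)) (coordField I Ψ Y (Ψ x))
        (coordField I Ψ Z (Ψ x)) := by
  have hz := Ψ.map_source hx
  have hZc := (h.contMDiffAt_field_iff (n := ⊤) hx).1 hZ
  have hDZ : DifferentiableAt ℝ (fderiv ℝ (coordField I Ψ Z)) (Ψ x) :=
    (hZc.fderiv_right (m := ∞) (by simp)).differentiableAt (by simp)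
  have hZd : DifferentiableAt ℝ (coordField I Ψ Z) (Ψ x) := hZc.differentiableAt (by simp)
  -- the field `∇_W Z` in coordinates
  have hcov : ∀ W : Π x : M, TangentSpace I x,
      coordField I Ψ (fun y => cov Z y (W y)) =ᶠ[𝓝 (Ψ x)] fun z =>
        fderiv ℝ (coordField I Ψ Z) z (coordField I Ψ W z) +
          Γ z (coordField I Ψ W z) (coordField I Ψ Z z) := by
    intro W
    have hUn : ∀ᶠ z in 𝓝 (Ψ x), Ψ.symm z ∈ U :=
      (Ψ.continuousAt_symm hz).eventually (by rw [Ψ.left_inv hx]; exact hU.mem_nhds hxU)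
    have hZn : ∀ᶠ z in 𝓝 (Ψ x), DifferentiableAt ℝ (coordField I Ψ Z) z := by
      have := (hZc.of_le (m := 1) (by simp)).eventually (by simp)
      filter_upwards [this] with z hz using hz.differentiableAt (by simp)
    filter_upwards [Ψ.open_target.mem_nhds hz, hUn, hZn] with z hz hzU hzZ
    have hs := Ψ.map_target hz
    have := hΓ _ hzU hs Z ((h.mdifferentiableAt_field_iff hs).2 (by rwa [Ψ.right_inv hz]))
      (W (Ψ.symm z))
    rw [Ψ.right_inv hz] at this
    exact this
  have hWd : ∀ W : Π x : M, TangentSpace I x, CMDiffAt ∞ (T% W) x →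
      DifferentiableAt ℝ (coordField I Ψ W) (Ψ x) := fun W hW =>
    ((h.contMDiffAt_field_iff (n := ⊤) hx).1 hW).differentiableAt (by simp)
  have hmd : ∀ W : Π x : M, TangentSpace I x, CMDiffAt ∞ (T% W) x →
      MDiffAt (T% (fun y => cov Z y (W y))) x := by
    intro W hW
    rw [h.mdifferentiableAt_field_iff hx]
    exact ((hDZ.clm_apply (hWd W hW)).add
      ((hd.clm_apply (hWd W hW)).clm_apply hZd)).congr_of_eventuallyEq (hcov W)
  have hfd : ∀ W : Π x : M, TangentSpace I x, CMDiffAt ∞ (T% W) x → ∀ v : V,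
      fderiv ℝ (coordField I Ψ (fun y => cov Z y (W y))) (Ψ x) v =
        fderiv ℝ (fderiv ℝ (coordField I Ψ Z)) (Ψ x) v (coordField I Ψ W (Ψ x)) +
        fderiv ℝ (coordField I Ψ Z) (Ψ x) (fderiv ℝ (coordField I Ψ W) (Ψ x) v) +
        (fderiv ℝ Γ (Ψ x) v (coordField I Ψ W (Ψ x)) (coordField I Ψ Z (Ψ x)) +
        Γ (Ψ x) (fderiv ℝ (coordField I Ψ W) (Ψ x) v) (coordField I Ψ Z (Ψ x)) +
        Γ (Ψ x) (coordField I Ψ W (Ψ x)) (fderiv ℝ (coordField I Ψ Z) (Ψ x) v)) := by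
    intro W hW v
    have hW' := hWd W hW
    rw [(hcov W).fderiv_eq, fderiv_fun_add (hDZ.clm_apply hW')
      ((hd.clm_apply hW').clm_apply hZd), fderiv_clm_apply hDZ hW',
      fderiv_clm_apply (hd.clm_apply hW') hZd, fderiv_clm_apply hd hW']
    simp
    abel
  have hsymm : ∀ u v, fderiv ℝ (fderiv ℝ (coordField I Ψ Z)) (Ψ x) u v =
      fderiv ℝ (fderiv ℝ (coordField I Ψ Z)) (Ψ x) v u :=
    (hZc.isSymmSndFDerivAt (by simpa using ENat.LEInfty.out)).eq
  have hXd : MDiffAt (T% X) x := hX.mdifferentiableAt (by simp)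
  have hYd : MDiffAt (T% Y) x := hY.mdifferentiableAt (by simp)
  rw [curvature, map_sub, map_sub, hΓ x hxU hx _ (hmd Y hY), hΓ x hxU hx _ (hmd X hX),
    hΓ x hxU hx Z (hZ.mdifferentiableAt (by simp)), hfd X hX, hfd Y hY,
    h.coordDeriv_mlieBracket hx hXd hYd, (hcov X).self_of_nhds, (hcov Y).self_of_nhds,
    ← IsSmoothCoord.coordField_apply hx, ← IsSmoothCoord.coordField_apply hx,
    hsymm (coordField I Ψ X (Ψ x)) (coordField I Ψ Y (Ψ x)), curvatureSymbol]
  simp only [map_add, map_sub, sub_apply]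
  abel

end MinimalSymbols

/-! ### Gluing minimal connections -/

section Gluing

variable {E : Type*} [NormedAddCommGroup E] [NormedSpace ℝ E] [FiniteDimensional ℝ E]
  {H : Type*} [TopologicalSpace H] {I : ModelWithCorners ℝ E H} [I.Boundaryless]
  {M : Type*} [TopologicalSpace M] [ChartedSpace H M] [IsManifold I ∞ M]
  {J : EndField I M}

variable (I) in
/-- A smooth partition of unity on an open subset of `M`, subordinate to an open cover, as a family
of functions on `M` which are smooth on this open subset. -/
theorem exists_partition_on_open [T2Space M] [SigmaCompactSpace M] {ι : Type*} {U : Set M}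
    (hU : IsOpen U) (W : ι → Set M) (hW : ∀ i, IsOpen (W i)) (hcov : U ⊆ ⋃ i, W i) :
    ∃ f : ι → M → ℝ, (∀ i, ∀ x ∈ U, ContMDiffAt I 𝓘(ℝ, ℝ) ∞ (f i) x) ∧
      ∀ x ∈ U, ∃ s : Finset ι, (∀ i ∈ s, x ∈ W i) ∧
        ∀ᶠ y in 𝓝 x, (∀ i ∉ s, f i y = 0) ∧ ∑ i ∈ s, f i y = 1 := by
  classical
  let O : TopologicalSpace.Opens M := ⟨U, hU⟩
  have : LocallyCompactSpace H := I.locallyCompactSpace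
  have : SecondCountableTopology H := I.secondCountableTopology
  have : LocallyCompactSpace M := ChartedSpace.locallyCompactSpace H M
  have : SecondCountableTopology M := ChartedSpace.secondCountable_of_sigmaCompact H M
  have : LocallyCompactSpace O := hU.locallyCompactSpace
  obtain ⟨ρ, hρ⟩ := SmoothPartitionOfUnity.exists_isSubordinate (M := O) I isClosed_univ
    (fun i => (Subtype.val ⁻¹' W i : Set O)) (fun i => (hW i).preimage continuous_subtype_val)
    (fun x _ => by
      obtain ⟨i, hi⟩ := mem_iUnion.1 (hcov x.2)
      exact mem_iUnion.2 ⟨i, hi⟩)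
  let f : ι → M → ℝ := fun i x => if h : x ∈ U then ρ i ⟨x, h⟩ else 0
  have hf : ∀ i (x : O), f i x = ρ i x := fun i x => dif_pos x.2
  refine ⟨f, fun i x hx => ?_, fun x hx => ⟨ρ.fintsupport ⟨x, hx⟩, fun i hi => ?_, ?_⟩⟩
  · refine (contMDiffAt_subtype_iff (U := O) (x := ⟨x, hx⟩)).1 ?_
    simp only [hf]
    exact (ρ i).contMDiff.contMDiffAt
  · exact hρ i ((ρ.mem_fintsupport_iff _ i).1 hi)
  · have h1 := ρ.eventually_finsupport_subset ⟨x, hx⟩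
    have h2 : ∀ᶠ y : O in 𝓝 ⟨x, hx⟩, (∀ i ∉ ρ.fintsupport ⟨x, hx⟩, f i y = 0) ∧
        ∑ i ∈ ρ.fintsupport ⟨x, hx⟩, f i y = 1 := by
      filter_upwards [h1] with y hy
      simp only [hf]
      refine ⟨fun i hi => ?_, ρ.sum_finsupport' y (mem_univ y) hy⟩
      by_contra hne
      exact hi (hy ((ρ.mem_finsupport _).2 hne))
    have hmap := hU.isOpenEmbedding_subtypeVal.map_nhds_eq ⟨x, hx⟩
    have h3 : ∀ᶠ y in Filter.map (Subtype.val : O → M) (𝓝 ⟨x, hx⟩),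
      (∀ i ∉ ρ.fintsupport ⟨x, hx⟩, f i y = 0) ∧
        ∑ i ∈ ρ.fintsupport ⟨x, hx⟩, f i y = 1 := h2
    rwa [show Filter.map (Subtype.val : O → M) (𝓝 ⟨x, hx⟩) = 𝓝 x from hmap] at h3

/-- Minimal connections form an affine space, so local ones can be glued. At every point the result
is a linear combination of the given connections, so it inherits linear conditions such as being
totally geodesic along a submanifold. -/
theorem exists_isMinimalConnectionOn_glue [T2Space M] [SigmaCompactSpace M] {ι : Type*}
    {W : ι → Set M} (hW : ∀ i, IsOpen (W i)) {cov : ι → ConnectionOp I M}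
    (hmin : ∀ i, IsMinimalConnectionOn J (W i) (cov i)) :
    ∃ c : ConnectionOp I M, IsMinimalConnectionOn J (⋃ i, W i) c ∧
      ∀ x ∈ ⋃ i, W i, ∃ (s : Finset ι) (a : ι → ℝ), (∀ i ∈ s, x ∈ W i) ∧
        ∀ Y, c Y x = ∑ i ∈ s, a i • cov i Y x := by
  classical
  have hU : IsOpen (⋃ i, W i) := isOpen_iUnion hW
  obtain ⟨f, hf, hs⟩ := exists_partition_on_open I hU W hW subset_rfl
  let c : ConnectionOp I M := fun Y x => ∑ᶠ i, f i x • cov i Y x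
  have hc : ∀ (s : Finset ι) (y : M), (∀ i ∉ s, f i y = 0) → ∀ Y,
      c Y y = ∑ i ∈ s, f i y • cov i Y y := by
    intro s y h0 Y
    refine finsum_eq_sum_of_support_subset _ fun i hi => ?_
    by_contra his
    exact hi (by simp [h0 i his])
  have hone : ∀ (s : Finset ι) (y : M), ∑ i ∈ s, f i y = 1 → ∀ v : TangentSpace I y,
      ∑ i ∈ s, f i y • v = v := by
    intro s y h1 v
    rw [← Finset.sum_smul, h1, one_smul]
  refine ⟨c, ⟨⟨?_, ?_⟩, ⟨?_⟩, ?_, ?_⟩, ?_⟩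
  · intro σ σ' x hσ hσ' hx
    obtain ⟨s, hsW, hev⟩ := hs x hx
    obtain ⟨h0, h1⟩ := hev.self_of_nhds
    rw [hc s x h0, hc s x h0, hc s x h0, ← Finset.sum_add_distrib]
    refine Finset.sum_congr rfl fun i hi => ?_
    rw [(hmin i).isCovariantDerivativeOn.add hσ hσ' (hsW i hi), smul_add]
  · intro σ g x hσ hg hx
    obtain ⟨s, hsW, hev⟩ := hs x hx
    obtain ⟨h0, h1⟩ := hev.self_of_nhds
    rw [hc s x h0, hc s x h0]
    have : ∀ i ∈ s, f i x • cov i (g • σ) x =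
        g x • f i x • cov i σ x + f i x • (mvfderiv I g x).smulRight (σ x) := by
      intro i hi
      rw [(hmin i).isCovariantDerivativeOn.leibniz hσ hg (hsW i hi), smul_add, smul_comm]
    rw [Finset.sum_congr rfl this, Finset.sum_add_distrib, ← Finset.smul_sum,
      ← Finset.sum_smul, h1, one_smul]
  · intro σ hσ x hx
    obtain ⟨s, hsW, hev⟩ := hs x hx
    have h := isSmoothCoord_chartCoord (I := I) x
    have hxs := mem_chartCoord_source (I := I) x
    refine ((h.contMDiffAt_end_iff (n := ⊤) hxs).2 ?_).contMDiffWithinAt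
    have key : ContDiffAt ℝ ∞ (fun z => ∑ i ∈ s, f i ((chartCoord I x).symm z) •
        coordEnd I (chartCoord I x) (cov i σ) z) (chartCoord I x x) := by
      refine ContDiffAt.sum fun i hi => ContDiffAt.fun_smul ?_ ?_
      · exact (h.contMDiffAt_iff (n := ⊤) hxs).1 (hf i x hx)
      · refine (h.contMDiffAt_end_iff (n := ⊤) hxs).1 ?_
        exact ((hmin i).smooth.contMDiff (σ := σ) (hσ.mono (subset_iUnion W i)) x
          (hsW i hi)).contMDiffAt ((hW i).mem_nhds (hsW i hi))
    refine key.congr_of_eventuallyEq ?_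
    have hev' : ∀ᶠ z in 𝓝 (chartCoord I x x), ∀ i ∉ s, f i ((chartCoord I x).symm z) = 0 := by
      refine ((chartCoord I x).continuousAt_symm ((chartCoord I x).map_source hxs)).eventually
        (p := fun y => ∀ i ∉ s, f i y = 0) ?_
      rw [(chartCoord I x).left_inv hxs]
      filter_upwards [hev] with y hy using hy.1
    filter_upwards [hev'] with z hz
    ext v
    simp only [coordEnd, hc s _ hz σ, ContinuousLinearMap.comp_apply, sum_apply, smul_apply,
      map_sum, map_smul]
  · intro x hx Y hY v
    obtain ⟨s, hsW, hev⟩ := hs x hx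
    obtain ⟨h0, h1⟩ := hev.self_of_nhds
    rw [hc s x h0, hc s x h0]
    simp only [sum_apply, smul_apply, map_sum, map_smul]
    refine Finset.sum_congr rfl fun i hi => ?_
    rw [(hmin i).parallel x (hsW i hi) Y hY]
  · intro x hx X Y hX hY
    obtain ⟨s, hsW, hev⟩ := hs x hx
    obtain ⟨h0, h1⟩ := hev.self_of_nhds
    rw [hc s x h0, hc s x h0, ← hone s x h1 (mlieBracket I X Y x),
      ← hone s x h1 (nijenhuis J X Y x), Finset.smul_sum]
    simp only [sum_apply, smul_apply, ← Finset.sum_sub_distrib, ← smul_sub]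
    refine Finset.sum_congr rfl fun i hi => ?_
    rw [(hmin i).torsion x (hsW i hi) X Y hX hY, smul_comm]
  · intro x hx
    obtain ⟨s, hsW, hev⟩ := hs x hx
    exact ⟨s, fun i => f i x, hsW, hc s x hev.self_of_nhds.1⟩

end Gluing

/-! ### Operations on smooth coordinates -/

section CoordOperations

variable {E : Type*} [NormedAddCommGroup E] [NormedSpace ℝ E]
  {H : Type*} [TopologicalSpace H] {I : ModelWithCorners ℝ E H}
  {M : Type*} [TopologicalSpace M] [ChartedSpace H M]
  {V : Type*} [NormedAddCommGroup V] [NormedSpace ℝ V]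
  {V' : Type*} [NormedAddCommGroup V'] [NormedSpace ℝ V']
  {Ψ : OpenPartialHomeomorph M V}

theorem IsSmoothCoord.trans (h : IsSmoothCoord I Ψ) {θ : OpenPartialHomeomorph V V'}
    (hθ : IsSmoothCoord 𝓘(ℝ, V) θ) : IsSmoothCoord I (Ψ.trans θ) where
  contMDiffOn := hθ.contMDiffOn.comp (h.contMDiffOn.mono fun _ hx => hx.1) fun _ hx => hx.2
  contMDiffOn_symm := h.contMDiffOn_symm.comp (hθ.contMDiffOn_symm.mono fun _ hx => hx.1)
    fun _ hx => hx.2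

theorem IsSmoothCoord.restrOpen (h : IsSmoothCoord I Ψ) {s : Set M} (hs : IsOpen s) :
    IsSmoothCoord I (Ψ.restrOpen s hs) where
  contMDiffOn := h.contMDiffOn.mono fun _ hx => hx.1
  contMDiffOn_symm := h.contMDiffOn_symm.mono fun _ hx => hx.1

theorem IsSmoothCoord.symm_trans (h : IsSmoothCoord I Ψ) {Ψ' : OpenPartialHomeomorph M V'}
    (h' : IsSmoothCoord I Ψ') : IsSmoothCoord 𝓘(ℝ, V) (Ψ.symm.trans Ψ') where
  contMDiffOn := h'.contMDiffOn.comp (h.contMDiffOn_symm.mono fun _ hx => hx.1) fun _ hx => hx.2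
  contMDiffOn_symm := h.contMDiffOn.comp (h'.contMDiffOn_symm.mono fun _ hx => hx.1)
    fun _ hx => hx.2

theorem isSmoothCoord_iff_contDiffOn {θ : OpenPartialHomeomorph V V'} :
    IsSmoothCoord 𝓘(ℝ, V) θ ↔
      ContDiffOn ℝ ∞ θ θ.source ∧ ContDiffOn ℝ ∞ θ.symm θ.target := by
  rw [← contMDiffOn_iff_contDiffOn, ← contMDiffOn_iff_contDiffOn]
  exact ⟨fun h => ⟨h.1, h.2⟩, fun h => ⟨h.1, h.2⟩⟩

theorem isSmoothCoord_toHomeomorph (e : V ≃L[ℝ] V') :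
    IsSmoothCoord 𝓘(ℝ, V) e.toHomeomorph.toOpenPartialHomeomorph :=
  isSmoothCoord_iff_contDiffOn.2 ⟨e.contDiff.contDiffOn, e.symm.contDiff.contDiffOn⟩

theorem IsSmoothCoord.prod_refl {θ : OpenPartialHomeomorph V V} (hθ : IsSmoothCoord 𝓘(ℝ, V) θ) :
    IsSmoothCoord 𝓘(ℝ, V × V') (θ.prod (OpenPartialHomeomorph.refl V')) := by
  obtain ⟨h1, h2⟩ := isSmoothCoord_iff_contDiffOn.1 hθ
  refine isSmoothCoord_iff_contDiffOn.2 ⟨?_, ?_⟩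
  · exact (h1.comp contDiff_fst.contDiffOn fun _ hx => hx.1).prodMk contDiff_snd.contDiffOn
  · exact (h2.comp contDiff_fst.contDiffOn fun _ hx => hx.1).prodMk contDiff_snd.contDiffOn

/-- Charts with values in the model space, as smooth coordinates. -/
theorem isSmoothCoord_of_mem_maximalAtlas {M : Type*} [TopologicalSpace M] [ChartedSpace E M]
    {φ : OpenPartialHomeomorph M E} (hφ : φ ∈ IsManifold.maximalAtlas 𝓘(ℝ, E) ∞ M) :
    IsSmoothCoord 𝓘(ℝ, E) φ :=
  ⟨contMDiffOn_of_mem_maximalAtlas hφ, contMDiffOn_symm_of_mem_maximalAtlas hφ⟩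

/-- Chain rule: the differential of `f`, read in coordinates `Ψ` of the target, is the differential
of `Ψ ∘ f`. -/
theorem IsSmoothCoord.coordDeriv_mfderiv (h : IsSmoothCoord I Ψ)
    {E₁ : Type*} [NormedAddCommGroup E₁] [NormedSpace ℝ E₁] {H₁ : Type*} [TopologicalSpace H₁]
    {I₁ : ModelWithCorners ℝ E₁ H₁} {N : Type*} [TopologicalSpace N] [ChartedSpace H₁ N]
    {f : N → M} {y : N} (hf : MDifferentiableAt I₁ I f y) (hy : f y ∈ Ψ.source)
    (u : TangentSpace I₁ y) :
    coordDeriv I Ψ (f y) (mfderiv I₁ I f y u) = mfderiv I₁ 𝓘(ℝ, V) (Ψ ∘ f) y u := by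
  rw [mfderiv_comp y (h.mdifferentiableAt hy) hf]
  rfl

end CoordOperations

/-! ### Slice coordinates along a submanifold -/

section Slice

variable {E E' F : Type*} [NormedAddCommGroup E] [NormedSpace ℝ E]
  [NormedAddCommGroup E'] [NormedSpace ℝ E'] [NormedAddCommGroup F] [NormedSpace ℝ F]
  {M : Type*} [TopologicalSpace M] [ChartedSpace E M] [IsManifold 𝓘(ℝ, E) ∞ M]
  {L : Type*} [TopologicalSpace L] [ChartedSpace E' L] [IsManifold 𝓘(ℝ, E') ∞ L]
  {ι : L → M} (hι : IsImmersionOfComplement F 𝓘(ℝ, E') 𝓘(ℝ, E) ∞ ι)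

/-- Coordinates `φ` of `L` and `Ψ` of `M` in which `L` is the slice `E' × 0`, with the same
transversal coordinates to first order as the slice chart at `p` which defines the local
trivialization of the normal bundle. -/
structure IsSliceCoord (p : L) (φ : OpenPartialHomeomorph L E')
    (Ψ : OpenPartialHomeomorph M (E' × F)) : Prop where
  coordL : IsSmoothCoord 𝓘(ℝ, E') φ
  coordM : IsSmoothCoord 𝓘(ℝ, E) Ψ
  source_subset : φ.source ⊆ (hι.isImmersionAt p).domChart.source
  preimage_source : ι ⁻¹' Ψ.source = φ.source
  map_eq : ∀ z ∈ φ.source, Ψ (ι z) = (φ z, 0)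
  sliceFwd_eq : ∀ z ∈ φ.source, ∀ v : TangentSpace 𝓘(ℝ, E) (ι z),
    sliceFwd hι p z v = (coordDeriv 𝓘(ℝ, E) Ψ (ι z) v).2

/-- Arbitrary coordinates of `L` extend, near a point, to slice coordinates of `M`. -/
theorem exists_isSliceCoord (hemb : IsEmbedding ι) {p : L} {φ' : OpenPartialHomeomorph L E'}
    (hφ' : IsSmoothCoord 𝓘(ℝ, E') φ') (hp : p ∈ φ'.source) :
    ∃ (φ : OpenPartialHomeomorph L E') (Ψ : OpenPartialHomeomorph M (E' × F)),
      IsSliceCoord hι p φ Ψ ∧ p ∈ φ.source ∧ ∃ s, ∃ hs : IsOpen s, φ = φ'.restrOpen s hs := by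
  set φp := (hι.isImmersionAt p).domChart with hφp
  set ψp := (hι.isImmersionAt p).codChart with hψp
  set e := (hι.isImmersionAt p).equiv with he
  have hφps : IsSmoothCoord 𝓘(ℝ, E') φp :=
    isSmoothCoord_of_mem_maximalAtlas (hι.isImmersionAt p).domChart_mem_maximalAtlas
  have hψps : IsSmoothCoord 𝓘(ℝ, E) ψp :=
    isSmoothCoord_of_mem_maximalAtlas (hι.isImmersionAt p).codChart_mem_maximalAtlas
  have hp' : p ∈ φp.source := (hι.isImmersionAt p).mem_domChart_source
  have hmap : ∀ z ∈ φp.source, ψp (ι z) = e (φp z, 0) := by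
    intro z hz
    have := (hι.isImmersionAt p).writtenInCharts
      ((φp.extend 𝓘(ℝ, E')).map_source (by simpa using hz))
    simpa [hz, ← hφp, ← hψp] using this
  -- since `ι` is an embedding, the coordinates of `M` can be restricted to an open set `W` which
  -- meets `L` only where both charts of `L` are defined
  let S : Set L := φp.source ∩ φ'.source
  have hSo : IsOpen S := φp.open_source.inter φ'.open_source
  obtain ⟨W, hW, hWS⟩ := hemb.isInducing.isOpen_iff.1 hSo
  -- the slice chart, followed by the change of coordinates from `φp` to `φ'` in the factor `E'`
  let θ : OpenPartialHomeomorph E' E' := φp.symm.trans φ'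
  have hθ : IsSmoothCoord 𝓘(ℝ, E') θ := hφps.symm_trans hφ'
  let Ψ₀ : OpenPartialHomeomorph M (E' × F) :=
    ψp.trans e.symm.toHomeomorph.toOpenPartialHomeomorph
  have hΨ₀ : IsSmoothCoord 𝓘(ℝ, E) Ψ₀ := hψps.trans (isSmoothCoord_toHomeomorph e.symm)
  let Ψ₁ : OpenPartialHomeomorph M (E' × F) := Ψ₀.trans (θ.prod (OpenPartialHomeomorph.refl F))
  have hΨ₁ : IsSmoothCoord 𝓘(ℝ, E) Ψ₁ := hΨ₀.trans hθ.prod_refl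
  have hΨ₀ι : ∀ z ∈ φp.source, Ψ₀ (ι z) = (φp z, 0) := by
    intro z hz
    change e.symm (ψp (ι z)) = _
    rw [hmap z hz, e.symm_apply_apply]
  have hsrc : ι ⁻¹' (Ψ₁.restrOpen W hW).source = S := by
    ext z
    constructor
    · intro hz
      exact hWS ▸ hz.2
    · intro hz
      refine ⟨⟨?_, ?_⟩, show z ∈ ι ⁻¹' W from hWS ▸ hz⟩
      · exact ⟨map_mem_codChart hι hz.1, mem_univ _⟩
      · change Ψ₀ (ι z) ∈ (θ.prod (OpenPartialHomeomorph.refl F)).source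
        rw [hΨ₀ι z hz.1]
        exact ⟨⟨φp.map_source hz.1, by simpa [φp.left_inv hz.1] using hz.2⟩, mem_univ _⟩
  refine ⟨φ'.restrOpen S hSo, Ψ₁.restrOpen W hW, ⟨hφ'.restrOpen hSo, hΨ₁.restrOpen hW,
    fun z hz => hz.2.1, ?_, ?_, ?_⟩, ⟨hp, hp', hp⟩, S, hSo, rfl⟩
  · rw [hsrc]
    ext z
    exact ⟨fun h => ⟨h.2, h⟩, fun h => h.2⟩
  · intro z hz
    change (θ (Ψ₀ (ι z)).1, (Ψ₀ (ι z)).2) = _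
    rw [hΨ₀ι z hz.2.1]
    change (φ' (φp.symm (φp z)), (0 : F)) = _
    rw [φp.left_inv hz.2.1]
    rfl
  · intro z hz v
    have hzs : ι z ∈ (Ψ₁.restrOpen W hW).source := by
      have : z ∈ ι ⁻¹' (Ψ₁.restrOpen W hW).source := hsrc ▸ hz.2
      exact this
    -- both sides are the differential of the common transversal coordinate
    let A : E →L[ℝ] F := (ContinuousLinearMap.snd ℝ E' F).comp (e.symm : E →L[ℝ] E' × F)
    have h1 : (ContinuousLinearMap.snd ℝ E' F) ∘ (Ψ₁.restrOpen W hW) = A ∘ ψp := rfl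
    have h2 := mfderiv_comp (I := 𝓘(ℝ, E)) (I' := 𝓘(ℝ, E' × F)) (I'' := 𝓘(ℝ, F)) (ι z)
      (ContinuousLinearMap.snd ℝ E' F).mdifferentiableAt
      ((hΨ₁.restrOpen hW).mdifferentiableAt hzs)
    have h3 := mfderiv_comp (I := 𝓘(ℝ, E)) (I' := 𝓘(ℝ, E)) (I'' := 𝓘(ℝ, F)) (ι z)
      A.mdifferentiableAt (hψps.mdifferentiableAt (map_mem_codChart hι hz.2.1))
    rw [h1, h3, ContinuousLinearMap.mfderiv_eq, ContinuousLinearMap.mfderiv_eq] at h2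
    exact congrArg (fun B : E →L[ℝ] F => B v) h2

theorem exists_isSliceCoord_self (hemb : IsEmbedding ι) (p : L) :
    ∃ (φ : OpenPartialHomeomorph L E') (Ψ : OpenPartialHomeomorph M (E' × F)),
      IsSliceCoord hι p φ Ψ ∧ p ∈ φ.source := by
  obtain ⟨φ, Ψ, h, hp, -⟩ := exists_isSliceCoord hι hemb (p := p)
    (isSmoothCoord_of_mem_maximalAtlas (hι.isImmersionAt p).domChart_mem_maximalAtlas)
    (hι.isImmersionAt p).mem_domChart_source
  exact ⟨φ, Ψ, h, hp⟩

variable {hι} {p : L} {φ : OpenPartialHomeomorph L E'} {Ψ : OpenPartialHomeomorph M (E' × F)}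

namespace IsSliceCoord

theorem mem_source (h : IsSliceCoord hι p φ Ψ) {z : L} (hz : z ∈ φ.source) : ι z ∈ Ψ.source := by
  rw [← h.preimage_source] at hz; exact hz

theorem mdifferentiableAt (_h : IsSliceCoord hι p φ Ψ) (z : L) :
    MDifferentiableAt 𝓘(ℝ, E') 𝓘(ℝ, E) ι z :=
  (hι.contMDiff z).mdifferentiableAt (by simp)

theorem coordDeriv_mfderiv (h : IsSliceCoord hι p φ Ψ) {z : L} (hz : z ∈ φ.source)
    (u : TangentSpace 𝓘(ℝ, E') z) :
    coordDeriv 𝓘(ℝ, E) Ψ (ι z) (mfderiv 𝓘(ℝ, E') 𝓘(ℝ, E) ι z u) =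
      (coordDeriv 𝓘(ℝ, E') φ z u, 0) := by
  rw [h.coordM.coordDeriv_mfderiv (h.mdifferentiableAt z) (h.mem_source hz)]
  have h1 : Ψ ∘ ι =ᶠ[𝓝 z] (ContinuousLinearMap.inl ℝ E' F) ∘ φ := by
    filter_upwards [φ.open_source.mem_nhds hz] with y hy
    simp [h.map_eq y hy]
  rw [h1.mfderiv_eq, mfderiv_comp z (ContinuousLinearMap.inl ℝ E' F).mdifferentiableAt
    (h.coordL.mdifferentiableAt hz), ContinuousLinearMap.mfderiv_eq]
  rfl

theorem mem_tangentImage_iff (h : IsSliceCoord hι p φ Ψ) {z : L} (hz : z ∈ φ.source)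
    (v : TangentSpace 𝓘(ℝ, E) (ι z)) :
    v ∈ tangentImage (E := E) (E' := E') ι z ↔ (coordDeriv 𝓘(ℝ, E) Ψ (ι z) v).2 = 0 := by
  rw [← h.sliceFwd_eq z hz, sliceFwd_eq_zero hι (h.source_subset hz)]

theorem normalMk_eq_zero_iff (h : IsSliceCoord hι p φ Ψ) {z : L} (hz : z ∈ φ.source)
    (v : TangentSpace 𝓘(ℝ, E) (ι z)) :
    normalMk hι z v = 0 ↔ (coordDeriv 𝓘(ℝ, E) Ψ (ι z) v).2 = 0 := by
  rw [normalMk_eq_zero, h.mem_tangentImage_iff hz]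

theorem sliceCoord_mk (h : IsSliceCoord hι p φ Ψ) {z : L} (hz : z ∈ φ.source)
    (v : TangentSpace 𝓘(ℝ, E) (ι z)) :
    sliceCoord hι p z (normalMk hι z v) = (coordDeriv 𝓘(ℝ, E) Ψ (ι z) v).2 := by
  rw [AlmostComplexNormalBundle.sliceCoord_mk hι (h.source_subset hz), h.sliceFwd_eq z hz]

theorem map_mem_target (h : IsSliceCoord hι p φ Ψ) {y : E'} (hy : y ∈ φ.target) :
    (y, (0 : F)) ∈ Ψ.target := by
  have := Ψ.map_source (h.mem_source (φ.map_target hy))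
  rwa [h.map_eq _ (φ.map_target hy), φ.right_inv hy] at this

end IsSliceCoord

/-! ### Coordinates of the normal bundle -/

variable (hι p φ) in
/-- The coordinates of the total space of the normal bundle defined by coordinates `φ` of the base
and the trivialization at `p`. -/
def normalCoord : OpenPartialHomeomorph (TotalSpace F (NormalFibre hι)) (E' × F) :=
  (trivializationAt F (NormalFibre hι) p).toOpenPartialHomeomorph.trans
    (φ.prod (OpenPartialHomeomorph.refl F))

theorem normalCoord_apply (a : TotalSpace F (NormalFibre hι)) :
    normalCoord hι p φ a = (φ a.proj, sliceCoord hι p a.proj a.2) := rfl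

theorem IsSliceCoord.mem_normalCoord_source (h : IsSliceCoord hι p φ Ψ)
    {a : TotalSpace F (NormalFibre hι)} :
    a ∈ (normalCoord hι p φ).source ↔ a.proj ∈ φ.source := by
  constructor
  · intro ha
    exact ha.2.1
  · intro ha
    exact ⟨h.source_subset ha, ha, mem_univ _⟩

theorem IsSliceCoord.mem_normalCoord_target (h : IsSliceCoord hι p φ Ψ) {y : E' × F} :
    y ∈ (normalCoord hι p φ).target ↔ y.1 ∈ φ.target := by
  constructor
  · intro ha
    exact ha.1.1
  · intro ha
    refine ⟨⟨ha, mem_univ _⟩, ?_⟩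
    exact ⟨h.source_subset (φ.map_target ha), mem_univ _⟩

theorem IsSliceCoord.isSmoothCoord_normalCoord (h : IsSliceCoord hι p φ Ψ) :
    IsSmoothCoord (𝓘(ℝ, E').prod 𝓘(ℝ, F)) (normalCoord hι p φ) where
  contMDiffOn := by
    have h1 := (trivializationAt F (NormalFibre hι) p).contMDiffOn (IB := 𝓘(ℝ, E')) (n := ∞)
    refine ContMDiffOn.prodMk_space ?_ ?_
    · exact h.coordL.contMDiffOn.comp (contMDiff_proj (NormalFibre hι)).contMDiffOn
        fun a ha => h.mem_normalCoord_source.1 ha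
    · exact (contMDiff_snd (M := L)).comp_contMDiffOn (h1.mono fun a ha => ha.1)
  contMDiffOn_symm := by
    have h1 := (trivializationAt F (NormalFibre hι) p).contMDiffOn_symm (IB := 𝓘(ℝ, E')) (n := ∞)
    refine h1.comp (f := fun y : E' × F => (φ.symm y.1, y.2)) (ContMDiffOn.prodMk ?_ ?_) ?_
    · exact h.coordL.contMDiffOn_symm.comp contDiff_fst.contMDiff.contMDiffOn fun y hy =>
        h.mem_normalCoord_target.1 hy
    · exact contDiff_snd.contMDiff.contMDiffOn
    · intro y hy
      exact hy.2

/-- The coordinates of a section of the normal bundle given by a vector field on `M`. -/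
theorem IsSliceCoord.coordDeriv_section (h : IsSliceCoord hι p φ Ψ) {x : L} (hx : x ∈ φ.source)
    [FiniteDimensional ℝ E] {Θ : Π y : M, TangentSpace 𝓘(ℝ, E) y} (hΘ : MDiffAt (T% Θ) (ι x))
    (u : TangentSpace 𝓘(ℝ, E') x) :
    coordDeriv (𝓘(ℝ, E').prod 𝓘(ℝ, F)) (normalCoord hι p φ) ⟨x, normalMk hι x (Θ (ι x))⟩
      (mfderiv 𝓘(ℝ, E') (𝓘(ℝ, E').prod 𝓘(ℝ, F))
        (fun z : L => (⟨z, normalMk hι z (Θ (ι z))⟩ : TotalSpace F (NormalFibre hι))) x u) =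
      (coordDeriv 𝓘(ℝ, E') φ x u,
        (fderiv ℝ (coordField 𝓘(ℝ, E) Ψ Θ) (φ x, 0) (coordDeriv 𝓘(ℝ, E') φ x u, 0)).2) := by
  have hN := h.isSmoothCoord_normalCoord
  let s : L → TotalSpace F (NormalFibre hι) := fun z => ⟨z, normalMk hι z (Θ (ι z))⟩
  have hsx : s x ∈ (normalCoord hι p φ).source := h.mem_normalCoord_source.2 hx
  have hd : DifferentiableAt ℝ (coordField 𝓘(ℝ, E) Ψ Θ) (φ x, 0) := by
    rw [← h.map_eq x hx]
    exact (h.coordM.mdifferentiableAt_field_iff (h.mem_source hx)).1 hΘ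
  let G : E' → E' × F := fun y => (y, (coordField 𝓘(ℝ, E) Ψ Θ (y, 0)).2)
  have hG : HasFDerivAt G ((ContinuousLinearMap.id ℝ E').prod ((ContinuousLinearMap.snd ℝ E' F).comp
      ((fderiv ℝ (coordField 𝓘(ℝ, E) Ψ Θ) (φ x, 0)).comp (ContinuousLinearMap.inl ℝ E' F)))) (φ x) := by
    refine (hasFDerivAt_id _).prodMk ?_
    refine (ContinuousLinearMap.snd ℝ E' F).hasFDerivAt.comp (φ x) ?_
    exact hd.hasFDerivAt.comp (φ x) ((ContinuousLinearMap.inl ℝ E' F).hasFDerivAt (x := φ x))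
  have hev : normalCoord hι p φ ∘ s =ᶠ[𝓝 x] G ∘ φ := by
    filter_upwards [φ.open_source.mem_nhds hx] with z hz
    simp only [Function.comp_apply, normalCoord_apply, G, s]
    rw [h.sliceCoord_mk hz, ← h.map_eq z hz, IsSmoothCoord.coordField_apply (h.mem_source hz)]
  have hGφ : HasMFDerivAt 𝓘(ℝ, E') 𝓘(ℝ, E' × F) (G ∘ φ) x
      (((ContinuousLinearMap.id ℝ E').prod ((ContinuousLinearMap.snd ℝ E' F).comp
      ((fderiv ℝ (coordField 𝓘(ℝ, E) Ψ Θ) (φ x, 0)).comp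
        (ContinuousLinearMap.inl ℝ E' F)))).comp (coordDeriv 𝓘(ℝ, E') φ x)) :=
    hG.hasMFDerivAt.comp x (h.coordL.mdifferentiableAt hx).hasMFDerivAt
  have hs : MDifferentiableAt 𝓘(ℝ, E') (𝓘(ℝ, E').prod 𝓘(ℝ, F)) s x := by
    have h1 : s =ᶠ[𝓝 x] (normalCoord hι p φ).symm ∘ (normalCoord hι p φ ∘ s) := by
      filter_upwards [φ.open_source.mem_nhds hx] with z hz
      exact ((normalCoord hι p φ).left_inv (h.mem_normalCoord_source.2 hz)).symm
    refine MDifferentiableAt.congr_of_eventuallyEq ?_ h1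
    refine MDifferentiableAt.comp (I' := 𝓘(ℝ, E' × F)) x ?_
      (hGφ.mdifferentiableAt.congr_of_eventuallyEq hev)
    exact hN.mdifferentiable.mdifferentiableAt_symm ((normalCoord hι p φ).map_source hsx)
  have := hN.coordDeriv_mfderiv hs hsx u
  rw [hev.mfderiv_eq, hGφ.mfderiv] at this
  exact this

theorem IsSliceCoord.coordDeriv_verticalLift (h : IsSliceCoord hι p φ Ψ)
    {a : TotalSpace F (NormalFibre hι)} (ha : a.proj ∈ φ.source)
    (v : TangentSpace 𝓘(ℝ, E) (ι a.proj)) :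
    coordDeriv (𝓘(ℝ, E').prod 𝓘(ℝ, F)) (normalCoord hι p φ) a
      (verticalLift hι a (normalMk hι a.proj v)) =
      (0, (coordDeriv 𝓘(ℝ, E) Ψ (ι a.proj) v).2) := by
  have hN := h.isSmoothCoord_normalCoord
  obtain ⟨x, n⟩ := a
  obtain ⟨v₀, rfl⟩ := normalMk_surjective hι x n
  change x ∈ φ.source at ha
  let c : ℝ → TotalSpace F (NormalFibre hι) :=
    fun t => ⟨x, normalMk hι x v₀ + t • normalMk hι x v⟩
  let w₀ : F := (coordDeriv 𝓘(ℝ, E) Ψ (ι x) v₀).2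
  let w : F := (coordDeriv 𝓘(ℝ, E) Ψ (ι x) v).2
  have hc0 : c 0 = ⟨x, normalMk hι x v₀⟩ := by simp [c]
  have hc : normalCoord hι p φ ∘ c = fun t => (φ x, w₀ + t • w) := by
    ext1 t
    simp only [Function.comp_apply, normalCoord_apply, c, w₀, w]
    rw [← map_smul, ← map_add, h.sliceCoord_mk ha, map_add, map_smul]
    rfl
  have hG : HasFDerivAt (fun t : ℝ => (φ x, w₀ + t • w))
      ((0 : ℝ →L[ℝ] E').prod ((1 : ℝ →L[ℝ] ℝ).smulRight w)) 0 := by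
    refine (hasFDerivAt_const _ _).prodMk ?_
    exact (((hasFDerivAt_id (𝕜 := ℝ) (0 : ℝ)).smul_const w).const_add w₀)
  have hcs : ∀ t, c t ∈ (normalCoord hι p φ).source := fun t => h.mem_normalCoord_source.2 ha
  have hcd : MDifferentiableAt 𝓘(ℝ, ℝ) (𝓘(ℝ, E').prod 𝓘(ℝ, F)) c 0 := by
    have h1 : c = (normalCoord hι p φ).symm ∘ (normalCoord hι p φ ∘ c) := by
      ext1 t
      exact ((normalCoord hι p φ).left_inv (hcs t)).symm
    rw [h1]
    refine MDifferentiableAt.comp (I' := 𝓘(ℝ, E' × F)) 0 ?_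
      (hc ▸ hG.hasMFDerivAt.mdifferentiableAt)
    exact hN.mdifferentiable.mdifferentiableAt_symm ((normalCoord hι p φ).map_source (hcs 0))
  have := hN.coordDeriv_mfderiv hcd (hcs 0) (1 : ℝ)
  rw [hc, hG.hasMFDerivAt.mfderiv] at this
  have hval : ((0 : ℝ →L[ℝ] E').prod ((1 : ℝ →L[ℝ] ℝ).smulRight w)) 1 = ((0 : E'), w) := by simp
  have key : coordDeriv (𝓘(ℝ, E').prod 𝓘(ℝ, F)) (normalCoord hι p φ) (c 0)
      (mfderiv 𝓘(ℝ, ℝ) (𝓘(ℝ, E').prod 𝓘(ℝ, F)) c 0 (1 : ℝ)) = (0, w) := this.trans hval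
  rw [hc0] at key
  exact key

theorem IsSliceCoord.coordDeriv_proj (h : IsSliceCoord hι p φ Ψ)
    {a : TotalSpace F (NormalFibre hι)} (ha : a.proj ∈ φ.source)
    (ξ : TangentSpace (𝓘(ℝ, E').prod 𝓘(ℝ, F)) a) :
    coordDeriv 𝓘(ℝ, E') φ a.proj (mfderiv (𝓘(ℝ, E').prod 𝓘(ℝ, F)) 𝓘(ℝ, E')
      (TotalSpace.proj : TotalSpace F (NormalFibre hι) → L) a ξ) =
      (coordDeriv (𝓘(ℝ, E').prod 𝓘(ℝ, F)) (normalCoord hι p φ) a ξ).1 := by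
  have hN := h.isSmoothCoord_normalCoord
  have hd : MDifferentiableAt (𝓘(ℝ, E').prod 𝓘(ℝ, F)) 𝓘(ℝ, E')
      (TotalSpace.proj : TotalSpace F (NormalFibre hι) → L) a :=
    ((contMDiff_proj (NormalFibre hι) (n := ∞)).contMDiffAt).mdifferentiableAt (by simp)
  rw [h.coordL.coordDeriv_mfderiv hd ha]
  have h1 : φ ∘ (TotalSpace.proj : TotalSpace F (NormalFibre hι) → L) =
      (ContinuousLinearMap.fst ℝ E' F) ∘ normalCoord hι p φ := rfl
  rw [h1, mfderiv_comp a (ContinuousLinearMap.fst ℝ E' F).mdifferentiableAt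
    (hN.mdifferentiableAt (h.mem_normalCoord_source.2 ha)), ContinuousLinearMap.mfderiv_eq]
  rfl

theorem IsSliceCoord.coordDeriv_zeroSection (h : IsSliceCoord hι p φ Ψ)
    {x : L} (hx : x ∈ φ.source) (u : TangentSpace 𝓘(ℝ, E') x) :
    coordDeriv (𝓘(ℝ, E').prod 𝓘(ℝ, F)) (normalCoord hι p φ) (zeroSection F (NormalFibre hι) x)
      (mfderiv 𝓘(ℝ, E') (𝓘(ℝ, E').prod 𝓘(ℝ, F)) (zeroSection F (NormalFibre hι)) x u) =
      (coordDeriv 𝓘(ℝ, E') φ x u, 0) := by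
  have hN := h.isSmoothCoord_normalCoord
  have hd : MDifferentiableAt 𝓘(ℝ, E') (𝓘(ℝ, E').prod 𝓘(ℝ, F))
      (zeroSection F (NormalFibre hι)) x :=
    ((contMDiff_zeroSection ℝ (NormalFibre hι) (n := ∞)).contMDiffAt).mdifferentiableAt (by simp)
  have hs : zeroSection F (NormalFibre hι) x ∈ (normalCoord hι p φ).source :=
    h.mem_normalCoord_source.2 hx
  rw [hN.coordDeriv_mfderiv hd hs]
  have h1 : normalCoord hι p φ ∘ zeroSection F (NormalFibre hι) =ᶠ[𝓝 x]
      (ContinuousLinearMap.inl ℝ E' F) ∘ φ := by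
    filter_upwards [φ.open_source.mem_nhds hx] with z hz
    have h2 := h.sliceCoord_mk hz 0
    rw [map_zero, map_zero] at h2
    simp only [Function.comp_apply, normalCoord_apply]
    exact Prod.ext rfl h2
  rw [h1.mfderiv_eq, mfderiv_comp x (ContinuousLinearMap.inl ℝ E' F).mdifferentiableAt
    (h.coordL.mdifferentiableAt hx), ContinuousLinearMap.mfderiv_eq]
  rfl

end Slice

/-! ### Block matrices along a slice -/

section SplitMatrix

variable {E' F : Type*} [NormedAddCommGroup E'] [NormedSpace ℝ E']
  [NormedAddCommGroup F] [NormedSpace ℝ F]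

/-- The tangential part of an endomorphism field along the slice `E' × 0`. -/
def tangentialPart (J : E' × F → E' × F →L[ℝ] E' × F) (y : E') : E' →L[ℝ] E' :=
  (ContinuousLinearMap.fst ℝ E' F).comp ((J (y, 0)).comp (ContinuousLinearMap.inl ℝ E' F))

/-- The transversal part of an endomorphism field along the slice `E' × 0`. -/
def normalPart (J : E' × F → E' × F →L[ℝ] E' × F) (y : E') : F →L[ℝ] F :=
  (ContinuousLinearMap.snd ℝ E' F).comp ((J (y, 0)).comp (ContinuousLinearMap.inr ℝ E' F))

/-- The Christoffel symbol of the connection induced on the normal bundle of the slice. -/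
def normalSymbol (Γ : E' × F → E' × F →L[ℝ] E' × F →L[ℝ] E' × F) (y : E') : E' →L[ℝ] F →L[ℝ] F :=
  (ContinuousLinearMap.compL ℝ F (E' × F) F (ContinuousLinearMap.snd ℝ E' F)).comp
    (((ContinuousLinearMap.compL ℝ F (E' × F) (E' × F)).flip (ContinuousLinearMap.inr ℝ E' F)).comp
      ((Γ (y, 0)).comp (ContinuousLinearMap.inl ℝ E' F)))

/-- The off-diagonal entry `u ↦ k Γ_u - Γ_{j u}` of the almost complex structure on the normal
bundle, where `Γ` is the Christoffel symbol of the induced connection. -/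
def normalTwist (j : E' → E' →L[ℝ] E') (k : E' → F →L[ℝ] F) (Γ : E' → E' →L[ℝ] F →L[ℝ] F) (y : E') :
    E' →L[ℝ] F →L[ℝ] F :=
  (ContinuousLinearMap.compL ℝ F F F (k y)).comp (Γ y) - (Γ y).comp (j y)

/-- The field of endomorphisms `(u, v) ↦ (j u, k v + C_u w)` at the point `(y, w)`. -/
def splitMatrix (j : E' → E' →L[ℝ] E') (C : E' → E' →L[ℝ] F →L[ℝ] F) (k : E' → F →L[ℝ] F)
    (z : E' × F) : E' × F →L[ℝ] E' × F :=
  ((j z.1).comp (ContinuousLinearMap.fst ℝ E' F)).prod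
    ((k z.1).comp (ContinuousLinearMap.snd ℝ E' F) +
      ((C z.1).flip z.2).comp (ContinuousLinearMap.fst ℝ E' F))

variable {J : E' × F → E' × F →L[ℝ] E' × F} {Γ : E' × F → E' × F →L[ℝ] E' × F →L[ℝ] E' × F}
  {j : E' → E' →L[ℝ] E'} {C : E' → E' →L[ℝ] F →L[ℝ] F} {k : E' → F →L[ℝ] F}

theorem normalPart_apply (y : E') (w : F) : normalPart J y w = (J (y, 0) (0, w)).2 := rfl

theorem normalSymbol_apply (y u : E') (w : F) :
    normalSymbol Γ y u w = (Γ (y, 0) (u, 0) (0, w)).2 := rfl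

theorem normalTwist_apply {Γ : E' → E' →L[ℝ] F →L[ℝ] F} (y u : E') (w : F) :
    normalTwist j k Γ y u w = k y (Γ y u w) - Γ y (j y u) w := rfl

theorem splitMatrix_apply (z v : E' × F) :
    splitMatrix j C k z v = (j z.1 v.1, k z.1 v.2 + C z.1 v.1 z.2) := rfl

theorem contDiffAt_slice (y : E') : ContDiffAt ℝ ∞ (fun y : E' => (y, (0 : F))) y :=
  contDiffAt_id.prodMk contDiffAt_const

theorem contDiffAt_tangentialPart {y : E'} (hJ : ContDiffAt ℝ ∞ J (y, 0)) :
    ContDiffAt ℝ ∞ (tangentialPart J) y :=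
  contDiffAt_const.clm_comp ((hJ.comp y (contDiffAt_slice y)).clm_comp contDiffAt_const)

theorem contDiffAt_normalPart {y : E'} (hJ : ContDiffAt ℝ ∞ J (y, 0)) :
    ContDiffAt ℝ ∞ (normalPart J) y :=
  contDiffAt_const.clm_comp ((hJ.comp y (contDiffAt_slice y)).clm_comp contDiffAt_const)

theorem contDiffAt_normalSymbol {y : E'} (hΓ : ContDiffAt ℝ ∞ Γ (y, 0)) :
    ContDiffAt ℝ ∞ (normalSymbol Γ) y :=
  contDiffAt_const.clm_comp (contDiffAt_const.clm_comp
    ((hΓ.comp y (contDiffAt_slice y)).clm_comp contDiffAt_const))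

theorem contDiffAt_normalTwist {Γ : E' → E' →L[ℝ] F →L[ℝ] F} {y : E'}
    (hj : ContDiffAt ℝ ∞ j y) (hk : ContDiffAt ℝ ∞ k y) (hΓ : ContDiffAt ℝ ∞ Γ y) :
    ContDiffAt ℝ ∞ (normalTwist j k Γ) y := by
  refine ContDiffAt.sub (ContDiffAt.clm_comp ?_ hΓ) (hΓ.clm_comp hj)
  exact (ContinuousLinearMap.compL ℝ F F F).contDiff.contDiffAt.comp y hk

set_option synthInstance.maxHeartbeats 200000 in
theorem contDiffAt_splitMatrix {z : E' × F} (hj : ContDiffAt ℝ ∞ j z.1)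
    (hC : ContDiffAt ℝ ∞ C z.1) (hk : ContDiffAt ℝ ∞ k z.1) :
    ContDiffAt ℝ ∞ (splitMatrix j C k) z := by
  have hj' : ContDiffAt ℝ ∞ (fun z : E' × F => j z.1) z := hj.comp z contDiffAt_fst
  have hC' : ContDiffAt ℝ ∞ (fun z : E' × F => C z.1) z := hC.comp z contDiffAt_fst
  have hk' : ContDiffAt ℝ ∞ (fun z : E' × F => k z.1) z := hk.comp z contDiffAt_fst
  have hflip : ContDiffAt ℝ ∞ (fun z : E' × F => (C z.1).flip z.2) z := by
    have h1 : ContDiffAt ℝ ∞ (fun z : E' × F =>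
        ((ContinuousLinearMap.apply ℝ F : F →L[ℝ] (F →L[ℝ] F) →L[ℝ] F) z.2).comp (C z.1)) z :=
      ((ContinuousLinearMap.apply ℝ F : F →L[ℝ] (F →L[ℝ] F) →L[ℝ] F).contDiff.contDiffAt.comp z
        contDiffAt_snd).clm_comp hC'
    exact h1
  have hA : ContDiffAt ℝ ∞ (fun z : E' × F => (j z.1).comp (ContinuousLinearMap.fst ℝ E' F)) z :=
    hj'.clm_comp contDiffAt_const
  have hB : ContDiffAt ℝ ∞ (fun z : E' × F => (k z.1).comp (ContinuousLinearMap.snd ℝ E' F) +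
      ((C z.1).flip z.2).comp (ContinuousLinearMap.fst ℝ E' F)) z :=
    (hk'.clm_comp contDiffAt_const).add
      (hflip.clm_comp contDiffAt_const)
  have hlin : ContDiff ℝ ∞ fun q : (E' × F →L[ℝ] E') × (E' × F →L[ℝ] F) =>
      (ContinuousLinearMap.inl ℝ E' F).comp q.1 + (ContinuousLinearMap.inr ℝ E' F).comp q.2 :=
    (contDiff_const.clm_comp contDiff_fst).add (contDiff_const.clm_comp contDiff_snd)
  refine (hlin.contDiffAt.comp z (hA.prodMk hB)).congr_of_eventuallyEq (Filter.Eventually.of_forall fun z' => ?_)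
  ext v <;> simp [splitMatrix]

/-- The structure on the normal bundle of a slice determined by `J`, in terms of the minimal
connection of the coordinates. -/
def normalStructure (J : E' × F → E' × F →L[ℝ] E' × F) : E' × F → E' × F →L[ℝ] E' × F :=
  splitMatrix (tangentialPart J)
    (normalTwist (tangentialPart J) (normalPart J) (normalSymbol (minimalSymbol J))) (normalPart J)

/-- `J` preserves the tangent spaces of the slice at `y`. -/
def PreservesSlice (J : E' × F → E' × F →L[ℝ] E' × F) (y : E') : Prop :=
  ∀ u, (J (y, 0) (u, 0)).2 = 0

theorem PreservesSlice.apply_inl {y : E'} (h : PreservesSlice J y) (u : E') :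
    J (y, 0) (u, 0) = (tangentialPart J y u, 0) :=
  Prod.ext rfl (h u)

theorem PreservesSlice.snd_apply {y : E'} (h : PreservesSlice J y) (v : E' × F) :
    (J (y, 0) v).2 = normalPart J y v.2 := by
  have : v = (v.1, 0) + (0, v.2) := by simp
  conv_lhs => rw [this, map_add]
  rw [Prod.snd_add, h v.1, zero_add, normalPart_apply]

theorem PreservesSlice.tangentialPart_sq {y : E'} (h : PreservesSlice J y)
    (hsq : ∀ v, J (y, 0) (J (y, 0) v) = -v) (u : E') :
    tangentialPart J y (tangentialPart J y u) = -u := by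
  have := hsq (u, 0)
  rw [h.apply_inl, h.apply_inl] at this
  exact congrArg Prod.fst this

theorem PreservesSlice.normalPart_sq {y : E'} (h : PreservesSlice J y)
    (hsq : ∀ v, J (y, 0) (J (y, 0) v) = -v) (w : F) :
    normalPart J y (normalPart J y w) = -w := by
  rw [normalPart_apply y w, ← h.snd_apply, hsq]
  rfl

theorem splitMatrix_sq {z : E' × F} (hj : ∀ u, j z.1 (j z.1 u) = -u) (hk : ∀ w, k z.1 (k z.1 w) = -w)
    (hC : ∀ u w, C z.1 (j z.1 u) w = -k z.1 (C z.1 u w)) (v : E' × F) :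
    splitMatrix j C k z (splitMatrix j C k z v) = -v := by
  rw [splitMatrix_apply, splitMatrix_apply]
  ext
  · simp [hj]
  · simp [hk, hC]

theorem normalTwist_antilinear {Γ : E' → E' →L[ℝ] F →L[ℝ] F} {y : E'}
    (hj : ∀ u, j y (j y u) = -u) (hk : ∀ w, k y (k y w) = -w) (u : E') (w : F) :
    normalTwist j k Γ y (j y u) w = -k y (normalTwist j k Γ y u w) := by
  simp only [normalTwist_apply, hj, map_sub, hk, map_neg, neg_apply]
  abel

/-- The off-diagonal entry does not depend on the minimal connection: two minimal connections differ
by a symmetric complex bilinear form. -/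
theorem normalTwist_eq_of_isMinimalSymbolAt {y : E'} (h : PreservesSlice J y)
    {Γ' : E' × F → E' × F →L[ℝ] E' × F →L[ℝ] E' × F} (hΓ : IsMinimalSymbolAt J (Γ (y, 0)) (y, 0))
    (hΓ' : IsMinimalSymbolAt J (Γ' (y, 0)) (y, 0)) :
    normalTwist (tangentialPart J) (normalPart J) (normalSymbol Γ) y =
      normalTwist (tangentialPart J) (normalPart J) (normalSymbol Γ') y := by
  have hsymm : ∀ X Y, Γ (y, 0) X Y - Γ' (y, 0) X Y = Γ (y, 0) Y X - Γ' (y, 0) Y X := by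
    intro X Y
    have := (hΓ.torsion X Y).trans (hΓ'.torsion X Y).symm
    rw [sub_eq_sub_iff_add_eq_add] at this ⊢
    rw [add_comm] at this
    rw [← sub_eq_zero] at this ⊢
    rw [← this]; abel
  have hlin : ∀ X Y, Γ (y, 0) X (J (y, 0) Y) - Γ' (y, 0) X (J (y, 0) Y) =
      J (y, 0) (Γ (y, 0) X Y - Γ' (y, 0) X Y) := by
    intro X Y
    rw [map_sub, ← hΓ.parallel, ← hΓ'.parallel]; abel
  ext u w
  rw [← sub_eq_zero, normalTwist_apply, normalTwist_apply]
  have h1 : Γ (y, 0) (J (y, 0) (u, 0)) (0, w) - Γ' (y, 0) (J (y, 0) (u, 0)) (0, w) =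
      J (y, 0) (Γ (y, 0) (u, 0) (0, w) - Γ' (y, 0) (u, 0) (0, w)) := by
    rw [hsymm, hlin, hsymm]
  have h2 := congrArg Prod.snd h1
  rw [h.snd_apply, h.apply_inl, Prod.snd_sub, Prod.snd_sub] at h2
  simp only [normalSymbol_apply]
  rw [map_sub] at h2
  rw [sub_sub_sub_comm, ← h2, sub_self]

/-- The minimal connection of coordinates adapted to a slice leaves the slice totally geodesic. -/
theorem minimalSymbol_slice {y : E'} (hJ : DifferentiableAt ℝ J (y, 0))
    (h : ∀ᶠ y' in 𝓝 y, PreservesSlice J y') (u u' : E') :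
    (minimalSymbol J (y, 0) (u, 0) (u', 0)).2 = 0 := by
  have hd : ∀ u u' : E', (fderiv ℝ J (y, 0) (u, 0) (u', 0)).2 = 0 := by
    intro u u'
    let A : (E' × F →L[ℝ] E' × F) →L[ℝ] F := (ContinuousLinearMap.snd ℝ E' F).comp
      (ContinuousLinearMap.apply ℝ (E' × F) (u', (0 : F)))
    have h1 : HasFDerivAt (fun y' : E' => A (J (y', 0)))
        (A.comp ((fderiv ℝ J (y, 0)).comp (ContinuousLinearMap.inl ℝ E' F))) y :=
      A.hasFDerivAt.comp y (hJ.hasFDerivAt.comp y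
        ((ContinuousLinearMap.inl ℝ E' F).hasFDerivAt (x := y)))
    have h2 : (fun y' : E' => A (J (y', 0))) =ᶠ[𝓝 y] fun _ => 0 := by
      filter_upwards [h] with y' hy' using hy' u'
    have h3 := h2.fderiv_eq (𝕜 := ℝ)
    rw [h1.fderiv, fderiv_fun_const] at h3
    exact congrArg (fun B : E' →L[ℝ] F => B u) h3
  have hy := h.self_of_nhds
  rw [minimalSymbol_apply, hy.apply_inl]
  simp only [Prod.smul_snd, Prod.snd_add, hy.snd_apply, hd, map_zero, add_zero, smul_zero]

end SplitMatrix

/-! ### The induced structure in slice coordinates -/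

section Induced

variable {E E' F : Type*} [NormedAddCommGroup E] [NormedSpace ℝ E] [FiniteDimensional ℝ E]
  [NormedAddCommGroup E'] [NormedSpace ℝ E'] [FiniteDimensional ℝ E']
  [NormedAddCommGroup F] [NormedSpace ℝ F] [FiniteDimensional ℝ F]
  {M : Type*} [TopologicalSpace M] [ChartedSpace E M] [IsManifold 𝓘(ℝ, E) ∞ M]
  {L : Type*} [TopologicalSpace L] [ChartedSpace E' L] [IsManifold 𝓘(ℝ, E') ∞ L]
  {ι : L → M} {hι : IsImmersionOfComplement F 𝓘(ℝ, E') 𝓘(ℝ, E) ∞ ι}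
  {J : EndField 𝓘(ℝ, E) M}
  {p : L} {φ : OpenPartialHomeomorph L E'} {Ψ : OpenPartialHomeomorph M (E' × F)}

namespace IsSliceCoord

theorem preservesSlice (h : IsSliceCoord hι p φ Ψ)
    (hPH : ∀ x : L, ∀ v ∈ tangentImage (E := E) (E' := E') ι x,
      J (ι x) v ∈ tangentImage (E := E) (E' := E') ι x) {y : E'} (hy : y ∈ φ.target) :
    PreservesSlice (coordEnd 𝓘(ℝ, E) Ψ J) y := by
  intro u
  have hz := φ.map_target hy
  have hs := h.mem_source hz
  have h1 : coordInv 𝓘(ℝ, E) Ψ (ι (φ.symm y)) (u, 0) ∈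
      tangentImage (E := E) (E' := E') ι (φ.symm y) := by
    rw [h.mem_tangentImage_iff hz, h.coordM.coordDeriv_coordInv hs]
  have h2 := (h.mem_tangentImage_iff hz _).1 (hPH _ _ h1)
  rwa [← h.coordM.coordEnd_apply hs J, h.coordM.coordDeriv_coordInv hs, h.map_eq _ hz,
    φ.right_inv hy] at h2

theorem mfderiv_restrictedStructure (h : IsSliceCoord hι p φ Ψ) {x : L} (hx : x ∈ φ.source)
    (hPH : ∀ x : L, ∀ v ∈ tangentImage (E := E) (E' := E') ι x,
      J (ι x) v ∈ tangentImage (E := E) (E' := E') ι x) (u : TangentSpace 𝓘(ℝ, E') x) :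
    mfderiv 𝓘(ℝ, E') 𝓘(ℝ, E) ι x (restrictedStructure J ι x u) =
      J (ι x) (mfderiv 𝓘(ℝ, E') 𝓘(ℝ, E) ι x u) := by
  have hinj : Function.Injective (mfderiv 𝓘(ℝ, E') 𝓘(ℝ, E) ι x) := by
    intro a b hab
    have := congrArg (coordDeriv 𝓘(ℝ, E) Ψ (ι x)) hab
    rw [h.coordDeriv_mfderiv hx, h.coordDeriv_mfderiv hx] at this
    exact h.coordL.coordDeriv_injective hx (congrArg Prod.fst this)
  obtain ⟨u', hu'⟩ := hPH x _ ⟨u, rfl⟩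
  have h1 : restrictedStructure J ι x u = u' := by
    have h2 := LinearMap.leftInverse_apply_of_inj
      (f := (mfderiv 𝓘(ℝ, E') 𝓘(ℝ, E) ι x : E' →L[ℝ] E).toLinearMap)
      (LinearMap.ker_eq_bot.2 hinj) u'
    exact (congrArg (mfderiv 𝓘(ℝ, E') 𝓘(ℝ, E) ι x : E' →L[ℝ] E).toLinearMap.leftInverse
      hu').symm.trans h2
  rw [h1]
  exact hu'

theorem coordDeriv_restrictedStructure (h : IsSliceCoord hι p φ Ψ) {x : L} (hx : x ∈ φ.source)
    (hPH : ∀ x : L, ∀ v ∈ tangentImage (E := E) (E' := E') ι x,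
      J (ι x) v ∈ tangentImage (E := E) (E' := E') ι x) (u : TangentSpace 𝓘(ℝ, E') x) :
    coordDeriv 𝓘(ℝ, E') φ x (restrictedStructure J ι x u) =
      tangentialPart (coordEnd 𝓘(ℝ, E) Ψ J) (φ x) (coordDeriv 𝓘(ℝ, E') φ x u) := by
  have h1 := congrArg (coordDeriv 𝓘(ℝ, E) Ψ (ι x)) (h.mfderiv_restrictedStructure hx hPH u)
  rw [h.coordDeriv_mfderiv hx, ← h.coordM.coordEnd_apply (h.mem_source hx) J,
    h.coordDeriv_mfderiv hx, h.map_eq x hx] at h1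
  exact congrArg Prod.fst h1

/-- The Christoffel symbol of a connection for which the submanifold is totally geodesic. -/
theorem symbol_slice [T2Space M] (h : IsSliceCoord hι p φ Ψ) {U : Set M}
    {cov : ConnectionOp 𝓘(ℝ, E) M} {Γ : E' × F → E' × F →L[ℝ] E' × F →L[ℝ] E' × F}
    (hΓ : HasSymbolOn 𝓘(ℝ, E) Ψ cov U Γ) (htg : IsTotallyGeodesicOn (E' := E') ι U cov)
    {x : L} (hx : x ∈ φ.source) (hxU : ι x ∈ U) (u u' : E') :
    (Γ (φ x, 0) (u, 0) (u', 0)).2 = 0 := by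
  have hs := h.mem_source hx
  obtain ⟨σ, hσ, hσc⟩ := exists_field_const h.coordM hs ((u', 0) : E' × F)
  have hσd : MDiffAt (T% σ) (ι x) := (hσ _).mdifferentiableAt (by simp)
  have h1 : ∀ᶠ z in 𝓝 x, σ (ι z) ∈ tangentImage (E := E) (E' := E') ι z := by
    have hcont : Filter.Tendsto (fun z => Ψ (ι z)) (𝓝 x) (𝓝 (Ψ (ι x))) :=
      (Ψ.continuousAt hs).comp (hι.contMDiff x).continuousAt
    filter_upwards [hcont.eventually hσc, φ.open_source.mem_nhds hx] with z hz hzs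
    rw [h.mem_tangentImage_iff hzs, ← IsSmoothCoord.coordField_apply (h.mem_source hzs), hz]
  have h2 := htg x hxU σ hσd h1 (coordInv 𝓘(ℝ, E) Ψ (ι x) (u, 0)) (by
    rw [h.mem_tangentImage_iff hx, h.coordM.coordDeriv_coordInv hs])
  rw [h.mem_tangentImage_iff hx, hΓ (ι x) hxU hs σ hσd, h.coordM.coordDeriv_coordInv hs,
    Filter.EventuallyEq.fderiv_eq (f := fun _ => ((u', 0) : E' × F)) hσc, hσc.self_of_nhds,
    h.map_eq x hx] at h2
  simpa using h2

/-- A connection whose Christoffel symbol is tangent to the slice. -/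
theorem isTotallyGeodesicOn (h : IsSliceCoord hι p φ Ψ) {U : Set M} (hU : U ⊆ Ψ.source)
    {cov : ConnectionOp 𝓘(ℝ, E) M} {Γ : E' × F → E' × F →L[ℝ] E' × F →L[ℝ] E' × F}
    (hΓ : HasSymbolOn 𝓘(ℝ, E) Ψ cov U Γ)
    (hsl : ∀ y ∈ φ.target, ∀ u u', (Γ (y, 0) (u, 0) (u', 0)).2 = 0) :
    IsTotallyGeodesicOn (E' := E') ι U cov := by
  intro x hxU Y hY htan v hv
  have hs := hU hxU
  have hx : x ∈ φ.source := by rw [← h.preimage_source]; exact hs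
  have hYd := (h.coordM.mdifferentiableAt_field_iff hs).1 hY
  rw [h.map_eq x hx] at hYd
  rw [h.mem_tangentImage_iff hx] at hv ⊢
  have hv' : coordDeriv 𝓘(ℝ, E) Ψ (ι x) v = ((coordDeriv 𝓘(ℝ, E) Ψ (ι x) v).1, 0) :=
    Prod.ext rfl hv
  have htan' : ∀ᶠ y in 𝓝 (φ x), (coordField 𝓘(ℝ, E) Ψ Y (y, 0)).2 = 0 := by
    have h1 : ∀ᶠ y in 𝓝 (φ x), Y (ι (φ.symm y)) ∈
        tangentImage (E := E) (E' := E') ι (φ.symm y) := by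
      refine (φ.continuousAt_symm (φ.map_source hx)).eventually
        (p := fun z => Y (ι z) ∈ tangentImage (E := E) (E' := E') ι z) ?_
      rwa [φ.left_inv hx]
    filter_upwards [h1, φ.open_target.mem_nhds (φ.map_source hx)] with y hy hyt
    have hz := φ.map_target hyt
    rw [h.mem_tangentImage_iff hz, ← IsSmoothCoord.coordField_apply (h.mem_source hz),
      h.map_eq _ hz, φ.right_inv hyt] at hy
    exact hy
  have hder : ∀ u : E', (fderiv ℝ (coordField 𝓘(ℝ, E) Ψ Y) (φ x, 0) (u, 0)).2 = 0 := by
    intro u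
    have h1 : HasFDerivAt (fun y : E' => (coordField 𝓘(ℝ, E) Ψ Y (y, 0)).2)
        ((ContinuousLinearMap.snd ℝ E' F).comp ((fderiv ℝ (coordField 𝓘(ℝ, E) Ψ Y) (φ x, 0)).comp
          (ContinuousLinearMap.inl ℝ E' F))) (φ x) :=
      (ContinuousLinearMap.snd ℝ E' F).hasFDerivAt.comp (φ x)
        (HasFDerivAt.comp (g := coordField 𝓘(ℝ, E) Ψ Y) (f := fun y : E' => (y, (0 : F))) (φ x)
          hYd.hasFDerivAt ((ContinuousLinearMap.inl ℝ E' F).hasFDerivAt (x := φ x)))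
    have h2 := (show (fun y : E' => (coordField 𝓘(ℝ, E) Ψ Y (y, 0)).2) =ᶠ[𝓝 (φ x)] fun _ => 0
      from htan').fderiv_eq (𝕜 := ℝ)
    rw [h1.fderiv, fderiv_fun_const] at h2
    exact congrArg (fun B : E' →L[ℝ] F => B u) h2
  have hval : coordField 𝓘(ℝ, E) Ψ Y (φ x, 0) = ((coordField 𝓘(ℝ, E) Ψ Y (φ x, 0)).1, 0) :=
    Prod.ext rfl htan'.self_of_nhds
  rw [hΓ (ι x) hxU hs Y hY, h.map_eq x hx, hv', Prod.snd_add, hder, zero_add, hval]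
  exact hsl _ (φ.map_source hx) _ _

/-- Horizontal lifts in slice coordinates. -/
theorem isHorizontalLift_iff [T2Space M] (h : IsSliceCoord hι p φ Ψ) {U : Set M}
    {cov : ConnectionOp 𝓘(ℝ, E) M} {Γ : E' × F → E' × F →L[ℝ] E' × F →L[ℝ] E' × F}
    (hΓ : HasSymbolOn 𝓘(ℝ, E) Ψ cov U Γ) (htg : IsTotallyGeodesicOn (E' := E') ι U cov)
    {a : TotalSpace F (NormalFibre hι)} (ha : a.proj ∈ φ.source) (haU : ι a.proj ∈ U)
    (u : TangentSpace 𝓘(ℝ, E') a.proj) (ξ : TangentSpace (𝓘(ℝ, E').prod 𝓘(ℝ, F)) a) :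
    IsHorizontalLift hι cov a u ξ ↔
      coordDeriv (𝓘(ℝ, E').prod 𝓘(ℝ, F)) (normalCoord hι p φ) a ξ =
        (coordDeriv 𝓘(ℝ, E') φ a.proj u, -normalSymbol Γ (φ a.proj)
          (coordDeriv 𝓘(ℝ, E') φ a.proj u) (normalCoord hι p φ a).2) := by
  have hN := h.isSmoothCoord_normalCoord
  have hslice := h.symbol_slice hΓ htg ha haU
  have haN : a ∈ (normalCoord hι p φ).source := h.mem_normalCoord_source.2 ha
  obtain ⟨x, n⟩ := a
  change x ∈ φ.source at ha
  change ι x ∈ U at haU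
  have hs := h.mem_source ha
  set ũ := coordDeriv 𝓘(ℝ, E') φ x u with hũ
  -- for any field `Θ`: the transversal coordinate of `∇_u Θ`
  have hcov : ∀ Θ : Π y : M, TangentSpace 𝓘(ℝ, E) y, MDiffAt (T% Θ) (ι x) →
      normalMk hι x (Θ (ι x)) = n →
      (coordDeriv 𝓘(ℝ, E) Ψ (ι x) (cov Θ (ι x) (mfderiv 𝓘(ℝ, E') 𝓘(ℝ, E) ι x u))).2 =
        (fderiv ℝ (coordField 𝓘(ℝ, E) Ψ Θ) (φ x, 0) (ũ, 0)).2 +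
          normalSymbol Γ (φ x) ũ (sliceCoord hι p x n) := by
    rintro Θ hΘ rfl
    rw [hΓ (ι x) haU hs Θ hΘ, h.coordDeriv_mfderiv ha, h.map_eq x ha, Prod.snd_add,
      h.sliceCoord_mk ha, ← IsSmoothCoord.coordField_apply hs, h.map_eq x ha, normalSymbol_apply]
    congr 1
    have : coordField 𝓘(ℝ, E) Ψ Θ (φ x, 0) = ((coordField 𝓘(ℝ, E) Ψ Θ (φ x, 0)).1, 0) +
        (0, (coordField 𝓘(ℝ, E) Ψ Θ (φ x, 0)).2) := by simp
    conv_lhs => rw [this, map_add, Prod.snd_add, hslice, zero_add]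
  constructor
  · rintro ⟨Θ, hΘ, hn, hpar, hξ⟩
    change normalMk hι x (Θ (ι x)) = n at hn
    subst hn
    subst hξ
    have h1 := h.coordDeriv_section ha hΘ u
    rw [h.normalMk_eq_zero_iff ha, hcov Θ hΘ rfl] at hpar
    rw [eq_neg_of_add_eq_zero_left hpar] at h1
    exact h1
  · intro hξ
    obtain ⟨v₀, rfl⟩ := normalMk_surjective hι x n
    -- a transversal field which is affine in the coordinates, with the value representing `n` and
    -- the derivative which makes it parallel in the direction `u`
    let w : F := (coordDeriv 𝓘(ℝ, E) Ψ (ι x) v₀).2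
    let B : E' →L[ℝ] F := -(normalSymbol Γ (φ x)).flip w
    let G : E' × F → E' × F := fun z => (0, w + B (z.1 - φ x))
    let Θ : Π y : M, TangentSpace 𝓘(ℝ, E) y := fun y => coordInv 𝓘(ℝ, E) Ψ y (G (Ψ y))
    have hΘG : coordField 𝓘(ℝ, E) Ψ Θ =ᶠ[𝓝 (Ψ (ι x))] G := by
      filter_upwards [Ψ.open_target.mem_nhds (Ψ.map_source hs)] with z hz
      simp only [coordField, Θ, h.coordM.coordDeriv_coordInv (Ψ.map_target hz), Ψ.right_inv hz]
    have hG : ∀ z, HasFDerivAt G ((0 : E' × F →L[ℝ] E').prod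
        (B.comp (ContinuousLinearMap.fst ℝ E' F))) z := by
      intro z
      refine (hasFDerivAt_const _ _).prodMk (HasFDerivAt.const_add w ?_)
      exact B.hasFDerivAt.comp z
        ((ContinuousLinearMap.fst ℝ E' F).hasFDerivAt.sub_const (φ x))
    have hΘ : MDiffAt (T% Θ) (ι x) := by
      rw [h.coordM.mdifferentiableAt_field_iff hs]
      exact (hG _).differentiableAt.congr_of_eventuallyEq hΘG
    have hGx : G (φ x, 0) = (0, w) := by simp [G]
    have hn : normalMk hι x (Θ (ι x)) = normalMk hι x v₀ := by
      rw [← sub_eq_zero, ← map_sub, h.normalMk_eq_zero_iff ha, map_sub,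
        ← IsSmoothCoord.coordField_apply hs, hΘG.self_of_nhds, h.map_eq x ha, hGx]
      simp [w]
    have hDΘ : (fderiv ℝ (coordField 𝓘(ℝ, E) Ψ Θ) (φ x, 0) (ũ, 0)).2 =
        -normalSymbol Γ (φ x) ũ w := by
      rw [← h.map_eq x ha, hΘG.fderiv_eq, (hG _).fderiv]
      simp [B]
    have hw : sliceCoord hι p x (normalMk hι x v₀) = w := h.sliceCoord_mk ha v₀
    refine ⟨Θ, hΘ, hn, ?_, ?_⟩
    · refine (h.normalMk_eq_zero_iff ha _).2 ?_
      rw [hcov Θ hΘ hn, hDΘ, hw]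
      simp
    · have h1 := h.coordDeriv_section ha hΘ u
      rw [hn, hDΘ] at h1
      apply hN.coordDeriv_injective haN
      refine hξ.trans (Eq.trans ?_ h1.symm)
      rw [normalCoord_apply, hw]

theorem existsUnique_isHorizontalLift [T2Space M] (h : IsSliceCoord hι p φ Ψ) {U : Set M}
    {cov : ConnectionOp 𝓘(ℝ, E) M} {Γ : E' × F → E' × F →L[ℝ] E' × F →L[ℝ] E' × F}
    (hΓ : HasSymbolOn 𝓘(ℝ, E) Ψ cov U Γ) (htg : IsTotallyGeodesicOn (E' := E') ι U cov)
    {a : TotalSpace F (NormalFibre hι)} (ha : a.proj ∈ φ.source) (haU : ι a.proj ∈ U)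
    (u : TangentSpace 𝓘(ℝ, E') a.proj) : ∃! ξ, IsHorizontalLift hι cov a u ξ := by
  have hN := h.isSmoothCoord_normalCoord
  have haN : a ∈ (normalCoord hι p φ).source := h.mem_normalCoord_source.2 ha
  simp only [h.isHorizontalLift_iff hΓ htg ha haU]
  exact ⟨coordInv _ _ a _, hN.coordDeriv_coordInv haN _, fun ξ hξ =>
    hN.coordDeriv_injective haN (hξ.trans (hN.coordDeriv_coordInv haN _).symm)⟩

/-- The direct sum structure on `T_a (N_L M)` in slice coordinates. -/
theorem isSplitStructureAt_iff [T2Space M] (h : IsSliceCoord hι p φ Ψ) (hJ : IsAlmostComplex J)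
    (hPH : ∀ x : L, ∀ v ∈ tangentImage (E := E) (E' := E') ι x,
      J (ι x) v ∈ tangentImage (E := E) (E' := E') ι x) {U : Set M} (hU : IsOpen U)
    {cov : ConnectionOp 𝓘(ℝ, E) M} (hmin : IsMinimalConnectionOn J U cov)
    (htg : IsTotallyGeodesicOn (E' := E') ι U cov)
    {a : TotalSpace F (NormalFibre hι)} (ha : a.proj ∈ φ.source) (haU : ι a.proj ∈ U)
    (K : TangentSpace (𝓘(ℝ, E').prod 𝓘(ℝ, F)) a →L[ℝ] TangentSpace (𝓘(ℝ, E').prod 𝓘(ℝ, F)) a) :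
    IsSplitStructureAt hι J cov a K ↔
      ∀ ξ, coordDeriv (𝓘(ℝ, E').prod 𝓘(ℝ, F)) (normalCoord hι p φ) a (K ξ) =
        normalStructure (coordEnd 𝓘(ℝ, E) Ψ J) (normalCoord hι p φ a)
          (coordDeriv (𝓘(ℝ, E').prod 𝓘(ℝ, F)) (normalCoord hι p φ) a ξ) := by
  obtain ⟨Γ, hΓ, -⟩ := exists_symbol h.coordM hU hmin.isCovariantDerivativeOn hmin.smooth
  have hN := h.isSmoothCoord_normalCoord
  have haN : a ∈ (normalCoord hι p φ).source := h.mem_normalCoord_source.2 ha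
  have hs := h.mem_source ha
  have hpres := h.preservesSlice hPH (φ.map_source ha)
  have hy : (φ a.proj, (0 : F)) ∈ Ψ.target := h.map_mem_target (φ.map_source ha)
  have hΓm := hΓ.isMinimalSymbolAt hJ h.coordM haU hs hmin
  rw [h.map_eq _ ha] at hΓm
  have htw := normalTwist_eq_of_isMinimalSymbolAt (Γ' := minimalSymbol (coordEnd 𝓘(ℝ, E) Ψ J))
    hpres hΓm (isMinimalSymbolAt_minimalSymbol hJ h.coordM hy)
  have hJt : ∀ u : TangentSpace 𝓘(ℝ, E') a.proj, _ :=
    fun u => h.coordDeriv_restrictedStructure ha hPH u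
  set w := (normalCoord hι p φ a).2 with hw
  have hstr : ∀ v : E' × F, normalStructure (coordEnd 𝓘(ℝ, E) Ψ J) (normalCoord hι p φ a) v =
      (tangentialPart (coordEnd 𝓘(ℝ, E) Ψ J) (φ a.proj) v.1,
        normalPart (coordEnd 𝓘(ℝ, E) Ψ J) (φ a.proj) v.2 +
          (normalPart (coordEnd 𝓘(ℝ, E) Ψ J) (φ a.proj) (normalSymbol Γ (φ a.proj) v.1 w) -
            normalSymbol Γ (φ a.proj) (tangentialPart (coordEnd 𝓘(ℝ, E) Ψ J) (φ a.proj) v.1) w)) := by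
    intro v
    rw [normalStructure, splitMatrix_apply, show (normalCoord hι p φ a).1 = φ a.proj from rfl, ← htw,
      normalTwist_apply]
  have hvert : ∀ v : TangentSpace 𝓘(ℝ, E) (ι a.proj),
      coordDeriv _ (normalCoord hι p φ) a (verticalLift hι a (normalMk hι a.proj (J (ι a.proj) v))) =
      normalStructure (coordEnd 𝓘(ℝ, E) Ψ J) (normalCoord hι p φ a)
        (coordDeriv _ (normalCoord hι p φ) a (verticalLift hι a (normalMk hι a.proj v))) := by
    intro v
    rw [h.coordDeriv_verticalLift ha, h.coordDeriv_verticalLift ha, hstr,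
      ← h.coordM.coordEnd_apply hs J, h.map_eq _ ha, hpres.snd_apply]
    simp
  constructor
  · rintro ⟨h1, h2⟩ ξ
    -- decompose `ξ` into its horizontal and its vertical part
    set v := coordDeriv (𝓘(ℝ, E').prod 𝓘(ℝ, F)) (normalCoord hι p φ) a ξ with hv
    let u : TangentSpace 𝓘(ℝ, E') a.proj := coordInv 𝓘(ℝ, E') φ a.proj v.1
    have hu : coordDeriv 𝓘(ℝ, E') φ a.proj u = v.1 := h.coordL.coordDeriv_coordInv ha _
    obtain ⟨ξh, hξh, -⟩ := h.existsUnique_isHorizontalLift hΓ htg ha haU u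
    have hKh := (h.isHorizontalLift_iff hΓ htg ha haU _ _).1 (h2 u ξh hξh)
    have hξh' := (h.isHorizontalLift_iff hΓ htg ha haU _ _).1 hξh
    rw [hJt u, hu] at hKh
    rw [hu] at hξh'
    let t : TangentSpace 𝓘(ℝ, E) (ι a.proj) :=
      coordInv 𝓘(ℝ, E) Ψ (ι a.proj) (0, v.2 + normalSymbol Γ (φ a.proj) v.1 w)
    have hξ : ξ = ξh + verticalLift hι a (normalMk hι a.proj t) := by
      apply hN.coordDeriv_injective haN
      rw [map_add, hξh', h.coordDeriv_verticalLift ha, h.coordM.coordDeriv_coordInv hs, ← hv]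
      ext <;> simp [hw]
    rw [← hv] at *
    rw [hξ, map_add, map_add, hKh, h1 t, hvert t]
    have hv' : v = (v.1, -normalSymbol Γ (φ a.proj) v.1 w) +
        coordDeriv _ (normalCoord hι p φ) a (verticalLift hι a (normalMk hι a.proj t)) := by
      rw [h.coordDeriv_verticalLift ha, h.coordM.coordDeriv_coordInv hs]
      ext <;> simp
    conv_rhs => rw [hv', map_add]
    congr 1
    rw [hstr]
    ext
    · simp
    · simp only [← hw, map_neg]
      abel
  · intro hK
    refine ⟨fun v => hN.coordDeriv_injective haN ((hK _).trans (hvert v).symm), fun u ξ hξ => ?_⟩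
    rw [h.isHorizontalLift_iff hΓ htg ha haU] at hξ ⊢
    rw [hK, hξ, hstr, hJt u]
    ext
    · simp
    · simp only [← hw, map_neg]
      abel

end IsSliceCoord

end Induced

/-! ### Existence of minimal connections for which the submanifold is totally geodesic -/

section Existence

variable {E E' F : Type*} [NormedAddCommGroup E] [NormedSpace ℝ E] [FiniteDimensional ℝ E]
  [NormedAddCommGroup E'] [NormedSpace ℝ E'] [FiniteDimensional ℝ E']
  [NormedAddCommGroup F] [NormedSpace ℝ F]
  {M : Type*} [TopologicalSpace M] [ChartedSpace E M] [IsManifold 𝓘(ℝ, E) ∞ M]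
  {L : Type*} [TopologicalSpace L] [ChartedSpace E' L] [IsManifold 𝓘(ℝ, E') ∞ L]
  {J : EndField 𝓘(ℝ, E) M} {ι : L → M}

theorem finiteDimensional_of_isImmersionOfComplement
    (hι : IsImmersionOfComplement F 𝓘(ℝ, E') 𝓘(ℝ, E) ∞ ι) (p : L) : FiniteDimensional ℝ F := by
  have hinj : Function.Injective (((hι.isImmersionAt p).equiv : E' × F →L[ℝ] E).comp
      (ContinuousLinearMap.inr ℝ E' F)).toLinearMap := by
    intro a b hab
    exact congrArg Prod.snd ((hι.isImmersionAt p).equiv.injective hab)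
  exact FiniteDimensional.of_injective _ hinj

theorem exists_isTotallyGeodesicOn_glue [T2Space M] [SigmaCompactSpace M] {A : Type*}
    {W : A → Set M} (hW : ∀ i, IsOpen (W i)) {cov : A → ConnectionOp 𝓘(ℝ, E) M}
    (hmin : ∀ i, IsMinimalConnectionOn J (W i) (cov i))
    (htg : ∀ i, IsTotallyGeodesicOn (E' := E') ι (W i) (cov i)) :
    ∃ c : ConnectionOp 𝓘(ℝ, E) M, IsMinimalConnectionOn J (⋃ i, W i) c ∧
      IsTotallyGeodesicOn (E' := E') ι (⋃ i, W i) c := by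
  obtain ⟨c, hc, hs⟩ := exists_isMinimalConnectionOn_glue hW hmin
  refine ⟨c, hc, fun x hx Y hY htan v hv => ?_⟩
  obtain ⟨s, a, hsW, hsum⟩ := hs _ hx
  rw [hsum Y]
  have : (∑ i ∈ s, a i • cov i Y (ι x)) v = ∑ i ∈ s, a i • cov i Y (ι x) v := by
    simp
  rw [this]
  exact Submodule.sum_mem _ fun i hi => Submodule.smul_mem _ _ (htg i x (hsW i hi) Y hY htan v hv)

theorem IsSliceCoord.isTotallyGeodesicOn_minimalConnection [FiniteDimensional ℝ F] [T2Space M]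
    {hι : IsImmersionOfComplement F 𝓘(ℝ, E') 𝓘(ℝ, E) ∞ ι}
    {p : L} {φ : OpenPartialHomeomorph L E'} {Ψ : OpenPartialHomeomorph M (E' × F)}
    (h : IsSliceCoord hι p φ Ψ) (hJ : IsAlmostComplex J)
    (hPH : ∀ x : L, ∀ v ∈ tangentImage (E := E) (E' := E') ι x,
      J (ι x) v ∈ tangentImage (E := E) (E' := E') ι x) :
    IsTotallyGeodesicOn (E' := E') ι Ψ.source (minimalConnection J Ψ) := by
  refine h.isTotallyGeodesicOn subset_rfl (hasSymbolOn_minimalConnection h.coordM _) ?_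
  intro y hy u u'
  refine minimalSymbol_slice ?_ ?_ u u'
  · exact (hJ.contDiffAt_coordEnd h.coordM (h.map_mem_target hy)).differentiableAt (by simp)
  · filter_upwards [φ.open_target.mem_nhds hy] with y' hy' using h.preservesSlice hPH hy'

theorem exists_isMinimalConnectionOn_isTotallyGeodesicOn [T2Space M] [SigmaCompactSpace M]
    (hJ : IsAlmostComplex J) (hι : IsImmersionOfComplement F 𝓘(ℝ, E') 𝓘(ℝ, E) ∞ ι)
    (hemb : IsEmbedding ι)
    (hPH : ∀ x : L, ∀ v ∈ tangentImage (E := E) (E' := E') ι x,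
      J (ι x) v ∈ tangentImage (E := E) (E' := E') ι x) :
    ∃ (U : Set M) (cov : ConnectionOp 𝓘(ℝ, E) M),
      IsOpen U ∧ range ι ⊆ U ∧ (IsClosed (range ι) → U = univ) ∧
        IsMinimalConnectionOn J U cov ∧ IsTotallyGeodesicOn (E' := E') ι U cov := by
  -- glue all minimal connections on open sets for which `L` is totally geodesic
  let A := {q : Set M × ConnectionOp 𝓘(ℝ, E) M // IsOpen q.1 ∧ IsMinimalConnectionOn J q.1 q.2 ∧
    IsTotallyGeodesicOn (E' := E') ι q.1 q.2}
  obtain ⟨c, hc, hctg⟩ := exists_isTotallyGeodesicOn_glue (J := J) (ι := ι) (E' := E')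
    (A := A) (W := fun q => q.1.1) (fun q => q.2.1) (cov := fun q => q.1.2) (fun q => q.2.2.1)
    (fun q => q.2.2.2)
  have hrange : range ι ⊆ ⋃ q : A, q.1.1 := by
    rintro _ ⟨p, rfl⟩
    have := finiteDimensional_of_isImmersionOfComplement hι p
    obtain ⟨φ, Ψ, h, hp⟩ := exists_isSliceCoord_self hι hemb p
    exact mem_iUnion.2 ⟨⟨⟨Ψ.source, minimalConnection J Ψ⟩, Ψ.open_source,
      isMinimalConnectionOn_minimalConnection hJ h.coordM,
      h.isTotallyGeodesicOn_minimalConnection hJ hPH⟩, h.mem_source hp⟩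
  refine ⟨_, c, isOpen_iUnion fun q : A => q.2.1, hrange, fun hcl => ?_, hc, hctg⟩
  refine eq_univ_of_forall fun x => ?_
  by_cases hx : x ∈ range ι
  · exact hrange hx
  let Ψ := (chartCoord 𝓘(ℝ, E) x).restrOpen (range ι)ᶜ hcl.isOpen_compl
  have hΨ : IsSmoothCoord 𝓘(ℝ, E) Ψ := (isSmoothCoord_chartCoord x).restrOpen _
  refine mem_iUnion.2 ⟨⟨⟨Ψ.source, minimalConnection J Ψ⟩, Ψ.open_source,
    isMinimalConnectionOn_minimalConnection hJ hΨ, ?_⟩, mem_chartCoord_source x, hx⟩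
  rintro z ⟨-, hz⟩
  exact absurd (mem_range_self z) hz

end Existence

/-! ### The almost complex structure of the normal bundle -/

section NormalBundleStructure

variable {E E' F : Type*} [NormedAddCommGroup E] [NormedSpace ℝ E] [FiniteDimensional ℝ E]
  [NormedAddCommGroup E'] [NormedSpace ℝ E'] [FiniteDimensional ℝ E']
  [NormedAddCommGroup F] [NormedSpace ℝ F] [FiniteDimensional ℝ F]
  {M : Type*} [TopologicalSpace M] [ChartedSpace E M] [IsManifold 𝓘(ℝ, E) ∞ M]
  {L : Type*} [TopologicalSpace L] [ChartedSpace E' L] [IsManifold 𝓘(ℝ, E') ∞ L]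
  {J : EndField 𝓘(ℝ, E) M} {ι : L → M}

/-- `Jhat` has the expected expression in all slice coordinates. -/
def HasSliceExpression (hι : IsImmersionOfComplement F 𝓘(ℝ, E') 𝓘(ℝ, E) ∞ ι)
    (J : EndField 𝓘(ℝ, E) M)
    (Jhat : EndField (𝓘(ℝ, E').prod 𝓘(ℝ, F)) (TotalSpace F (NormalFibre hι))) : Prop :=
  ∀ (p : L) (φ : OpenPartialHomeomorph L E') (Ψ : OpenPartialHomeomorph M (E' × F)),
    IsSliceCoord hι p φ Ψ → ∀ a : TotalSpace F (NormalFibre hι), a.proj ∈ φ.source → ∀ ξ,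
      coordDeriv (𝓘(ℝ, E').prod 𝓘(ℝ, F)) (normalCoord hι p φ) a (Jhat a ξ) =
        normalStructure (coordEnd 𝓘(ℝ, E) Ψ J) (normalCoord hι p φ a)
          (coordDeriv (𝓘(ℝ, E').prod 𝓘(ℝ, F)) (normalCoord hι p φ) a ξ)

theorem exists_hasSliceExpression [T2Space M] [SigmaCompactSpace M]
    (hJ : IsAlmostComplex J) (hι : IsImmersionOfComplement F 𝓘(ℝ, E') 𝓘(ℝ, E) ∞ ι)
    (hemb : IsEmbedding ι)
    (hPH : ∀ x : L, ∀ v ∈ tangentImage (E := E) (E' := E') ι x,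
      J (ι x) v ∈ tangentImage (E := E) (E' := E') ι x) :
    ∃ Jhat : EndField (𝓘(ℝ, E').prod 𝓘(ℝ, F)) (TotalSpace F (NormalFibre hι)),
      HasSliceExpression hι J Jhat := by
  obtain ⟨U, cov, hU, hsub, -, hmin, htg⟩ :=
    exists_isMinimalConnectionOn_isTotallyGeodesicOn hJ hι hemb hPH
  have key : ∀ a : TotalSpace F (NormalFibre hι),
      ∃ K : TangentSpace (𝓘(ℝ, E').prod 𝓘(ℝ, F)) a →L[ℝ] TangentSpace (𝓘(ℝ, E').prod 𝓘(ℝ, F)) a,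
        IsSplitStructureAt hι J cov a K := by
    intro a
    obtain ⟨φ, Ψ, h, hp⟩ := exists_isSliceCoord_self hι hemb a.proj
    refine ⟨(coordInv (𝓘(ℝ, E').prod 𝓘(ℝ, F)) (normalCoord hι a.proj φ) a).comp
      ((normalStructure (coordEnd 𝓘(ℝ, E) Ψ J) (normalCoord hι a.proj φ a)).comp
        (coordDeriv (𝓘(ℝ, E').prod 𝓘(ℝ, F)) (normalCoord hι a.proj φ) a)), ?_⟩
    rw [h.isSplitStructureAt_iff hJ hPH hU hmin htg hp (hsub ⟨_, rfl⟩)]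
    intro ξ
    exact h.isSmoothCoord_normalCoord.coordDeriv_coordInv (h.mem_normalCoord_source.2 hp) _
  choose Jhat hJhat using key
  exact ⟨Jhat, fun p φ Ψ h a ha =>
    (h.isSplitStructureAt_iff hJ hPH hU hmin htg ha (hsub ⟨_, rfl⟩) _).1 (hJhat a)⟩

namespace HasSliceExpression

variable {hι : IsImmersionOfComplement F 𝓘(ℝ, E') 𝓘(ℝ, E) ∞ ι}
  {Jhat : EndField (𝓘(ℝ, E').prod 𝓘(ℝ, F)) (TotalSpace F (NormalFibre hι))}

theorem coordEnd_eq (hh : HasSliceExpression hι J Jhat) {p : L} {φ : OpenPartialHomeomorph L E'}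
    {Ψ : OpenPartialHomeomorph M (E' × F)} (h : IsSliceCoord hι p φ Ψ) {z : E' × F}
    (hz : z.1 ∈ φ.target) :
    coordEnd (𝓘(ℝ, E').prod 𝓘(ℝ, F)) (normalCoord hι p φ) Jhat z =
      normalStructure (coordEnd 𝓘(ℝ, E) Ψ J) z := by
  have hz' := h.mem_normalCoord_target.2 hz
  have hs := (normalCoord hι p φ).map_target hz'
  have hN := h.isSmoothCoord_normalCoord
  refine ContinuousLinearMap.ext fun v => ?_
  have h1 := hh p φ Ψ h _ (h.mem_normalCoord_source.1 hs) (coordInv _ (normalCoord hι p φ) _ v)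
  rwa [hN.coordDeriv_coordInv hs, (normalCoord hι p φ).right_inv hz'] at h1

theorem isAlmostComplex (hh : HasSliceExpression hι J Jhat) (hJ : IsAlmostComplex J)
    (hemb : IsEmbedding ι)
    (hPH : ∀ x : L, ∀ v ∈ tangentImage (E := E) (E' := E') ι x,
      J (ι x) v ∈ tangentImage (E := E) (E' := E') ι x) : IsAlmostComplex Jhat where
  sq a ξ := by
    obtain ⟨φ, Ψ, h, hp⟩ := exists_isSliceCoord_self hι hemb a.proj
    have hN := h.isSmoothCoord_normalCoord
    have hy := φ.map_source hp
    have hpres := h.preservesSlice hPH hy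
    have hsq := hJ.coordEnd_sq h.coordM (h.map_mem_target hy)
    apply hN.coordDeriv_injective (h.mem_normalCoord_source.2 hp)
    rw [hh _ φ Ψ h a hp, hh _ φ Ψ h a hp, map_neg]
    exact splitMatrix_sq (hpres.tangentialPart_sq hsq) (hpres.normalPart_sq hsq)
      (normalTwist_antilinear (hpres.tangentialPart_sq hsq) (hpres.normalPart_sq hsq)) _
  smooth a := by
    obtain ⟨φ, Ψ, h, hp⟩ := exists_isSliceCoord_self hι hemb a.proj
    have hN := h.isSmoothCoord_normalCoord
    have hy := φ.map_source hp
    have hJc := hJ.contDiffAt_coordEnd h.coordM (h.map_mem_target hy)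
    refine (hN.contMDiffAt_end_iff (n := ⊤) (h.mem_normalCoord_source.2 hp)).2 ?_
    have hev : coordEnd (𝓘(ℝ, E').prod 𝓘(ℝ, F)) (normalCoord hι a.proj φ) Jhat
        =ᶠ[𝓝 (normalCoord hι a.proj φ a)] normalStructure (coordEnd 𝓘(ℝ, E) Ψ J) := by
      have ho : IsOpen (Prod.fst ⁻¹' φ.target : Set (E' × F)) :=
        φ.open_target.preimage continuous_fst
      filter_upwards [ho.mem_nhds (show (normalCoord hι a.proj φ a).1 ∈ φ.target from hy)] with z hz
        using hh.coordEnd_eq h hz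
    refine ContDiffAt.congr_of_eventuallyEq ?_ hev
    exact contDiffAt_splitMatrix (contDiffAt_tangentialPart hJc)
      (contDiffAt_normalTwist (contDiffAt_tangentialPart hJc) (contDiffAt_normalPart hJc)
        (contDiffAt_normalSymbol (contDiffAt_minimalSymbol hJc))) (contDiffAt_normalPart hJc)

theorem existsUnique_isHorizontalLift [T2Space M] (hemb : IsEmbedding ι) {U : Set M}
    (hU : IsOpen U) {cov : ConnectionOp 𝓘(ℝ, E) M} (hmin : IsMinimalConnectionOn J U cov)
    (htg : IsTotallyGeodesicOn (E' := E') ι U cov) {a : TotalSpace F (NormalFibre hι)}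
    (ha : ι a.proj ∈ U) (u : TangentSpace 𝓘(ℝ, E') a.proj) :
    ∃! ξ, IsHorizontalLift hι cov a u ξ := by
  obtain ⟨φ, Ψ, h, hp⟩ := exists_isSliceCoord_self hι hemb a.proj
  obtain ⟨Γ, hΓ, -⟩ := exists_symbol h.coordM hU hmin.isCovariantDerivativeOn hmin.smooth
  exact h.existsUnique_isHorizontalLift hΓ htg hp ha u

theorem isSplitStructureAt_iff [T2Space M] (hh : HasSliceExpression hι J Jhat)
    (hJ : IsAlmostComplex J) (hemb : IsEmbedding ι)
    (hPH : ∀ x : L, ∀ v ∈ tangentImage (E := E) (E' := E') ι x,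
      J (ι x) v ∈ tangentImage (E := E) (E' := E') ι x) {U : Set M}
    (hU : IsOpen U) {cov : ConnectionOp 𝓘(ℝ, E) M} (hmin : IsMinimalConnectionOn J U cov)
    (htg : IsTotallyGeodesicOn (E' := E') ι U cov) {a : TotalSpace F (NormalFibre hι)}
    (ha : ι a.proj ∈ U)
    (K : TangentSpace (𝓘(ℝ, E').prod 𝓘(ℝ, F)) a →L[ℝ] TangentSpace (𝓘(ℝ, E').prod 𝓘(ℝ, F)) a) :
    IsSplitStructureAt hι J cov a K ↔ K = Jhat a := by
  obtain ⟨φ, Ψ, h, hp⟩ := exists_isSliceCoord_self hι hemb a.proj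
  rw [h.isSplitStructureAt_iff hJ hPH hU hmin htg hp ha]
  constructor
  · intro hK
    ext1 ξ
    exact h.isSmoothCoord_normalCoord.coordDeriv_injective (h.mem_normalCoord_source.2 hp)
      ((hK ξ).trans (hh _ φ Ψ h a hp ξ).symm)
  · rintro rfl
    exact hh _ φ Ψ h a hp

theorem isPseudoholomorphic_proj (hh : HasSliceExpression hι J Jhat) (hemb : IsEmbedding ι)
    (hPH : ∀ x : L, ∀ v ∈ tangentImage (E := E) (E' := E') ι x,
      J (ι x) v ∈ tangentImage (E := E) (E' := E') ι x) :
    IsPseudoholomorphic Jhat (restrictedStructure J ι : EndField 𝓘(ℝ, E') L)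
      (TotalSpace.proj : TotalSpace F (NormalFibre hι) → L) := by
  refine ⟨contMDiff_proj _, fun a ξ => ?_⟩
  obtain ⟨φ, Ψ, h, hp⟩ := exists_isSliceCoord_self hι hemb a.proj
  apply h.coordL.coordDeriv_injective hp
  rw [h.coordDeriv_restrictedStructure hp hPH, h.coordDeriv_proj hp, h.coordDeriv_proj hp,
    hh _ φ Ψ h a hp]
  rfl

theorem isPseudoholomorphic_zeroSection (hh : HasSliceExpression hι J Jhat) (hemb : IsEmbedding ι)
    (hPH : ∀ x : L, ∀ v ∈ tangentImage (E := E) (E' := E') ι x,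
      J (ι x) v ∈ tangentImage (E := E) (E' := E') ι x) :
    IsPseudoholomorphic (restrictedStructure J ι : EndField 𝓘(ℝ, E') L) Jhat
      (zeroSection F (NormalFibre hι)) := by
  refine ⟨contMDiff_zeroSection ℝ _, fun x u => ?_⟩
  obtain ⟨φ, Ψ, h, hp⟩ := exists_isSliceCoord_self hι hemb x
  have hp' : zeroSection F (NormalFibre hι) x ∈ (normalCoord hι x φ).source :=
    h.mem_normalCoord_source.2 hp
  apply h.isSmoothCoord_normalCoord.coordDeriv_injective hp'
  rw [h.coordDeriv_zeroSection hp, hh _ φ Ψ h _ hp, h.coordDeriv_zeroSection hp,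
    h.coordDeriv_restrictedStructure hp hPH, normalStructure, splitMatrix_apply]
  have h0 : (normalCoord hι x φ (zeroSection F (NormalFibre hι) x)).2 = 0 := by
    change sliceCoord hι x x 0 = 0
    rw [← map_zero (normalMk hι x), h.sliceCoord_mk hp, map_zero]
    rfl
  rw [h0]
  ext
  · rfl
  · simp

end HasSliceExpression

end NormalBundleStructure

/-! ### Restrictions of a test function to parallel planes -/

section LineFamily

open BoundedContinuousFunction

variable {V : Type*} [NormedAddCommGroup V] [NormedSpace ℝ V] [FiniteDimensional ℝ V]
  {G : Type*} [NormedAddCommGroup G] [NormedSpace ℝ G]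

/-- The restriction of a continuous function with compact support to the plane through `y` in the
direction `m`, as a bounded continuous function of the parameter in `ℂ`. -/
def planeRestriction (m : ℂ →L[ℝ] V) (a : V → G) (ha : Continuous a) (hs : HasCompactSupport a)
    (y : V) : BoundedContinuousFunction ℂ G :=
  BoundedContinuousFunction.ofNormedAddCommGroup (fun ζ => a (y + m ζ)) (by fun_prop)
    (hs.exists_bound_of_continuous ha).choose
    (fun _ => (hs.exists_bound_of_continuous ha).choose_spec _)

variable {m : ℂ →L[ℝ] V} {a : V → G}

@[simp] theorem planeRestriction_apply (ha : Continuous a) (hs : HasCompactSupport a) (y : V)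
    (ζ : ℂ) : planeRestriction m a ha hs y ζ = a (y + m ζ) := rfl

/-- Restriction to planes is differentiable for the supremum norm: the derivative of `a` has compact
support, so it is uniformly continuous and the remainder is small uniformly in `ζ`. -/
theorem hasFDerivAt_planeRestriction (ha : ContDiff ℝ 1 a) (hs : HasCompactSupport a) (y : V) :
    ∃ D : V →L[ℝ] BoundedContinuousFunction ℂ G,
      HasFDerivAt (planeRestriction m a ha.continuous hs) D y ∧
        ∀ v ζ, D v ζ = fderiv ℝ a (y + m ζ) v := by
  have hDc : Continuous (fderiv ℝ a) := ha.continuous_fderiv (by simp)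
  have hDv : ∀ v, Continuous fun x => fderiv ℝ a x v := fun v => hDc.clm_apply continuous_const
  let D : V →L[ℝ] BoundedContinuousFunction ℂ G := LinearMap.toContinuousLinearMap
    { toFun := fun v => planeRestriction m (fun x => fderiv ℝ a x v) (hDv v) (hs.fderiv_apply ℝ v) y
      map_add' := fun v w => by ext ζ; simp
      map_smul' := fun c v => by ext ζ; simp }
  refine ⟨D, ?_, fun v ζ => rfl⟩
  rw [hasFDerivAt_iff_isLittleO_nhds_zero, Asymptotics.isLittleO_iff]
  intro ε hε
  obtain ⟨δ, hδ, hunif⟩ := Metric.uniformContinuous_iff.1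
    ((hs.fderiv ℝ).uniformContinuous_of_continuous hDc) ε hε
  filter_upwards [Metric.ball_mem_nhds (0 : V) hδ] with v hv
  rw [mem_ball_zero_iff] at hv
  refine (BoundedContinuousFunction.norm_le (by positivity)).2 fun ζ => ?_
  change ‖a (y + v + m ζ) - a (y + m ζ) - fderiv ℝ a (y + m ζ) v‖ ≤ ε * ‖v‖
  have h1 := (convex_ball (y + m ζ) δ).norm_image_sub_le_of_norm_fderiv_le' (𝕜 := ℝ) (f := a)
    (C := ε) (φ := fderiv ℝ a (y + m ζ)) (x := y + m ζ) (y := y + v + m ζ)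
    (fun x _ => (ha.differentiable (by simp)) x)
    (fun x hx => by rw [← dist_eq_norm]; exact (hunif hx).le) (Metric.mem_ball_self hδ)
    (by rwa [Metric.mem_ball, dist_eq_norm, show y + v + m ζ - (y + m ζ) = v by abel])
  have h2 : y + v + m ζ - (y + m ζ) = v := by abel
  rwa [h2] at h1

theorem fderiv_planeRestriction_apply (ha : ContDiff ℝ 1 a) (hs : HasCompactSupport a)
    (y v : V) (ζ : ℂ) :
    fderiv ℝ (planeRestriction m a ha.continuous hs) y v ζ = fderiv ℝ a (y + m ζ) v := by
  obtain ⟨D, hD, hDa⟩ := hasFDerivAt_planeRestriction (m := m) ha hs y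
  rw [hD.fderiv, hDa]

theorem contDiff_planeRestriction (n : ℕ) : ∀ (a : V → G) (ha : ContDiff ℝ ∞ a)
    (hs : HasCompactSupport a), ContDiff ℝ n (planeRestriction m a ha.continuous hs) := by
  induction n with
  | zero =>
    intro a ha hs
    refine contDiff_zero.2 (continuous_iff_continuousAt.2 fun y => ?_)
    obtain ⟨D, hD, -⟩ := hasFDerivAt_planeRestriction (m := m) (ha.of_le (by simp)) hs y
    exact hD.continuousAt
  | succ n ih =>
    intro a ha hs
    push_cast
    refine contDiff_succ_iff_fderiv_apply.2 ⟨fun y => ?_, by simp, fun v => ?_⟩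
    · obtain ⟨D, hD, -⟩ := hasFDerivAt_planeRestriction (m := m) (ha.of_le (by simp)) hs y
      exact hD.differentiableAt
    · have hv : ContDiff ℝ ∞ fun x => fderiv ℝ a x v :=
        (ha.fderiv_right (m := ∞) (by simp)).clm_apply contDiff_const
      have heq : (fun y => fderiv ℝ (planeRestriction m a ha.continuous hs) y v) =
          planeRestriction m (fun x => fderiv ℝ a x v) hv.continuous (hs.fderiv_apply ℝ v) := by
        ext y ζ
        exact fderiv_planeRestriction_apply (ha.of_le (by simp)) hs y v ζ
      rw [heq]
      exact ih _ hv _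

end LineFamily

/-! ### The Cauchy kernel -/

section CauchyKernel

open MeasureTheory BoundedContinuousFunction
open scoped Convolution Real

variable {A : Type*} [NormedRing A] [NormedAlgebra ℝ A]

/-- The Cauchy kernel `1 / (π ζ)`, truncated to the unit disc, where the imaginary unit acts on `A`
as multiplication by `I`. -/
def cauchyKernel (I : A) : ℂ → A :=
  (Metric.ball (0 : ℂ) 1).indicator fun ζ => (π * ‖ζ‖ ^ 2)⁻¹ • (ζ.re • (1 : A) - ζ.im • I)

theorem integrable_cauchyKernel (I : A) : Integrable (cauchyKernel I) := by
  have hb : Integrable (fun ζ : ℂ => (Iio (1 : ℝ)).indicator (fun r : ℝ => r⁻¹) ‖ζ‖) := by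
    refine (integrable_fun_norm_addHaar (volume : Measure ℂ)
      (f := (Iio (1 : ℝ)).indicator (fun r : ℝ => r⁻¹))).2 ?_
    have h1 : IntegrableOn ((Iio (1 : ℝ)).indicator fun _ => (1 : ℝ)) (Ioi 0) := by
      rw [IntegrableOn, integrable_indicator_iff measurableSet_Iio, IntegrableOn,
        Measure.restrict_restrict measurableSet_Iio]
      refine integrableOn_const ?_
      rw [inter_comm, Ioi_inter_Iio]
      simp
    refine h1.congr_fun (fun r hr => ?_) measurableSet_Ioi
    have hr : r ≠ 0 := ne_of_gt hr
    by_cases h : r < 1 <;> simp [h, hr]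
  refine (hb.mul_const (π⁻¹ * (‖(1 : A)‖ + ‖I‖))).mono' ?_ ?_
  · refine AEStronglyMeasurable.indicator ?_ measurableSet_ball
    refine AEStronglyMeasurable.smul ?_ ?_
    · exact (by fun_prop : Measurable fun ζ : ℂ => (π * ‖ζ‖ ^ 2)⁻¹).aestronglyMeasurable
    · exact (by fun_prop : Continuous fun ζ : ℂ => ζ.re • (1 : A) - ζ.im • I).aestronglyMeasurable
  · refine Filter.Eventually.of_forall fun ζ => ?_
    rw [cauchyKernel]
    by_cases h : ζ ∈ Metric.ball (0 : ℂ) 1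
    · have h' : ‖ζ‖ ∈ Iio (1 : ℝ) := by simpa using h
      rw [indicator_of_mem h, indicator_of_mem h', norm_smul, norm_inv, norm_mul, norm_pow,
        norm_norm, Real.norm_of_nonneg Real.pi_pos.le]
      have h2 : ‖ζ.re • (1 : A) - ζ.im • I‖ ≤ ‖ζ‖ * (‖(1 : A)‖ + ‖I‖) := by
        refine (norm_sub_le _ _).trans ?_
        rw [norm_smul, norm_smul, mul_add]
        gcongr
        · exact ζ.abs_re_le_norm
        · exact ζ.abs_im_le_norm
      rcases eq_or_ne ζ 0 with rfl | h0
      · simp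
      have h0' : 0 < ‖ζ‖ := norm_pos_iff.2 h0
      calc (π * ‖ζ‖ ^ 2)⁻¹ * ‖ζ.re • (1 : A) - ζ.im • I‖
          ≤ (π * ‖ζ‖ ^ 2)⁻¹ * (‖ζ‖ * (‖(1 : A)‖ + ‖I‖)) := by gcongr
        _ = ‖ζ‖⁻¹ * (π⁻¹ * (‖(1 : A)‖ + ‖I‖)) := by field_simp
    · have h' : ‖ζ‖ ∉ Iio (1 : ℝ) := by simpa using h
      rw [indicator_of_notMem h, indicator_of_notMem h']
      simp

theorem continuous_cauchyKernel_convolution (I : A) (f : BoundedContinuousFunction ℂ A) :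
    Continuous (cauchyKernel I ⋆[ContinuousLinearMap.mul ℝ A] f) :=
  BddAbove.continuous_convolution_right_of_integrable _
    ⟨‖f‖, by rintro _ ⟨x, rfl⟩; exact f.norm_coe_le_norm x⟩ (integrable_cauchyKernel I) f.continuous

theorem norm_cauchyKernel_convolution_le (I : A) (f : BoundedContinuousFunction ℂ A) (ζ : ℂ) :
    ‖(cauchyKernel I ⋆[ContinuousLinearMap.mul ℝ A] f) ζ‖ ≤ (∫ η, ‖cauchyKernel I η‖) * ‖f‖ := by
  rw [convolution_def, ← integral_mul_const]
  refine norm_integral_le_of_norm_le ((integrable_cauchyKernel I).norm.mul_const _) ?_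
  refine Filter.Eventually.of_forall fun η => ?_
  rw [ContinuousLinearMap.mul_apply']
  exact (norm_mul_le _ _).trans (by gcongr; exact f.norm_coe_le_norm _)

theorem integrable_cauchyKernel_mul (I : A) (f : BoundedContinuousFunction ℂ A) (ζ : ℂ) :
    Integrable fun η => cauchyKernel I η * f (ζ - η) :=
  (integrable_cauchyKernel I).mul_bdd (c := ‖f‖)
    (f.continuous.comp (by fun_prop)).aestronglyMeasurable
    (Filter.Eventually.of_forall fun η => f.norm_coe_le_norm _)

/-- Convolution with the truncated Cauchy kernel. -/
def cauchyOp (I : A) : BoundedContinuousFunction ℂ A →L[ℝ] BoundedContinuousFunction ℂ A :=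
  LinearMap.mkContinuous
    { toFun := fun f => BoundedContinuousFunction.ofNormedAddCommGroup
        (cauchyKernel I ⋆[ContinuousLinearMap.mul ℝ A] f)
        (continuous_cauchyKernel_convolution I f) _ (norm_cauchyKernel_convolution_le I f)
      map_add' := fun f g => by
        ext ζ
        have h1 := integrable_cauchyKernel_mul I f ζ
        have h2 := integrable_cauchyKernel_mul I g ζ
        simp only [coe_ofNormedAddCommGroup, convolution_def, ContinuousLinearMap.mul_apply',
          BoundedContinuousFunction.add_apply, mul_add]
        exact integral_add h1 h2
      map_smul' := fun c f => by
        ext ζ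
        simp only [coe_ofNormedAddCommGroup, convolution_def, ContinuousLinearMap.mul_apply',
          BoundedContinuousFunction.smul_apply, mul_smul_comm, RingHom.id_apply]
        exact integral_smul c _ }
    (∫ η, ‖cauchyKernel I η‖) (fun f => by
      refine (BoundedContinuousFunction.norm_le (by positivity)).2 fun ζ => ?_
      exact norm_cauchyKernel_convolution_le I f ζ)

theorem cauchyOp_apply (I : A) (f : BoundedContinuousFunction ℂ A) (ζ : ℂ) :
    cauchyOp I f ζ = ∫ η, cauchyKernel I η * f (ζ - η) := rfl

theorem commute_cauchyKernel {I : A} (hI : ∀ x, Commute I x) (ζ : ℂ) (x : A) :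
    I * (cauchyKernel I ζ * x) = cauchyKernel I ζ * (I * x) := by
  rw [← mul_assoc, (hI _).eq, mul_assoc]

theorem cauchyOp_const_mul [CompleteSpace A] {I : A} (hI : ∀ x, Commute I x)
    (f : BoundedContinuousFunction ℂ A) :
    cauchyOp I (BoundedContinuousFunction.const ℂ I * f) =
      BoundedContinuousFunction.const ℂ I * cauchyOp I f := by
  ext ζ
  simp only [cauchyOp_apply, BoundedContinuousFunction.mul_apply, const_apply,
    ← commute_cauchyKernel hI]
  exact ((ContinuousLinearMap.mul ℝ A I).integral_comp_comm (integrable_cauchyKernel_mul I f ζ))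

/-- The Cauchy–Pompeiu formula for a function supported in the unit disc, at the centre. In polar
coordinates the integrand is a radial derivative, which integrates to `-f 0`, plus an angular
derivative, which integrates to zero. -/
theorem integral_cauchyKernel_dbar [CompleteSpace A] {I : A} (hI2 : I * I = -1) {f : ℂ → A}
    (hf : ContDiff ℝ 1 f) (h0 : ∀ ζ, 1 ≤ ‖ζ‖ → f ζ = 0) :
    ∫ η, cauchyKernel I η * ((1 / 2 : ℝ) • (fderiv ℝ f η 1 + I * fderiv ℝ f η Complex.I)) =
      -f 0 := by
  have hDc : Continuous (fderiv ℝ f) := hf.continuous_fderiv (by simp)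
  have hfd : ∀ x, HasFDerivAt f (fderiv ℝ f x) x := fun x =>
    (hf.differentiable (by simp) x).hasFDerivAt
  have hP : Continuous fun p : ℝ × ℝ => circleMap 0 p.1 p.2 := by
    simp only [circleMap]; fun_prop
  have hE : Continuous fun p : ℝ × ℝ => circleMap 0 1 p.2 := by
    simp only [circleMap]; fun_prop
  let H₁ : ℝ × ℝ → A := fun p => fderiv ℝ f (circleMap 0 p.1 p.2) (circleMap 0 1 p.2)
  let H₂ : ℝ × ℝ → A := fun p => fderiv ℝ f (circleMap 0 p.1 p.2) (circleMap 0 1 p.2 * Complex.I)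
  have hH₁ : Continuous H₁ := (hDc.comp hP).clm_apply hE
  have hH₂ : Continuous H₂ := (hDc.comp hP).clm_apply (hE.mul continuous_const)
  have hint : ∀ {H : ℝ × ℝ → A}, Continuous H → IntegrableOn H (Ioo 0 1 ×ˢ Ioo (-π) π) := by
    intro H hH
    exact (hH.continuousOn.integrableOn_compact (isCompact_Icc.prod isCompact_Icc)).mono_set
      (prod_mono Ioo_subset_Icc_self Ioo_subset_Icc_self)
  -- the integrand in polar coordinates
  have hpolar : ∀ p ∈ polarCoord.target, p.1 • (cauchyKernel I (Complex.polarCoord.symm p) *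
      ((1 / 2 : ℝ) • (fderiv ℝ f (Complex.polarCoord.symm p) 1 +
        I * fderiv ℝ f (Complex.polarCoord.symm p) Complex.I))) =
      (Ioo (0 : ℝ) 1 ×ˢ Ioo (-π) π).indicator
        (fun p => (2 * π)⁻¹ • (H₁ p + I * H₂ p)) p := by
    rintro ⟨r, θ⟩ ⟨hr, hθ⟩
    have hr : 0 < r := hr
    have hPe : Complex.polarCoord.symm (r, θ) = circleMap 0 r θ := by
      rw [Complex.polarCoord_symm_apply, circleMap_zero, Complex.exp_mul_I]
      simp
    rw [hPe]
    have hn : ‖circleMap 0 r θ‖ = r := by simp [abs_of_pos hr]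
    by_cases h1 : r < 1
    · rw [indicator_of_mem (show (r, θ) ∈ Ioo (0 : ℝ) 1 ×ˢ Ioo (-π) π from ⟨⟨hr, h1⟩, hθ⟩),
        cauchyKernel, indicator_of_mem (by simpa [abs_of_pos hr] using h1), hn]
      have hre : (circleMap 0 r θ).re = r * Real.cos θ := by
        simp [circleMap_zero, Complex.exp_mul_I, ← Complex.ofReal_cos, ← Complex.ofReal_sin]
      have him : (circleMap 0 r θ).im = r * Real.sin θ := by
        simp [circleMap_zero, Complex.exp_mul_I, ← Complex.ofReal_cos, ← Complex.ofReal_sin]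
      have he : circleMap 0 1 θ = Real.cos θ • (1 : ℂ) + Real.sin θ • Complex.I := by
        simp [circleMap_zero, Complex.exp_mul_I]
      have hie : circleMap 0 1 θ * Complex.I = -Real.sin θ • (1 : ℂ) + Real.cos θ • Complex.I := by
        rw [he]
        apply Complex.ext <;> simp
      simp only [H₁, H₂]
      rw [hie, he, hre, him, map_add, map_add, map_smul, map_smul, map_smul, map_smul]
      generalize fderiv ℝ f (circleMap 0 r θ) 1 = a
      generalize fderiv ℝ f (circleMap 0 r θ) Complex.I = b
      have e1 : I * (I * b) = -b := by rw [← mul_assoc, hI2, neg_one_mul]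
      have e2 : r • ((π * r ^ 2)⁻¹ • ((r * Real.cos θ) • (1 : A) - (r * Real.sin θ) • I) *
          ((1 / 2 : ℝ) • (a + I * b))) =
          (r * (π * r ^ 2)⁻¹ * r * (1 / 2)) •
            ((Real.cos θ • (1 : A) - Real.sin θ • I) * (a + I * b)) := by
        simp only [smul_mul_assoc, mul_smul_comm, smul_smul, sub_mul, smul_sub]
        congr 2 <;> ring
      rw [e2, show r * (π * r ^ 2)⁻¹ * r * (1 / 2) = (2 * π)⁻¹ by field_simp]
      congr 1
      simp only [sub_mul, mul_add, smul_mul_assoc, one_mul, mul_smul_comm, e1, smul_neg,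
        neg_smul, mul_neg]
      abel
    · rw [indicator_of_notMem (by simp [h1]), cauchyKernel,
        indicator_of_notMem (by simpa [abs_of_pos hr] using h1), zero_mul, smul_zero]
  rw [← Complex.integral_comp_polarCoord_symm,
    setIntegral_congr_fun polarCoord.open_target.measurableSet hpolar,
    setIntegral_indicator (measurableSet_Ioo.prod measurableSet_Ioo)]
  have hset : polarCoord.target ∩ Ioo (0 : ℝ) 1 ×ˢ Ioo (-π) π = Ioo (0 : ℝ) 1 ×ˢ Ioo (-π) π := by
    refine inter_eq_right.2 ?_
    rintro ⟨r, θ⟩ ⟨hr, hθ⟩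
    exact ⟨hr.1, hθ⟩
  rw [hset, integral_smul, integral_add (hint hH₁) ((hint hH₂).const_mul I)]
  -- the radial derivative
  have h1 : ∫ p in Ioo (0 : ℝ) 1 ×ˢ Ioo (-π) π, H₁ p = -((2 * π) • f 0) := by
    have hswap : ∫ p in Ioo (0 : ℝ) 1 ×ˢ Ioo (-π) π, H₁ p =
        ∫ θ in Ioo (-π) π, ∫ r in Ioo (0 : ℝ) 1, H₁ (r, θ) := by
      rw [Measure.volume_eq_prod, ← setIntegral_prod_swap]
      refine setIntegral_prod _ ?_
      have := (hH₁.comp continuous_swap).continuousOn.integrableOn_compact (μ := volume)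
        ((isCompact_Icc (a := -π) (b := π)).prod (isCompact_Icc (a := (0 : ℝ)) (b := 1)))
      exact this.mono_set (prod_mono Ioo_subset_Icc_self Ioo_subset_Icc_self)
    rw [hswap]
    have hin : ∀ θ : ℝ, ∫ r in Ioo (0 : ℝ) 1, H₁ (r, θ) = -f 0 := by
      intro θ
      rw [← integral_Ioc_eq_integral_Ioo, ← intervalIntegral.integral_of_le zero_le_one]
      have hd : ∀ r : ℝ, HasDerivAt (fun r : ℝ => f (circleMap 0 r θ)) (H₁ (r, θ)) r := by
        intro r
        have hc : HasDerivAt (fun r : ℝ => circleMap 0 r θ) (circleMap 0 1 θ) r := by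
          simp only [circleMap, zero_add, Complex.ofReal_one]
          exact (Complex.ofRealCLM.hasDerivAt (x := r)).mul_const _
        exact (hfd _).comp_hasDerivAt r hc
      rw [intervalIntegral.integral_eq_sub_of_hasDerivAt (fun r _ => hd r)
        ((hH₁.comp (by fun_prop : Continuous fun r : ℝ => (r, θ))).intervalIntegrable _ _),
        h0 _ (by simp), circleMap_zero_radius]
      simp
    simp only [hin]
    rw [setIntegral_const]
    simp [Real.pi_pos.le, two_mul]
  -- the angular derivative
  have h2 : ∫ p in Ioo (0 : ℝ) 1 ×ˢ Ioo (-π) π, I * H₂ p = 0 := by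
    rw [Measure.volume_eq_prod, setIntegral_prod _ ((hint hH₂).const_mul I)]
    refine setIntegral_eq_zero_of_forall_eq_zero fun r hr => ?_
    have hin : ∫ θ in Ioo (-π) π, r • H₂ (r, θ) = 0 := by
      rw [← integral_Ioc_eq_integral_Ioo, ← intervalIntegral.integral_of_le
        (by linarith [Real.pi_pos])]
      have hd : ∀ θ : ℝ, HasDerivAt (fun θ : ℝ => f (circleMap 0 r θ)) (r • H₂ (r, θ)) θ := by
        intro θ
        have h3 := (hfd _).comp_hasDerivAt θ (hasDerivAt_circleMap 0 r θ)
        have h4 : circleMap 0 r θ * Complex.I = r • (circleMap 0 1 θ * Complex.I) := by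
          simp [circleMap_zero]
          ring
        rw [h4, map_smul] at h3
        exact h3
      rw [intervalIntegral.integral_eq_sub_of_hasDerivAt (fun θ _ => hd θ)
        (((hH₂.comp (by fun_prop : Continuous fun θ : ℝ => (r, θ))).const_smul r).intervalIntegrable
          _ _)]
      have : circleMap 0 r (-π) = circleMap 0 r π := by
        have := periodic_circleMap 0 r (-π)
        rw [← this]; congr 1; ring
      rw [this, sub_self]
    rw [integral_smul] at hin
    have h3 := (smul_eq_zero.1 hin).resolve_left hr.1.ne'
    have h4 : IntegrableOn (fun θ => H₂ (r, θ)) (Ioo (-π) π) :=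
      ((hH₂.comp (by fun_prop : Continuous fun θ : ℝ => (r, θ))).continuousOn.integrableOn_compact
        isCompact_Icc).mono_set Ioo_subset_Icc_self
    exact ((ContinuousLinearMap.mul ℝ A I).integral_comp_comm h4).trans (by rw [h3, map_zero])
  rw [h1, h2, add_zero, smul_neg, smul_smul, inv_mul_cancel₀ (by positivity), one_smul]

/-- Convolution with the truncated Cauchy kernel solves the inhomogeneous Cauchy–Riemann equation at
the centre of the unit disc. -/
theorem dbar_cauchyOp [CompleteSpace A] {I : A} (hI2 : I * I = -1) (hI : ∀ x, Commute I x)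
    (f : BoundedContinuousFunction ℂ A) (hf : ContDiff ℝ 1 f) (h0 : ∀ ζ, 1 ≤ ‖ζ‖ → f ζ = 0) :
    ∃ D : ℂ →L[ℝ] A, HasFDerivAt (cauchyOp I f) D 0 ∧
      (1 / 2 : ℝ) • (D 1 + I * D Complex.I) = f 0 := by
  have hs : HasCompactSupport f := by
    refine HasCompactSupport.of_support_subset_isCompact (isCompact_closedBall (0 : ℂ) 1) ?_
    intro ζ hζ
    by_contra h
    exact hζ (h0 ζ (by simpa using (not_le.1 (by simpa using h)).le))
  have hloc := (integrable_cauchyKernel I).locallyIntegrable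
  have hDc : Continuous (fderiv ℝ f) := hf.continuous_fderiv (by simp)
  have hD := hs.hasFDerivAt_convolution_right (ContinuousLinearMap.mul ℝ A) hloc hf (0 : ℂ)
  refine ⟨_, hD, ?_⟩
  rw [convolution_precompR_apply _ hloc (hs.fderiv ℝ) hDc,
    convolution_precompR_apply _ hloc (hs.fderiv ℝ) hDc, convolution_def, convolution_def]
  simp only [ContinuousLinearMap.mul_apply', zero_sub]
  -- the convolution evaluates `f` at `-η`, so the Cauchy–Pompeiu formula is applied to the reflection
  let g : ℂ → A := fun ζ => f (-ζ)
  have hg : ContDiff ℝ 1 g := hf.comp contDiff_neg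
  have hDg : ∀ ζ v, fderiv ℝ g ζ v = -fderiv ℝ f (-ζ) v := by
    intro ζ v
    have h1 : HasFDerivAt g ((fderiv ℝ f (-ζ)).comp (-ContinuousLinearMap.id ℝ ℂ)) ζ :=
      ((hf.differentiable (by simp)) (-ζ)).hasFDerivAt.comp ζ (hasFDerivAt_id ζ).neg
    rw [h1.fderiv]
    simp
  have key := integral_cauchyKernel_dbar hI2 hg (fun ζ hζ => h0 _ (by simpa using hζ))
  have hi : ∀ v : ℂ, Integrable fun η => cauchyKernel I η * fderiv ℝ f (-η) v := by
    intro v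
    obtain ⟨C, hC⟩ := (hs.fderiv ℝ).exists_bound_of_continuous hDc
    refine (integrable_cauchyKernel I).mul_bdd (c := C * ‖v‖)
      ((hDc.comp continuous_neg).clm_apply continuous_const).aestronglyMeasurable
      (Filter.Eventually.of_forall fun η => ?_)
    exact ((fderiv ℝ f (-η)).le_opNorm v).trans (by gcongr; exact hC _)
  have hI' : I * ∫ η, cauchyKernel I η * fderiv ℝ f (-η) Complex.I =
      ∫ η, cauchyKernel I η * (I * fderiv ℝ f (-η) Complex.I) := by
    simp only [← commute_cauchyKernel hI]
    exact ((ContinuousLinearMap.mul ℝ A I).integral_comp_comm (hi _)).symm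
  have hi' : Integrable fun η => cauchyKernel I η * (I * fderiv ℝ f (-η) Complex.I) := by
    simp only [← commute_cauchyKernel hI]
    exact (hi _).const_mul I
  rw [hI', ← integral_add (hi 1) hi', ← integral_smul]
  rw [show g 0 = f 0 by simp [g]] at key
  rw [← neg_eq_iff_eq_neg.2 key, ← integral_neg]
  refine integral_congr_ae (Filter.Eventually.of_forall fun η => ?_)
  simp only [hDg]
  rw [mul_neg, ← neg_add, smul_neg, mul_neg, neg_neg, mul_smul_comm, mul_add]

end CauchyKernel

/-! ### The Cauchy–Riemann operator of functions with values in an algebra -/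

section Dbar

variable {V : Type*} [NormedAddCommGroup V] [NormedSpace ℝ V]
  {A : Type*} [NormedRing A] [NormedAlgebra ℝ A]

/-- The antiholomorphic derivative `½ (D_v f + I D_{j v} f)`, for a complex structure `j` on the
source and a central square root `I` of `-1` in the target. -/
def dbar (j : V →L[ℝ] V) (I : A) (f : V → A) (y v : V) : A :=
  (1 / 2 : ℝ) • (fderiv ℝ f y v + I * fderiv ℝ f y (j v))

variable {j : V →L[ℝ] V} {I : A} {f g : V → A} {y : V}

theorem dbar_smul_dir (c : ℝ) (v : V) : dbar j I f y (c • v) = c • dbar j I f y v := by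
  simp only [dbar, map_smul, mul_smul_comm, ← smul_add]
  rw [smul_comm]

theorem dbar_j (hj : ∀ v, j (j v) = -v) (hI2 : I * I = -1) (v : V) :
    dbar j I f y (j v) = -(I * dbar j I f y v) := by
  simp only [dbar, hj, map_neg, mul_smul_comm, mul_add, ← mul_assoc, hI2, ← smul_neg]
  congr 1
  simp

theorem dbar_congr (h : f =ᶠ[𝓝 y] g) (v : V) : dbar j I f y v = dbar j I g y v := by
  rw [dbar, dbar, h.fderiv_eq]

theorem dbar_mul (hI : ∀ x, Commute I x) (hf : DifferentiableAt ℝ f y)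
    (hg : DifferentiableAt ℝ g y) (v : V) :
    dbar j I (fun y => f y * g y) y v = dbar j I f y v * g y + f y * dbar j I g y v := by
  have h1 := (hf.hasFDerivAt.mul' hg.hasFDerivAt).fderiv
  change fderiv ℝ (fun y => f y * g y) y = _ at h1
  simp only [dbar, h1, add_apply, smul_apply, smul_eq_mul, MulOpposite.smul_eq_mul_unop,
    MulOpposite.unop_op, smul_mul_assoc, mul_smul_comm, ← smul_add, add_mul, mul_add]
  congr 1
  rw [← mul_assoc I, (hI (f y)).eq, mul_assoc, mul_assoc]
  abel

theorem dbar_sub (hf : DifferentiableAt ℝ f y) (hg : DifferentiableAt ℝ g y) (v : V) :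
    dbar j I (fun y => f y - g y) y v = dbar j I f y v - dbar j I g y v := by
  simp only [dbar, fderiv_fun_sub hf hg, sub_apply, mul_sub, ← smul_sub]
  congr 1; abel

theorem fderiv_dbar (hf : ContDiffAt ℝ ∞ f y) (u v : V) :
    fderiv ℝ (fun y => dbar j I f y v) y u = (1 / 2 : ℝ) •
      (fderiv ℝ (fderiv ℝ f) y u v + I * fderiv ℝ (fderiv ℝ f) y u (j v)) := by
  have hd : HasFDerivAt (fderiv ℝ f) (fderiv ℝ (fderiv ℝ f) y) y :=
    ((hf.fderiv_right (m := ∞) (by simp)).differentiableAt (by simp)).hasFDerivAt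
  have happ : ∀ w : V, HasFDerivAt (fun y => fderiv ℝ f y w)
      ((ContinuousLinearMap.apply ℝ A w).comp (fderiv ℝ (fderiv ℝ f) y)) y :=
    fun w => (ContinuousLinearMap.apply ℝ A w).hasFDerivAt.comp y hd
  have hm : HasFDerivAt (fun y => I * fderiv ℝ f y (j v))
      ((ContinuousLinearMap.mul ℝ A I).comp
        ((ContinuousLinearMap.apply ℝ A (j v)).comp (fderiv ℝ (fderiv ℝ f) y))) y :=
    (ContinuousLinearMap.mul ℝ A I).hasFDerivAt.comp y (happ (j v))
  have := (((happ v).add hm).const_smul (1 / 2 : ℝ)).fderiv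
  change fderiv ℝ (fun y => dbar j I f y v) y = _ at this
  rw [this]
  simp

theorem dbar_comm (hf : ContDiffAt ℝ ∞ f y) (u v : V) :
    dbar j I (fun y => dbar j I f y v) y u = dbar j I (fun y => dbar j I f y u) y v := by
  have hs : ∀ a b, fderiv ℝ (fderiv ℝ f) y a b = fderiv ℝ (fderiv ℝ f) y b a :=
    (hf.isSymmSndFDerivAt (by simpa using ENat.LEInfty.out)).eq
  change (1 / 2 : ℝ) • (fderiv ℝ (fun y => dbar j I f y v) y u +
      I * fderiv ℝ (fun y => dbar j I f y v) y (j u)) =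
    (1 / 2 : ℝ) • (fderiv ℝ (fun y => dbar j I f y u) y v +
      I * fderiv ℝ (fun y => dbar j I f y u) y (j v))
  simp only [fderiv_dbar hf, mul_smul_comm, ← smul_add, mul_add]
  rw [hs u v, hs (j u) v, hs u (j v), hs (j u) (j v)]
  congr 2
  abel

theorem contDiffAt_dbar (hf : ContDiffAt ℝ ∞ f y) (v : V) :
    ContDiffAt ℝ ∞ (fun y => dbar j I f y v) y := by
  have h1 : ContDiffAt ℝ ∞ (fderiv ℝ f) y := hf.fderiv_right (by simp)
  have h2 : ContDiffAt ℝ ∞ (fun y => I * fderiv ℝ f y (j v)) y :=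
    contDiffAt_const.mul (h1.clm_apply contDiffAt_const)
  exact ((h1.clm_apply contDiffAt_const).add h2).const_smul (1 / 2 : ℝ)

end Dbar

/-! ### The inhomogeneous Cauchy–Riemann equation in one complex direction -/

section OneDirection

open BoundedContinuousFunction

variable {V : Type*} [NormedAddCommGroup V] [NormedSpace ℝ V] [FiniteDimensional ℝ V]
  {A : Type*} [NormedRing A] [NormedAlgebra ℝ A] [CompleteSpace A]
  {j : V →L[ℝ] V} {I : A}

theorem half_smul_mul_eq {R : Type*} [Ring R] [Algebra ℝ R] {a₁ a₂ b b₁ b₂ c g : R}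
    (hc : c * g = g * c) (hb : (1 / 2 : ℝ) • (b₁ + c * b₂) = 0) :
    ((1 / 2 : ℝ) • (a₁ + c * a₂)) * b =
      (1 / 2 : ℝ) • ((a₁ * b + g * b₁) + c * (a₂ * b + g * b₂)) := by
  have h1 : b₁ + c * b₂ = 0 := (smul_eq_zero.1 hb).resolve_left (by norm_num)
  rw [smul_mul_assoc]
  congr 1
  rw [mul_add c, ← mul_assoc c g, hc, eq_neg_of_add_eq_zero_left h1]
  noncomm_ring

/-- The complex line through the origin spanned by `u`. -/
def complexLine (j : V →L[ℝ] V) (u : V) : ℂ →L[ℝ] V :=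
  Complex.reCLM.smulRight u + Complex.imCLM.smulRight (j u)

theorem complexLine_apply (u : V) (ζ : ℂ) : complexLine j u ζ = ζ.re • u + ζ.im • j u := rfl

/-- Solution of `∂̄_u h = h a` for a small function `a` with compact support. On each complex line
in the direction `u` it is the fixed point of `g ↦ 1 + T (g a)`, where `T` is the convolution with
the Cauchy kernel; uniqueness of this fixed point shows that `h` is holomorphic in all other
directions in which `a` is. -/
theorem exists_dbar_eq_mul_of_small (hI2 : I * I = -1) (hI : ∀ x, Commute I x)
    (u : V) {a : V → A} (ha : ContDiff ℝ ∞ a) (hs : HasCompactSupport a) {C : ℝ}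
    (hC : ∀ y, ‖a y‖ ≤ C) (hsmall : ‖cauchyOp I‖ * C * (‖(1 : A)‖ + 1) < 1) :
    ∃ h : V → A, ContDiff ℝ ∞ h ∧ (∀ y, ‖h y - 1‖ < 1) ∧
      (∀ y, (∀ ζ : ℂ, 1 ≤ ‖ζ‖ → a (y + complexLine j u ζ) = 0) → dbar j I h y u = h y * a y) ∧
      ∀ y s, (∀ ζ : ℂ, dbar j I a (y + complexLine j u ζ) s = 0) → dbar j I h y s = 0 := by
  set m := complexLine j u with hm
  set T := cauchyOp I with hT
  let B : V → BoundedContinuousFunction ℂ A := planeRestriction m a ha.continuous hs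
  have hBs : ContDiff ℝ ∞ B := contDiff_infty.2 fun n => contDiff_planeRestriction n a ha hs
  have hC0 : 0 ≤ C := (norm_nonneg _).trans (hC 0)
  have hBn : ∀ y, ‖B y‖ ≤ C := fun y =>
    (BoundedContinuousFunction.norm_le hC0).2 fun ζ => hC _
  set q := ‖T‖ * C with hq
  have hq0 : 0 ≤ q := by positivity
  have hq1 : q < 1 := by nlinarith [norm_nonneg (1 : A)]
  have hTn : ∀ y f, ‖T (f * B y)‖ ≤ q * ‖f‖ := by
    intro y f
    calc ‖T (f * B y)‖ ≤ ‖T‖ * (‖f‖ * ‖B y‖) :=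
          (T.le_opNorm _).trans (by gcongr; exact norm_mul_le _ _)
      _ ≤ ‖T‖ * (‖f‖ * C) := by gcongr; exact hBn y
      _ = q * ‖f‖ := by rw [hq]; ring
  have huniq : ∀ y f, f = T (f * B y) → f = 0 := by
    intro y f hf
    have h1 : ‖f‖ ≤ q * ‖f‖ := (congrArg norm hf).le.trans (hTn y f)
    by_contra h0
    have : 0 < ‖f‖ := norm_pos_iff.2 h0
    nlinarith
  -- the Neumann series: `P y` has norm less than one, so `g y = (1 - P y)⁻¹ 1` exists and is smooth
  let P : V → BoundedContinuousFunction ℂ A →L[ℝ] BoundedContinuousFunction ℂ A := fun y =>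
    T.comp ((ContinuousLinearMap.mul ℝ (BoundedContinuousFunction ℂ A)).flip (B y))
  have hPapp : ∀ y f, P y f = T (f * B y) := fun y f => rfl
  have hPn : ∀ y, ‖P y‖ ≤ q := fun y => ContinuousLinearMap.opNorm_le_bound _ hq0 (hTn y)
  have hPs : ContDiff ℝ ∞ P :=
    contDiff_const.clm_comp (ContinuousLinearMap.contDiff _ |>.comp hBs)
  have hunit : ∀ y, IsUnit (1 - P y) := fun y =>
    isUnit_one_sub_of_norm_lt_one
      (R := BoundedContinuousFunction ℂ A →L[ℝ] BoundedContinuousFunction ℂ A) ((hPn y).trans_lt hq1)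
  let g : V → BoundedContinuousFunction ℂ A := fun y => Ring.inverse (1 - P y) 1
  have hgs : ContDiff ℝ ∞ g := by
    refine ContDiff.clm_apply (contDiff_iff_contDiffAt.2 fun y => ?_) contDiff_const
    obtain ⟨w, hw⟩ := hunit y
    have h1 := contDiffAt_ringInverse ℝ (n := ∞)
      (R := BoundedContinuousFunction ℂ A →L[ℝ] BoundedContinuousFunction ℂ A) w
    rw [hw] at h1
    exact h1.comp y (contDiff_const.sub hPs).contDiffAt
  have hfix : ∀ y, g y = 1 + T (g y * B y) := by
    intro y
    have h1 : (1 - P y) (g y) = 1 := by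
      change ((1 - P y) * Ring.inverse (1 - P y)) 1 = 1
      rw [Ring.mul_inverse_cancel _ (hunit y)]
      rfl
    rw [_root_.sub_apply, hPapp] at h1
    exact sub_eq_iff_eq_add.1 h1
  have hg1 : ∀ y, ‖g y - 1‖ < 1 := by
    intro y
    have h1 : ‖g y - 1‖ ≤ q * ‖g y‖ := by
      conv_lhs => rw [hfix y, add_sub_cancel_left]
      exact hTn y _
    have h2 : ‖g y‖ ≤ ‖g y - 1‖ + ‖(1 : A)‖ := by
      refine (norm_le_norm_sub_add (g y) 1).trans ?_
      gcongr
      exact (BoundedContinuousFunction.norm_le (norm_nonneg _)).2 fun _ => le_rfl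
    have h3 : q * ‖g y‖ ≤ q * (‖g y - 1‖ + ‖(1 : A)‖) := by gcongr
    nlinarith [norm_nonneg (g y - 1)]
  let h : V → A := fun y => g y 0
  have hhs : ContDiff ℝ ∞ h :=
    (BoundedContinuousFunction.evalCLM ℝ (0 : ℂ) :
      BoundedContinuousFunction ℂ A →L[ℝ] A).contDiff.comp hgs
  -- along a line `g` is obtained by translation, since translation commutes with the convolution
  -- and the fixed point is unique
  have htrans : ∀ y s, h (y + m s) = g y s := by
    intro y s
    let τ : BoundedContinuousFunction ℂ A → BoundedContinuousFunction ℂ A := fun f =>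
      f.compContinuous ⟨fun ζ => ζ + s, by fun_prop⟩
    have hτT : ∀ f, τ (T f) = T (τ f) := by
      intro f
      ext ζ
      change T f (ζ + s) = _
      simp only [hT, cauchyOp_apply]
      refine MeasureTheory.integral_congr_ae (Filter.Eventually.of_forall fun η => ?_)
      change _ = cauchyKernel I η * f (ζ - η + s)
      simp only
      congr 2; ring
    have hτB : τ (B y) = B (y + m s) := by
      ext ζ
      change a (y + m (ζ + s)) = a (y + m s + m ζ)
      rw [map_add]; congr 1; abel
    have h1 : τ (g y) = 1 + T (τ (g y) * B (y + m s)) := by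
      rw [← hτB]
      conv_lhs => rw [hfix y]
      change τ 1 + τ (T (g y * B y)) = _
      rw [hτT]
      rfl
    have h2 : τ (g y) - g (y + m s) = T ((τ (g y) - g (y + m s)) * B (y + m s)) := by
      conv_lhs => rw [h1, hfix (y + m s)]
      rw [sub_mul, map_sub]
      abel
    have h3 := sub_eq_zero.1 (huniq _ _ h2)
    have h4 := congrArg (fun f : BoundedContinuousFunction ℂ A => f 0) h3
    simpa [τ] using h4.symm
  refine ⟨h, hhs, fun y => ?_, fun y hy => ?_, fun y s hy => ?_⟩
  · exact ((g y - 1).norm_coe_le_norm 0).trans_lt (hg1 y)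
  -- on the line, `h` is `1` plus the Cauchy transform of `h a`, so `∂̄_u h = h a`
  · let f₀ := g y * B y
    have hf₀ : ∀ ζ, f₀ ζ = h (y + m ζ) * a (y + m ζ) := fun ζ => by rw [htrans]; rfl
    have hline : ContDiff ℝ ∞ fun ζ => y + m ζ := contDiff_const.add m.contDiff
    have hf₀s : ContDiff ℝ 1 f₀ := by
      have : ContDiff ℝ ∞ fun ζ => h (y + m ζ) * a (y + m ζ) :=
        (hhs.comp hline).mul (ha.comp hline)
      rw [← show ⇑f₀ = fun ζ => h (y + m ζ) * a (y + m ζ) from funext hf₀] at this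
      exact this.of_le (by simp)
    obtain ⟨D, hD, hD'⟩ := dbar_cauchyOp hI2 hI f₀ hf₀s (fun ζ hζ => by
      rw [hf₀, hy ζ hζ, mul_zero])
    have h1 : HasFDerivAt (fun ζ => h (y + m ζ)) ((fderiv ℝ h y).comp m) 0 := by
      have h2 : HasFDerivAt h (fderiv ℝ h y) (y + m 0) := by
        rw [map_zero, add_zero]
        exact (hhs.differentiable (by simp) y).hasFDerivAt
      exact HasFDerivAt.comp (0 : ℂ) h2 (m.hasFDerivAt.const_add y)
    have h3 : (fun ζ => h (y + m ζ)) = fun ζ => (1 : A) + T f₀ ζ := by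
      ext ζ
      rw [htrans]
      conv_lhs => rw [hfix y]
      rfl
    rw [h3] at h1
    have h4 : (fderiv ℝ h y).comp m = D := h1.unique (hD.const_add 1)
    have h5 : m 1 = u := by simp [hm, complexLine_apply]
    have h6 : m Complex.I = j u := by simp [hm, complexLine_apply]
    rw [← h4, hf₀, map_zero, add_zero] at hD'
    simp only [ContinuousLinearMap.comp_apply, h5, h6] at hD'
    exact hD'
  -- the antiholomorphic derivative `G` of `g` in the direction `s` satisfies the homogeneous fixed
  -- point equation, so it vanishes
  · have hgd : HasFDerivAt g (fderiv ℝ g y) y := (hgs.differentiable (by simp) y).hasFDerivAt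
    have hBd : HasFDerivAt B (fderiv ℝ B y) y := (hBs.differentiable (by simp) y).hasFDerivAt
    have hD : ∀ v, fderiv ℝ g y v = T (fderiv ℝ g y v * B y + g y * fderiv ℝ B y v) := by
      intro v
      have h1 := (T.hasFDerivAt.comp y (hgd.mul' hBd)).const_add 1
      have h2 : (fun x => 1 + (T ∘ (g * B)) x) = g := funext fun x => (hfix x).symm
      have h3 := h1.fderiv
      rw [h2] at h3
      refine (DFunLike.congr_fun h3 v).trans ?_
      change T (g y * fderiv ℝ B y v + fderiv ℝ g y v * B y) = _
      rw [add_comm]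
    let G := (1 / 2 : ℝ) • (fderiv ℝ g y s + BoundedContinuousFunction.const ℂ I * fderiv ℝ g y (j s))
    have hB0 : (1 / 2 : ℝ) • (fderiv ℝ B y s +
        BoundedContinuousFunction.const ℂ I * fderiv ℝ B y (j s)) = 0 := by
      ext ζ
      have := hy ζ
      rw [dbar, ← fderiv_planeRestriction_apply (ha.of_le (by simp)) hs,
        ← fderiv_planeRestriction_apply (ha.of_le (by simp)) hs] at this
      exact this
    have hcomm : BoundedContinuousFunction.const ℂ I * g y =
        g y * BoundedContinuousFunction.const ℂ I := by
      ext ζ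
      exact (hI _).eq
    have hG : G = T (G * B y) := by
      have h1 : G * B y = (1 / 2 : ℝ) • ((fderiv ℝ g y s * B y + g y * fderiv ℝ B y s) +
          BoundedContinuousFunction.const ℂ I *
            (fderiv ℝ g y (j s) * B y + g y * fderiv ℝ B y (j s))) := by
        exact half_smul_mul_eq hcomm hB0
      rw [h1, map_smul, map_add, cauchyOp_const_mul hI, ← hT, ← hD, ← hD]
    have hG0 := congrArg (fun f : BoundedContinuousFunction ℂ A => f 0) (huniq y G hG)
    have hhd : ∀ v, fderiv ℝ h y v = fderiv ℝ g y v 0 := by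
      intro v
      have h1 := ((BoundedContinuousFunction.evalCLM ℝ (0 : ℂ) :
        BoundedContinuousFunction ℂ A →L[ℝ] A).hasFDerivAt.comp y hgd).fderiv
      change fderiv ℝ h y = _ at h1
      rw [h1]
      rfl
    rw [dbar, hhd, hhd]
    exact hG0

end OneDirection

/-! ### The Koszul–Malgrange theorem -/

section KoszulMalgrange

variable {V : Type*} [NormedAddCommGroup V] [NormedSpace ℝ V] [FiniteDimensional ℝ V]
  {A : Type*} [NormedRing A] [NormedAlgebra ℝ A] [CompleteSpace A]
  {j : V →L[ℝ] V} {I : A}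

/-- A complex linear functional which is a coordinate on the complex line through `u` and vanishes
on a given complex subspace. -/
theorem exists_complex_functional (hj : ∀ v, j (j v) = -v) {S : Submodule ℝ V}
    (hS : ∀ s ∈ S, j s ∈ S) {u : V} (hu : u ∉ S) :
    ∃ ℓ : V →L[ℝ] ℂ, (∀ ζ, ℓ (complexLine j u ζ) = ζ) ∧ ∀ s ∈ S, ℓ s = 0 := by
  have hu' : u ∉ S ⊔ Submodule.span ℝ {j u} := by
    intro h
    obtain ⟨s, hs, w, hw, hsw⟩ := Submodule.mem_sup.1 h
    obtain ⟨c, rfl⟩ := Submodule.mem_span_singleton.1 hw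
    have h1 : u - c • j u ∈ S := by rwa [← eq_sub_of_add_eq hsw]
    have h2 : j (u - c • j u) ∈ S := hS _ h1
    have h3 : (1 + c ^ 2) • u ∈ S := by
      have : (1 + c ^ 2) • u = (u - c • j u) + c • j (u - c • j u) := by
        rw [map_sub, map_smul, hj]
        module
      rw [this]
      exact S.add_mem h1 (S.smul_mem _ h2)
    exact hu ((S.smul_mem_iff (by positivity)).1 h3)
  obtain ⟨f, hf, hker⟩ := Submodule.exists_le_ker_of_notMem hu'
  have hfS : ∀ s ∈ S, f s = 0 := fun s hs => hker (Submodule.mem_sup_left hs)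
  have hfj : f (j u) = 0 :=
    hker (Submodule.mem_sup_right (Submodule.mem_span_singleton_self _))
  let F : V →L[ℝ] ℝ := LinearMap.toContinuousLinearMap ((f u)⁻¹ • f)
  have hF : ∀ v, F v = (f u)⁻¹ * f v := fun v => rfl
  refine ⟨Complex.equivRealProdCLM.symm.toContinuousLinearMap.comp (F.prod (-(F.comp j))), ?_, ?_⟩
  · intro ζ
    apply Complex.ext
    · change F (ζ.re • u + ζ.im • j u) = ζ.re
      simp only [hF, map_add, map_smul, hfj, smul_eq_mul, mul_zero, add_zero]
      field_simp
    · change -F (j (ζ.re • u + ζ.im • j u)) = ζ.im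
      simp only [hF, map_add, map_smul, hj, map_neg, hfj, smul_eq_mul, mul_zero, zero_add]
      field_simp
  · intro s hs
    apply Complex.ext
    · change F s = 0
      rw [hF, hfS s hs, mul_zero]
    · change -F (j s) = 0
      rw [hF, hfS _ (hS s hs), mul_zero, neg_zero]

/-- Local solution of `∂̄_u h = h a` which is holomorphic along `S`, if `a` is holomorphic along the
complex subspace `S`. Near the base point it is enough to solve `∂̄_{εu} h = h b`, where `b` is the
small function obtained from `ε a` by two cutoffs. -/
theorem exists_dbar_eq_mul_local (hj : ∀ v, j (j v) = -v) (hI2 : I * I = -1)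
    (hI : ∀ x, Commute I x) {S : Submodule ℝ V} (hS : ∀ s ∈ S, j s ∈ S) {u : V} (hu : u ∉ S)
    {a : V → A} {y₀ : V} (ha : ∀ᶠ y in 𝓝 y₀, ContDiffAt ℝ ∞ a y)
    (haS : ∀ᶠ y in 𝓝 y₀, ∀ s ∈ S, dbar j I a y s = 0) :
    ∃ h : V → A, ContDiff ℝ ∞ h ∧ IsUnit (h y₀) ∧
      ∀ᶠ y in 𝓝 y₀, dbar j I h y u = h y * a y ∧ ∀ s ∈ S, dbar j I h y s = 0 := by
  obtain ⟨ℓ, hℓ, hℓS⟩ := exists_complex_functional hj hS hu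
  obtain ⟨ρ, hρ, hball⟩ := Metric.eventually_nhds_iff_ball.1 (ha.and haS)
  let χ₁ : ContDiffBump y₀ := ⟨ρ / 2, 3 * ρ / 4, by positivity, by linarith⟩
  let χ₂ : ContDiffBump (0 : ℂ) := ⟨1 / 4, 1 / 2, by norm_num, by norm_num⟩
  have hacont : ContinuousOn a (Metric.closedBall y₀ (3 * ρ / 4)) := fun y hy =>
    (hball y (Metric.closedBall_subset_ball (by linarith) hy)).1.continuousAt.continuousWithinAt
  obtain ⟨C, hC⟩ := (isCompact_closedBall y₀ (3 * ρ / 4)).exists_bound_of_continuousOn hacont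
  have hC0 : 0 ≤ C := (norm_nonneg _).trans (hC y₀ (Metric.mem_closedBall_self (by positivity)))
  set m := complexLine j u with hm
  -- rescaling `u` makes `a` small, and the relevant part of the complex lines short
  obtain ⟨ε, hε, hε1, hε2⟩ : ∃ ε : ℝ, 0 < ε ∧ ε * ‖m‖ ≤ ρ / 4 ∧
      ‖cauchyOp I‖ * (ε * C) * (‖(1 : A)‖ + 1) < 1 := by
    set K := ‖cauchyOp I‖ * C * (‖(1 : A)‖ + 1) with hK
    have hK0 : 0 ≤ K := by positivity
    refine ⟨min (ρ / 4 / (‖m‖ + 1)) (1 / (K + 1)), by positivity, ?_, ?_⟩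
    · calc _ ≤ ρ / 4 / (‖m‖ + 1) * ‖m‖ := by gcongr; exact min_le_left _ _
        _ ≤ ρ / 4 / (‖m‖ + 1) * (‖m‖ + 1) := by gcongr; linarith
        _ = ρ / 4 := by field_simp
    · calc _ = min (ρ / 4 / (‖m‖ + 1)) (1 / (K + 1)) * K := by rw [hK]; ring
        _ ≤ 1 / (K + 1) * K := by gcongr; exact min_le_right _ _
        _ < 1 := by rw [div_mul_eq_mul_div, one_mul, div_lt_one (by positivity)]; linarith
  have hmε : ∀ ζ, complexLine j (ε • u) ζ = ε • m ζ := by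
    intro ζ
    simp only [hm, complexLine_apply, map_smul, smul_add]
    rw [smul_comm, smul_comm ε ζ.im]
  -- the cutoff `χ₂ ∘ t` along the complex lines depends only on a coordinate `t` which is constant
  -- along `S`, so it preserves holomorphy along `S`
  let t : V → ℂ := fun y => ε⁻¹ • ℓ (y - y₀)
  have ht : ContDiff ℝ ∞ t := (ℓ.contDiff.comp (contDiff_id.sub contDiff_const)).const_smul _
  have htm : ∀ y ζ, t (y + ε • m ζ) = t y + ζ := by
    intro y ζ
    simp only [t]
    rw [show y + ε • m ζ - y₀ = (y - y₀) + ε • m ζ by abel, map_add, map_smul, hℓ, smul_add,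
      smul_smul, inv_mul_cancel₀ hε.ne', one_smul]
  let c : V → ℝ := fun y => χ₂ (t y) * ε
  have hc : ContDiff ℝ ∞ c := (χ₂.contDiff.comp ht).mul contDiff_const
  let b : V → A := fun y => χ₁ y • (c y • a y)
  have hb : ContDiff ℝ ∞ b := by
    refine contDiff_iff_contDiffAt.2 fun y => ?_
    by_cases hy : y ∈ Metric.ball y₀ ρ
    · exact χ₁.contDiffAt.smul (hc.contDiffAt.smul (hball y hy).1)
    · have h1 : y ∉ tsupport χ₁ := by
        rw [χ₁.tsupport_eq]
        intro h
        exact hy (Metric.closedBall_subset_ball (by change 3 * ρ / 4 < ρ; linarith) h)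
      have h2 : b =ᶠ[𝓝 y] fun _ => 0 := by
        filter_upwards [notMem_tsupport_iff_eventuallyEq.1 h1] with z hz
        simp only [b, hz, Pi.zero_apply, zero_smul]
      exact contDiffAt_const.congr_of_eventuallyEq h2
  have hbs : HasCompactSupport b := χ₁.hasCompactSupport.smul_right
  have hbC : ∀ y, ‖b y‖ ≤ ε * C := by
    intro y
    by_cases hy : y ∈ Metric.ball y₀ (3 * ρ / 4)
    · simp only [b, c]
      rw [norm_smul, norm_smul, norm_mul, Real.norm_of_nonneg hε.le,
        Real.norm_of_nonneg χ₁.nonneg, Real.norm_of_nonneg χ₂.nonneg]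
      calc χ₁ y * (χ₂ (t y) * ε * ‖a y‖) ≤ 1 * (1 * ε * C) := by
            have h1 : ‖a y‖ ≤ C := hC y (Metric.ball_subset_closedBall hy)
            have h2 : χ₁ y ≤ 1 := χ₁.le_one
            have h3 : χ₂ (t y) ≤ 1 := χ₂.le_one
            have h4 : 0 ≤ χ₂ (t y) := χ₂.nonneg
            gcongr
        _ = ε * C := by ring
    · have : χ₁ y = 0 := χ₁.zero_of_le_dist (by simpa using hy)
      simp only [b, this, zero_smul, norm_zero]
      positivity
  obtain ⟨h, hh, hh1, hhu, hhS⟩ := exists_dbar_eq_mul_of_small (j := j) hI2 hI (ε • u) hb hbs hbC hε2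
  refine ⟨h, hh, ?_, ?_⟩
  · have := isUnit_one_sub_of_norm_lt_one (x := 1 - h y₀) (by rw [norm_sub_rev]; exact hh1 y₀)
    simpa using this
  have hnear : ∀ᶠ y in 𝓝 y₀, ‖t y‖ < 1 / 8 := by
    have : ‖t y₀‖ < 1 / 8 := by simp [t]
    exact ht.continuous.norm.continuousAt.eventually_lt continuousAt_const this
  filter_upwards [hnear, Metric.ball_mem_nhds y₀ (show 0 < ρ / 8 by positivity)] with y hy1 hy2
  rw [Metric.mem_ball, dist_eq_norm] at hy2
  have hfar : ∀ ζ : ℂ, 1 ≤ ‖ζ‖ → 1 / 2 < ‖t (y + ε • m ζ)‖ := by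
    intro ζ hζ
    rw [htm]
    have := norm_sub_norm_le ζ (-t y)
    rw [norm_neg, sub_neg_eq_add, add_comm] at this
    linarith
  constructor
  · have h1 := hhu y (fun ζ hζ => by
      rw [hmε]
      have : χ₂ (t (y + ε • m ζ)) = 0 := χ₂.zero_of_le_dist (by
        rw [dist_zero_right]; exact (hfar ζ hζ).le)
      simp only [b, c, this, zero_mul, zero_smul, smul_zero])
    have h2 : b y = ε • a y := by
      have e1 : χ₁ y = 1 := χ₁.one_of_mem_closedBall (by
        rw [Metric.mem_closedBall, dist_eq_norm]; change _ ≤ ρ / 2; linarith)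
      have e2 : χ₂ (t y) = 1 := χ₂.one_of_mem_closedBall (by
        rw [mem_closedBall_zero_iff]; change _ ≤ (1 / 4 : ℝ); linarith)
      simp only [b, c, e1, e2, one_mul, one_smul]
    rw [h2, dbar_smul_dir, mul_smul_comm] at h1
    exact smul_right_injective A hε.ne' h1
  · intro s hs
    refine hhS y s fun ζ => ?_
    rw [hmε]
    set x := y + ε • m ζ with hx
    -- far out on the line `b` vanishes; the rest of the line lies where `χ₁ = 1`
    rcases le_or_gt 1 ‖ζ‖ with hζ | hζ
    · have h1 : b =ᶠ[𝓝 x] fun _ => 0 := by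
        have : ∀ᶠ z in 𝓝 x, 1 / 2 < ‖t z‖ :=
          continuousAt_const.eventually_lt ht.continuous.norm.continuousAt (hfar ζ hζ)
        filter_upwards [this] with z hz
        have : χ₂ (t z) = 0 := χ₂.zero_of_le_dist (by rw [dist_zero_right]; exact hz.le)
        simp only [b, c, this, zero_mul, zero_smul, smul_zero]
      rw [dbar_congr h1]
      simp [dbar]
    · have hxb : x ∈ Metric.ball y₀ (ρ / 2) := by
        rw [Metric.mem_ball, dist_eq_norm, hx]
        have e1 : ‖ε • m ζ‖ ≤ ρ / 4 := by
          rw [norm_smul, Real.norm_of_nonneg hε.le]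
          calc ε * ‖m ζ‖ ≤ ε * (‖m‖ * 1) := by
                gcongr; exact (m.le_opNorm ζ).trans (by gcongr)
            _ ≤ ρ / 4 := by rw [mul_one]; exact hε1
        calc ‖y + ε • m ζ - y₀‖ = ‖(y - y₀) + ε • m ζ‖ := by congr 1; abel
          _ ≤ ‖y - y₀‖ + ‖ε • m ζ‖ := norm_add_le _ _
          _ < ρ / 2 := by linarith
      have hxρ := hball x (Metric.ball_subset_ball (by linarith) hxb)
      have h1 : b =ᶠ[𝓝 x] fun z => c z • a z := by
        filter_upwards [Metric.isOpen_ball.mem_nhds hxb] with z hz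
        have e1 : χ₁ z = 1 := χ₁.one_of_mem_closedBall (Metric.ball_subset_closedBall hz)
        simp only [b, e1, one_smul]
      have hcS : ∀ s ∈ S, fderiv ℝ c x s = 0 := by
        intro s hs
        have e1 : HasFDerivAt t (ε⁻¹ • ℓ) x :=
          (ℓ.hasFDerivAt.comp x ((hasFDerivAt_id x).sub_const y₀)).const_smul ε⁻¹
        have e2 : HasFDerivAt χ₂ (fderiv ℝ χ₂ (t x)) (t x) :=
          ((χ₂.contDiff (n := 1)).differentiable (by simp) (t x)).hasFDerivAt
        have e3 := ((e2.comp x e1).mul_const ε).fderiv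
        change fderiv ℝ c x = _ at e3
        rw [e3]
        simp [hℓS s hs]
      have hcd : DifferentiableAt ℝ c x := hc.differentiable (by simp) x
      have had : DifferentiableAt ℝ a x := hxρ.1.differentiableAt (by simp)
      have hD : ∀ s ∈ S, fderiv ℝ b x s = c x • fderiv ℝ a x s := by
        intro s hs
        rw [h1.fderiv_eq, fderiv_fun_smul hcd had]
        simp [hcS s hs]
      have h2 := hxρ.2 s hs
      rw [dbar, hD s hs, hD _ (hS s hs), mul_smul_comm, ← smul_add, smul_comm]
      rw [dbar] at h2
      rw [h2, smul_zero]

/-- The gauge transform of the antilinear form `α` by an invertible function `h`: if `∂̄ g = g β`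
for the transform `β`, then `∂̄ (g h) = (g h) α`. -/
def gaugeTransform (j : V →L[ℝ] V) (I : A) (h : V → A) (α : V → V →L[ℝ] A) (y : V) : V →L[ℝ] A :=
  ((ContinuousLinearMap.mul ℝ A).flip (Ring.inverse (h y))).comp
    ((ContinuousLinearMap.mul ℝ A (h y)).comp (α y) - (1 / 2 : ℝ) • (fderiv ℝ h y +
      (ContinuousLinearMap.mul ℝ A I).comp ((fderiv ℝ h y).comp j)))

theorem gaugeTransform_apply (h : V → A) (α : V → V →L[ℝ] A) (y v : V) :
    gaugeTransform j I h α y v = (h y * α y v - dbar j I h y v) * Ring.inverse (h y) := rfl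

theorem gaugeTransform_mul {h : V → A} {α : V → V →L[ℝ] A} {y : V} (hh : IsUnit (h y)) (v : V) :
    gaugeTransform j I h α y v * h y = h y * α y v - dbar j I h y v := by
  rw [gaugeTransform_apply, mul_assoc, Ring.inverse_mul_cancel _ hh, mul_one]

theorem contDiffAt_gaugeTransform {h : V → A} {α : V → V →L[ℝ] A} {y : V} (hu : IsUnit (h y))
    (hh : ContDiffAt ℝ ∞ h y) (hα : ContDiffAt ℝ ∞ α y) :
    ContDiffAt ℝ ∞ (gaugeTransform j I h α) y := by
  have h1 : ContDiffAt ℝ ∞ (fun y => Ring.inverse (h y)) y := by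
    obtain ⟨w, hw⟩ := hu
    have := contDiffAt_ringInverse ℝ (n := ∞) w
    rw [hw] at this
    exact this.comp y hh
  have hD : ContDiffAt ℝ ∞ (fderiv ℝ h) y := hh.fderiv_right (by simp)
  have h2 : ContDiffAt ℝ ∞ (fun y => (ContinuousLinearMap.mul ℝ A).flip (Ring.inverse (h y))) y :=
    ((ContinuousLinearMap.mul ℝ A).flip.contDiff.contDiffAt).comp y h1
  have h3 : ContDiffAt ℝ ∞ (fun y => ContinuousLinearMap.mul ℝ A (h y)) y :=
    ((ContinuousLinearMap.mul ℝ A).contDiff.contDiffAt).comp y hh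
  exact h2.clm_comp ((h3.clm_comp hα).sub ((hD.add
    (contDiffAt_const.clm_comp (hD.clm_comp contDiffAt_const))).const_smul _))

/-- The integrability condition `∂̄α + α ∧ α = 0` at a point. -/
def IsDbarFlatAt (j : V →L[ℝ] V) (I : A) (α : V → V →L[ℝ] A) (y : V) : Prop :=
  ∀ u v, dbar j I (fun y => α y v) y u - dbar j I (fun y => α y u) y v +
    (α y u * α y v - α y v * α y u) = 0

/-- The integrability condition is invariant under gauge transformations. -/
theorem IsDbarFlatAt.gaugeTransform (hI : ∀ x, Commute I x) {h : V → A} {α : V → V →L[ℝ] A}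
    {y : V} (hh : ContDiff ℝ ∞ h) (hu : IsUnit (h y)) (hα : ContDiffAt ℝ ∞ α y)
    (hflat : IsDbarFlatAt j I α y) :
    IsDbarFlatAt j I (AlmostComplexNormalBundle.gaugeTransform j I h α) y := by
  intro u v
  set β := AlmostComplexNormalBundle.gaugeTransform j I h α with hβ
  have hβs : ContDiffAt ℝ ∞ β y := contDiffAt_gaugeTransform hu hh.contDiffAt hα
  have hhd : DifferentiableAt ℝ h y := hh.differentiable (by simp) y
  have hβd : ∀ w, DifferentiableAt ℝ (fun y => β y w) y := fun w =>
    (hβs.clm_apply contDiffAt_const).differentiableAt (by simp)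
  have hαd : ∀ w, DifferentiableAt ℝ (fun y => α y w) y := fun w =>
    (hα.clm_apply contDiffAt_const).differentiableAt (by simp)
  have hun : ∀ᶠ z in 𝓝 y, IsUnit (h z) :=
    hh.continuous.continuousAt.eventually (Units.isOpen.mem_nhds hu)
  have hdb : ∀ w, dbar j I h y w = h y * α y w - β y w * h y := by
    intro w
    rw [hβ, gaugeTransform_mul hu, sub_sub_cancel]
  have key : ∀ u v, dbar j I (fun y => β y v) y u * h y + β y v * dbar j I h y u =
      dbar j I h y u * α y v + h y * dbar j I (fun y => α y v) y u -
        dbar j I (fun y => dbar j I h y v) y u := by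
    intro u v
    rw [← dbar_mul hI (hβd v) hhd, ← dbar_mul hI hhd (hαd v),
      ← dbar_sub (f := fun y => h y * α y v) (hhd.mul (hαd v)) ((contDiffAt_dbar hh.contDiffAt v).differentiableAt (by simp))]
    refine dbar_congr ?_ u
    filter_upwards [hun] with z hz using gaugeTransform_mul hz v
  have k1 := key u v
  have k2 := key v u
  rw [dbar_comm hh.contDiffAt u v, hdb u] at k1
  rw [hdb v] at k2
  have k3 := hflat u v
  have k4 : (dbar j I (fun y => β y v) y u - dbar j I (fun y => β y u) y v +
      (β y u * β y v - β y v * β y u)) * h y = 0 := by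
    rw [add_mul, sub_mul, eq_sub_of_add_eq k1, eq_sub_of_add_eq k2]
    have k5 : dbar j I (fun y => α y v) y u = dbar j I (fun y => α y u) y v -
        (α y u * α y v - α y v * α y u) := by
      rw [← sub_eq_zero, ← k3]; abel
    rw [k5]
    noncomm_ring
  exact (hu.mul_left_eq_zero).1 k4

/-- Solution of `∂̄ h = h α` for a flat form `α` which vanishes along a complex subspace `S`, by
induction on the codimension of `S`. In a direction `u` outside `S` the equation is solved by
`exists_dbar_eq_mul_local`; the gauge transform of `α` by the solution is again flat, and it
vanishes along the larger subspace `S ⊕ ℂ u`. -/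
theorem exists_dbar_eq_mul_of_vanishing (hj : ∀ v, j (j v) = -v) (hI2 : I * I = -1)
    (hI : ∀ x, Commute I x) {y₀ : V} (n : ℕ) : ∀ (S : Submodule ℝ V), (∀ s ∈ S, j s ∈ S) →
    Module.finrank ℝ V ≤ Module.finrank ℝ S + n → ∀ α : V → V →L[ℝ] A,
    (∀ᶠ y in 𝓝 y₀, ContDiffAt ℝ ∞ α y) → (∀ᶠ y in 𝓝 y₀, ∀ v, α y (j v) = -(I * α y v)) →
    (∀ᶠ y in 𝓝 y₀, IsDbarFlatAt j I α y) → (∀ᶠ y in 𝓝 y₀, ∀ s ∈ S, α y s = 0) →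
    ∃ h : V → A, ContDiff ℝ ∞ h ∧ IsUnit (h y₀) ∧
      ∀ᶠ y in 𝓝 y₀, ∀ v, dbar j I h y v = h y * α y v := by
  induction n with
  | zero =>
    intro S hS hn α hα hαj hflat hαS
    have hST : S = ⊤ := Submodule.eq_top_of_finrank_eq (le_antisymm (Submodule.finrank_le S) hn)
    refine ⟨fun _ => 1, contDiff_const, isUnit_one, ?_⟩
    filter_upwards [hαS] with y hy v
    rw [hy v (by rw [hST]; trivial)]
    simp [dbar]
  | succ n ih =>
    intro S hS hn α hα hαj hflat hαS
    by_cases hST : S = ⊤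
    · exact ih S hS (by rw [hST, finrank_top]; omega) α hα hαj hflat hαS
    obtain ⟨u, -, hu⟩ := SetLike.exists_of_lt (lt_top_iff_ne_top.2 hST)
    -- along `S` the component `α_u` is holomorphic
    have hαu : ∀ᶠ y in 𝓝 y₀, ∀ s ∈ S, dbar j I (fun y => α y u) y s = 0 := by
      filter_upwards [hflat, hαS.eventually_nhds] with y hy hyS s hs
      have h1 := hy s u
      have h2 : (fun y => α y s) =ᶠ[𝓝 y] fun _ => 0 := by
        filter_upwards [hyS] with z hz using hz s hs
      rw [dbar_congr h2, hyS.self_of_nhds s hs] at h1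
      simpa [dbar] using h1
    have hαus : ∀ᶠ y in 𝓝 y₀, ContDiffAt ℝ ∞ (fun y => α y u) y := by
      filter_upwards [hα] with y hy using hy.clm_apply contDiffAt_const
    obtain ⟨h, hh, hhu, hsol⟩ := exists_dbar_eq_mul_local hj hI2 hI hS hu hαus hαu
    have hun : ∀ᶠ z in 𝓝 y₀, IsUnit (h z) :=
      hh.continuous.continuousAt.eventually (Units.isOpen.mem_nhds hhu)
    let S' := S ⊔ Submodule.span ℝ {u, j u}
    have hgen : ∀ {P : V → Prop}, (∀ s ∈ S, P s) → P u → P (j u) → (∀ v w, P v → P w → P (v + w)) →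
        (∀ (c : ℝ) v, P v → P (c • v)) → ∀ s ∈ S', P s := by
      intro P hPS hPu hPj hadd hsmul s hs
      obtain ⟨s₁, hs₁, w, hw, rfl⟩ := Submodule.mem_sup.1 hs
      obtain ⟨c, d, rfl⟩ := Submodule.mem_span_pair.1 hw
      exact hadd _ _ (hPS _ hs₁) (hadd _ _ (hsmul _ _ hPu) (hsmul _ _ hPj))
    have huS' : u ∈ S' := Submodule.mem_sup_right (Submodule.subset_span (by simp))
    have hjuS' : j u ∈ S' := Submodule.mem_sup_right (Submodule.subset_span (by simp))
    have hSS' : S ≤ S' := le_sup_left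
    have hS' : ∀ s ∈ S', j s ∈ S' := by
      refine hgen (fun s hs => hSS' (hS s hs)) hjuS' ?_ ?_ ?_
      · rw [hj]; exact S'.neg_mem huS'
      · intro v w hv hw; rw [map_add]; exact S'.add_mem hv hw
      · intro c v hv; rw [map_smul]; exact S'.smul_mem c hv
    have hlt : Module.finrank ℝ S < Module.finrank ℝ S' :=
      Submodule.finrank_lt_finrank_of_lt (lt_of_le_of_ne hSS' fun he => hu (he ▸ huS'))
    obtain ⟨g, hg, hgu, hgsol⟩ := ih S' hS' (by omega) (gaugeTransform j I h α) (by
        filter_upwards [hα, hun] with y hy hyu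
        exact contDiffAt_gaugeTransform hyu hh.contDiffAt hy) (by
        filter_upwards [hαj] with y hy v
        rw [gaugeTransform_apply, gaugeTransform_apply, hy, dbar_j hj hI2, mul_neg, ← mul_assoc,
          ← (hI (h y)).eq]
        noncomm_ring) (by
        filter_upwards [hα, hun, hflat] with y hy hyu hyf
        exact hyf.gaugeTransform hI hh hyu hy) (by
        filter_upwards [hαS, hαj, hsol] with y hyS hyj hysol
        refine hgen (fun s hs => ?_) ?_ ?_ ?_ ?_
        · rw [gaugeTransform_apply, hyS s hs, hysol.2 s hs]; simp
        · rw [gaugeTransform_apply, hysol.1, sub_self, zero_mul]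
        · rw [gaugeTransform_apply, dbar_j hj hI2, hysol.1, hyj, mul_neg, ← mul_assoc,
            ← (hI (h y)).eq]
          noncomm_ring
        · intro v w hv hw; rw [map_add, hv, hw, add_zero]
        · intro c v hv; rw [map_smul, hv, smul_zero])
    refine ⟨fun y => g y * h y, hg.mul hh, hgu.mul hhu, ?_⟩
    filter_upwards [hgsol, hun] with y hy hyu v
    rw [dbar_mul hI (hg.differentiable (by simp) y) (hh.differentiable (by simp) y), hy, mul_assoc,
      gaugeTransform_mul hyu]
    noncomm_ring

/-- The Koszul–Malgrange theorem: an antilinear form `α` with `∂̄α + α ∧ α = 0` is locally of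
the form `h⁻¹ ∂̄h`. -/
theorem exists_dbar_eq_mul (hj : ∀ v, j (j v) = -v) (hI2 : I * I = -1)
    (hI : ∀ x, Commute I x) {y₀ : V} {α : V → V →L[ℝ] A}
    (hα : ∀ᶠ y in 𝓝 y₀, ContDiffAt ℝ ∞ α y) (hαj : ∀ᶠ y in 𝓝 y₀, ∀ v, α y (j v) = -(I * α y v))
    (hflat : ∀ᶠ y in 𝓝 y₀, IsDbarFlatAt j I α y) :
    ∃ h : V → A, ContDiff ℝ ∞ h ∧ IsUnit (h y₀) ∧
      ∀ᶠ y in 𝓝 y₀, ∀ v, dbar j I h y v = h y * α y v :=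
  exists_dbar_eq_mul_of_vanishing hj hI2 hI (Module.finrank ℝ V) ⊥ (by simp) (by simp) α hα hαj hflat
    (Filter.Eventually.of_forall (by simp))

end KoszulMalgrange

/-! ### Connections with values in an algebra and holomorphic frames -/

section ConnectionForms

variable {V : Type*} [NormedAddCommGroup V] [NormedSpace ℝ V]
  {B : Type*} [NormedRing B] [NormedAlgebra ℝ B]
  {j : V →L[ℝ] V} {γ : V → V →L[ℝ] B} {k g : V → B} {y : V}

/-- The curvature `dγ + γ ∧ γ` of the connection form `γ`. -/
def formCurvature (γ : V → V →L[ℝ] B) (y u v : V) : B :=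
  fderiv ℝ γ y u v - fderiv ℝ γ y v u + (γ y u * γ y v - γ y v * γ y u)

/-- Four times the part of the curvature of `γ` which is antilinear in both arguments, for the
complex structures `j` of the base and `k` of the fibres. -/
def formCurvatureAntilinear (j : V →L[ℝ] V) (k : V → B) (γ : V → V →L[ℝ] B) (y u v : V) : B :=
  formCurvature γ y u v + k y * formCurvature γ y (j u) v + k y * formCurvature γ y u (j v) -
    formCurvature γ y (j u) (j v)

/-- The gauge transform of the connection form `γ` by an invertible function `g`. -/
def connectionGauge (g : V → B) (γ : V → V →L[ℝ] B) (y : V) : V →L[ℝ] B :=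
  ((ContinuousLinearMap.mul ℝ B).flip (Ring.inverse (g y))).comp
    ((ContinuousLinearMap.mul ℝ B (g y)).comp (γ y) - fderiv ℝ g y)

theorem connectionGauge_apply (u : V) :
    connectionGauge g γ y u = (g y * γ y u - fderiv ℝ g y u) * Ring.inverse (g y) := rfl

theorem connectionGauge_mul (hg : IsUnit (g y)) (u : V) :
    connectionGauge g γ y u * g y = g y * γ y u - fderiv ℝ g y u := by
  rw [connectionGauge_apply, mul_assoc, Ring.inverse_mul_cancel _ hg, mul_one]

theorem contDiffAt_connectionGauge [CompleteSpace B] (hu : IsUnit (g y)) (hg : ContDiffAt ℝ ∞ g y)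
    (hγ : ContDiffAt ℝ ∞ γ y) : ContDiffAt ℝ ∞ (connectionGauge g γ) y := by
  have h1 : ContDiffAt ℝ ∞ (fun y => Ring.inverse (g y)) y := by
    obtain ⟨w, hw⟩ := hu
    have := contDiffAt_ringInverse ℝ (n := ∞) w
    rw [hw] at this
    exact this.comp y hg
  have h2 : ContDiffAt ℝ ∞ (fun y => (ContinuousLinearMap.mul ℝ B).flip (Ring.inverse (g y))) y :=
    ((ContinuousLinearMap.mul ℝ B).flip.contDiff.contDiffAt).comp y h1
  have h3 : ContDiffAt ℝ ∞ (fun y => ContinuousLinearMap.mul ℝ B (g y)) y :=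
    ((ContinuousLinearMap.mul ℝ B).contDiff.contDiffAt).comp y hg
  exact h2.clm_comp ((h3.clm_comp hγ).sub (hg.fderiv_right (by simp)))

theorem fderiv_fun_apply_const {V₂ W : Type*} [NormedAddCommGroup V₂] [NormedSpace ℝ V₂]
    [NormedAddCommGroup W] [NormedSpace ℝ W] {f : V → V₂ →L[ℝ] W} (hf : DifferentiableAt ℝ f y)
    (v : V₂) (u : V) :
    fderiv ℝ (fun y => f y v) y u = fderiv ℝ f y u v := by
  rw [fderiv_clm_apply hf (differentiableAt_const v)]
  simp

theorem fderiv_fun_mul_apply {f₁ f₂ : V → B} (h₁ : DifferentiableAt ℝ f₁ y)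
    (h₂ : DifferentiableAt ℝ f₂ y) (u : V) :
    fderiv ℝ (fun y => f₁ y * f₂ y) y u = fderiv ℝ f₁ y u * f₂ y + f₁ y * fderiv ℝ f₂ y u := by
  have := (h₁.hasFDerivAt.mul' h₂.hasFDerivAt).fderiv
  change fderiv ℝ (fun y => f₁ y * f₂ y) y = _ at this
  rw [this]
  simp [add_comm]

theorem formCurvature_connectionGauge [CompleteSpace B] (hu : IsUnit (g y))
    (hg : ContDiffAt ℝ ∞ g y) (hgu : ∀ᶠ z in 𝓝 y, IsUnit (g z)) (hγ : ContDiffAt ℝ ∞ γ y)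
    (u v : V) :
    formCurvature (connectionGauge g γ) y u v * g y = g y * formCurvature γ y u v := by
  set β := connectionGauge g γ with hβ
  have hβs : ContDiffAt ℝ ∞ β y := contDiffAt_connectionGauge hu hg hγ
  have hgd : DifferentiableAt ℝ g y := hg.differentiableAt (by simp)
  have hβd : DifferentiableAt ℝ β y := hβs.differentiableAt (by simp)
  have hγd : DifferentiableAt ℝ γ y := hγ.differentiableAt (by simp)
  have hDd : DifferentiableAt ℝ (fderiv ℝ g) y :=
    (hg.fderiv_right (m := ∞) (by simp)).differentiableAt (by simp)
  have hap : ∀ {f : V → V →L[ℝ] B}, DifferentiableAt ℝ f y → ∀ w,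
      DifferentiableAt ℝ (fun y => f y w) y := fun hf w => hf.clm_apply (differentiableAt_const w)
  have hdg : ∀ w, fderiv ℝ g y w = g y * γ y w - β y w * g y := by
    intro w
    rw [hβ, connectionGauge_mul hu, sub_sub_cancel]
  have key : ∀ u v, fderiv ℝ β y u v * g y + β y v * fderiv ℝ g y u =
      fderiv ℝ g y u * γ y v + g y * fderiv ℝ γ y u v - fderiv ℝ (fderiv ℝ g) y u v := by
    intro u v
    have h1 : (fun z => β z v * g z) =ᶠ[𝓝 y] fun z => g z * γ z v - fderiv ℝ g z v := by
      filter_upwards [hgu] with z hz using connectionGauge_mul hz v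
    have h2 := DFunLike.congr_fun (h1.fderiv_eq (𝕜 := ℝ)) u
    rwa [fderiv_fun_mul_apply (hap hβd v) hgd, fderiv_fun_sub (f := fun z => g z * γ z v) (hgd.mul (hap hγd v)) (hap hDd v),
      sub_apply, fderiv_fun_mul_apply hgd (hap hγd v), fderiv_fun_apply_const hβd,
      fderiv_fun_apply_const hγd, fderiv_fun_apply_const hDd] at h2
  have hs : fderiv ℝ (fderiv ℝ g) y u v = fderiv ℝ (fderiv ℝ g) y v u :=
    (hg.isSymmSndFDerivAt (by simpa using ENat.LEInfty.out)).eq u v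
  have k1 := key u v
  have k2 := key v u
  rw [hs, hdg u] at k1
  rw [hdg v] at k2
  rw [formCurvature, formCurvature, add_mul, sub_mul, eq_sub_of_add_eq k1, eq_sub_of_add_eq k2]
  noncomm_ring

/-- A complex vector bundle with connection whose curvature has no antilinear part has local
holomorphic frames: after normalizing the complex structure of the fibres, this is the
Koszul–Malgrange theorem. -/
theorem exists_holomorphic_frame [FiniteDimensional ℝ V] [FiniteDimensional ℝ B]
    (hj : ∀ v, j (j v) = -v) {y₀ : V}
    (hk : ∀ᶠ y in 𝓝 y₀, ContDiffAt ℝ ∞ k y) (hγ : ∀ᶠ y in 𝓝 y₀, ContDiffAt ℝ ∞ γ y)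
    (hk2 : ∀ᶠ y in 𝓝 y₀, k y * k y = -1)
    (hpar : ∀ᶠ y in 𝓝 y₀, ∀ u, fderiv ℝ k y u = k y * γ y u - γ y u * k y)
    (hR : ∀ᶠ y in 𝓝 y₀, ∀ u v, formCurvatureAntilinear j k γ y u v = 0) :
    ∃ g : V → B, (∀ᶠ y in 𝓝 y₀, ContDiffAt ℝ ∞ g y) ∧ IsUnit (g y₀) ∧
      ∀ᶠ y in 𝓝 y₀, g y * k y = k y₀ * g y ∧
        ∀ u, fderiv ℝ g y (j u) - g y * γ y (j u) = k y₀ * (fderiv ℝ g y u - g y * γ y u) := by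
  have : CompleteSpace B := FiniteDimensional.complete ℝ B
  set k₀ := k y₀ with hk₀
  have hk₀2 : k₀ * k₀ = -1 := hk2.self_of_nhds
  have hk₀' : ∀ x, k₀ * (k₀ * x) = -x := fun x => by rw [← mul_assoc, hk₀2, neg_one_mul]
  -- `g₁` intertwines `k` and `k₀`
  let g₁ : V → B := fun y => (1 / 2 : ℝ) • (1 - k₀ * k y)
  have hg₁ : ∀ᶠ y in 𝓝 y₀, ContDiffAt ℝ ∞ g₁ y := by
    filter_upwards [hk] with y hy
    exact (contDiffAt_const.sub (contDiffAt_const.mul hy)).const_smul _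
  have hg₁0 : g₁ y₀ = 1 := by
    simp only [g₁, ← hk₀, hk₀2, sub_neg_eq_add, ← two_smul ℝ (1 : B), smul_smul]
    norm_num
  have hg₁u : ∀ᶠ y in 𝓝 y₀, IsUnit (g₁ y) :=
    hg₁.self_of_nhds.continuousAt.eventually (Units.isOpen.mem_nhds (by rw [hg₁0]; exact isUnit_one))
  have hg₁k : ∀ᶠ y in 𝓝 y₀, k₀ * g₁ y = g₁ y * k y := by
    filter_upwards [hk2] with y hy
    simp only [g₁, mul_smul_comm, smul_mul_assoc, mul_sub, sub_mul, mul_one, one_mul, hk₀',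
      mul_assoc, hy]
    congr 1; noncomm_ring
  let β : V → V →L[ℝ] B := connectionGauge g₁ γ
  have hβs : ∀ᶠ y in 𝓝 y₀, ContDiffAt ℝ ∞ β y := by
    filter_upwards [hg₁, hg₁u, hγ] with y h1 h2 h3 using contDiffAt_connectionGauge h2 h1 h3
  have hβk : ∀ᶠ y in 𝓝 y₀, ∀ u, β y u * k₀ = k₀ * β y u := by
    filter_upwards [hg₁, hg₁u, hg₁k.eventually_nhds, hpar, hk] with y h1 h2 h3 h4 h5 u
    have hkd : DifferentiableAt ℝ k y := h5.differentiableAt (by simp)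
    have hgd : DifferentiableAt ℝ g₁ y := h1.differentiableAt (by simp)
    have e1 := DFunLike.congr_fun (Filter.EventuallyEq.fderiv_eq (𝕜 := ℝ)
      (show (fun z => k₀ * g₁ z) =ᶠ[𝓝 y] fun z => g₁ z * k z from h3)) u
    rw [fderiv_fun_mul_apply (differentiableAt_const _) hgd, fderiv_fun_mul_apply hgd hkd,
      h4 u, fderiv_fun_const, Pi.zero_apply, zero_apply, zero_mul, zero_add] at e1
    have e2 := connectionGauge_mul (γ := γ) h2 u
    have e3 := h3.self_of_nhds
    rw [← sub_eq_zero]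
    refine h2.mul_left_eq_zero.1 ?_
    rw [sub_mul, mul_assoc, e3, ← mul_assoc, mul_assoc k₀]
    simp only [β]
    rw [e2, mul_sub, e1, ← mul_assoc k₀, e3]
    noncomm_ring
  have hβR : ∀ᶠ y in 𝓝 y₀, ∀ u v, formCurvatureAntilinear j (fun _ => k₀) β y u v = 0 := by
    filter_upwards [hg₁, hg₁u.eventually_nhds, hg₁k, hγ, hR] with y h1 h2 h3 h4 h5 u v
    have hc : ∀ u v, formCurvature β y u v * g₁ y = g₁ y * formCurvature γ y u v :=
      formCurvature_connectionGauge h2.self_of_nhds h1 h2 h4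
    refine h2.self_of_nhds.mul_left_eq_zero.1 ?_
    rw [← mul_zero (g₁ y), ← h5 u v]
    simp only [formCurvatureAntilinear, sub_mul, add_mul, mul_assoc, hc, mul_sub, mul_add]
    simp only [← mul_assoc, h3]
  -- the antilinear part of the connection form, in the algebra of endomorphisms commuting with `k₀`
  let A := Subalgebra.centralizer ℝ ({k₀} : Set B)
  have hmem : ∀ x : B, x * k₀ = k₀ * x → x ∈ A := by
    intro x hx
    rw [Subalgebra.mem_centralizer_iff]
    rintro _ rfl
    exact hx.symm
  have hmem' : ∀ x : A, (x : B) * k₀ = k₀ * x := fun x =>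
    ((Subalgebra.mem_centralizer_iff ℝ).1 x.2 k₀ rfl).symm
  have : CompleteSpace A := FiniteDimensional.complete ℝ A
  let I : A := ⟨k₀, hmem _ rfl⟩
  have hI2 : I * I = -1 := Subtype.ext hk₀2
  have hI : ∀ x : A, Commute I x := fun x => Subtype.ext (hmem' x).symm
  let val : A →L[ℝ] B := A.toSubmodule.subtypeL
  have hval : ∀ x : A, val x = x := fun x => rfl
  let pr : B →L[ℝ] A := LinearMap.toContinuousLinearMap
    { toFun := fun x => ⟨(1 / 2 : ℝ) • (x - k₀ * (x * k₀)), hmem _ (by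
        simp only [smul_mul_assoc, mul_smul_comm, sub_mul, mul_sub, mul_assoc, hk₀2, hk₀']
        simp [add_comm, sub_eq_add_neg])⟩
      map_add' := fun x z => Subtype.ext (by
        simp only [add_mul, mul_add, Subalgebra.coe_add, ← smul_add]
        congr 1; abel)
      map_smul' := fun c x => Subtype.ext (by
        simp only [smul_mul_assoc, mul_smul_comm, RingHom.id_apply, Subalgebra.coe_smul, ← smul_sub]
        rw [smul_comm]) }
  have hpr : ∀ x : B, x * k₀ = k₀ * x → (pr x : B) = x := by
    intro x hx
    change (1 / 2 : ℝ) • (x - k₀ * (x * k₀)) = x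
    rw [hx, hk₀', sub_neg_eq_add, ← two_smul ℝ x, smul_smul]
    norm_num
  let α' : V → V →L[ℝ] B := fun y => (1 / 2 : ℝ) • (β y +
    (ContinuousLinearMap.mul ℝ B k₀).comp ((β y).comp j))
  have hα'a : ∀ y u, α' y u = (1 / 2 : ℝ) • (β y u + k₀ * β y (j u)) := fun y u => rfl
  let α : V → V →L[ℝ] A := fun y => pr.comp (α' y)
  have hα's : ∀ᶠ y in 𝓝 y₀, ContDiffAt ℝ ∞ α' y := by
    filter_upwards [hβs] with y hy
    exact (hy.add (contDiffAt_const.clm_comp (hy.clm_comp contDiffAt_const))).const_smul _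
  have hαα' : ∀ᶠ y in 𝓝 y₀, ∀ u, (α y u : B) = α' y u := by
    filter_upwards [hβk] with y hy u
    refine hpr _ ?_
    change α' y u * k₀ = k₀ * α' y u
    simp only [hα'a, smul_mul_assoc, mul_smul_comm, add_mul, mul_add, mul_assoc, hy]
  have hαs : ∀ᶠ y in 𝓝 y₀, ContDiffAt ℝ ∞ α y := by
    filter_upwards [hα's] with y hy using contDiffAt_const.clm_comp hy
  have hαj : ∀ᶠ y in 𝓝 y₀, ∀ v, α y (j v) = -(I * α y v) := by
    filter_upwards [hαα'] with y hy v
    refine Subtype.ext ?_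
    change (α y (j v) : B) = -(k₀ * (α y v : B))
    rw [hy, hy, hα'a, hα'a, hj, map_neg, mul_smul_comm, mul_add, hk₀', ← smul_neg]
    congr 1; noncomm_ring
  have hflat : ∀ᶠ y in 𝓝 y₀, IsDbarFlatAt j I α y := by
    filter_upwards [hαα'.eventually_nhds, hαs, hα's, hβs, hβk, hβR] with y h1 h2 h3 h4 h5 h6 u v
    have hβd : DifferentiableAt ℝ β y := h4.differentiableAt (by simp)
    have hα'd : ∀ u v, fderiv ℝ α' y u v =
        (1 / 2 : ℝ) • (fderiv ℝ β y u v + k₀ * fderiv ℝ β y u (j v)) := by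
      intro u v
      have e1 : HasFDerivAt (fun y => α' y v) ((1 / 2 : ℝ) •
          (((ContinuousLinearMap.apply ℝ B v).comp (fderiv ℝ β y)) +
            (ContinuousLinearMap.mul ℝ B k₀).comp
              ((ContinuousLinearMap.apply ℝ B (j v)).comp (fderiv ℝ β y)))) y :=
        (((ContinuousLinearMap.apply ℝ B v).hasFDerivAt.comp y hβd.hasFDerivAt).add
          ((ContinuousLinearMap.mul ℝ B k₀).hasFDerivAt.comp y
            ((ContinuousLinearMap.apply ℝ B (j v)).hasFDerivAt.comp y
              hβd.hasFDerivAt))).const_smul _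
      rw [← fderiv_fun_apply_const (h3.differentiableAt (by simp)), e1.fderiv]
      rfl
    have hDα : ∀ u v, (fderiv ℝ (fun y => α y v) y u : B) = fderiv ℝ α' y u v := by
      intro u v
      have e1 : DifferentiableAt ℝ (fun y => α y v) y :=
        (h2.clm_apply contDiffAt_const).differentiableAt (by simp)
      have e2 := (val.hasFDerivAt.comp y e1.hasFDerivAt).fderiv
      have e3 : (val ∘ fun y => α y v) =ᶠ[𝓝 y] fun y => α' y v := by
        filter_upwards [h1] with z hz using hz v
      rw [e3.fderiv_eq] at e2
      rw [← fderiv_fun_apply_const (h3.differentiableAt (by simp)), e2]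
      rfl
    have h1y := h1.self_of_nhds
    have hb : ∀ u v, ((dbar j I (fun y => α y v) y u : A) : B) =
        (1 / 2 : ℝ) • (fderiv ℝ α' y u v + k₀ * fderiv ℝ α' y (j u) v) := by
      intro u v
      rw [← hDα, ← hDα]
      rfl
    refine Subtype.ext ?_
    have h6' := h6 u v
    have goal : (1 / 2 : ℝ) • (fderiv ℝ α' y u v + k₀ * fderiv ℝ α' y (j u) v) -
        (1 / 2 : ℝ) • (fderiv ℝ α' y v u + k₀ * fderiv ℝ α' y (j v) u) +
        (α' y u * α' y v - α' y v * α' y u) = 0 := by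
      have hkl : ∀ (u v : V), β y u * (k₀ * β y v) = k₀ * (β y u * β y v) := by
        intro u v; rw [← mul_assoc, h5, mul_assoc]
      have e : (1 / 2 : ℝ) • (fderiv ℝ α' y u v + k₀ * fderiv ℝ α' y (j u) v) -
          (1 / 2 : ℝ) • (fderiv ℝ α' y v u + k₀ * fderiv ℝ α' y (j v) u) +
          (α' y u * α' y v - α' y v * α' y u) =
          (1 / 4 : ℝ) • formCurvatureAntilinear j (fun _ => k₀) β y u v := by
        simp only [formCurvatureAntilinear, formCurvature, hα'd, hα'a, smul_mul_assoc,
          mul_smul_comm, mul_add, add_mul, mul_sub, mul_assoc, hkl, hk₀']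
        module
      rw [e, h6', smul_zero]
    rw [← hb, ← hb, ← h1y, ← h1y] at goal
    exact goal
  obtain ⟨h, hh, hhu, hsol⟩ := exists_dbar_eq_mul hj hI2 hI hαs hαj hflat
  let h' : V → B := fun y => h y
  have hh' : ContDiff ℝ ∞ h' := val.contDiff.comp hh
  have hDh : ∀ y u, fderiv ℝ h' y u = (fderiv ℝ h y u : B) := by
    intro y u
    have := (val.hasFDerivAt.comp y (hh.differentiable (by simp) y).hasFDerivAt).fderiv
    change fderiv ℝ h' y = _ at this
    rw [this]
    rfl
  have hh'u : IsUnit (h' y₀) := hhu.map A.val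
  refine ⟨fun y => h' y * g₁ y, ?_, by simpa only [hg₁0, mul_one] using hh'u, ?_⟩
  · filter_upwards [hg₁] with y hy using hh'.contDiffAt.mul hy
  filter_upwards [hsol, hαα', hg₁, hg₁u, hg₁k] with y h1 h2 h3 h4 h5
  refine ⟨?_, fun u => ?_⟩
  · rw [mul_assoc, ← h5, ← mul_assoc, hmem' (h y), mul_assoc]
  · have hgd : DifferentiableAt ℝ g₁ y := h3.differentiableAt (by simp)
    have hhd : DifferentiableAt ℝ h' y := hh'.differentiable (by simp) y
    have e1 : ∀ u, fderiv ℝ (fun y => h' y * g₁ y) y u - h' y * g₁ y * γ y u =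
        (fderiv ℝ h' y u - h' y * β y u) * g₁ y := by
      intro u
      rw [fderiv_fun_mul_apply hhd hgd, sub_mul, mul_assoc _ (β y u), connectionGauge_mul h4]
      noncomm_ring
    have e2 := congrArg (fun x : A => (x : B)) (h1 u)
    change (1 / 2 : ℝ) • ((fderiv ℝ h y u : B) + k₀ * (fderiv ℝ h y (j u) : B)) =
      h' y * (α y u : B) at e2
    rw [h2, hα'a, ← hDh, ← hDh, mul_smul_comm] at e2
    have e3 := smul_right_injective B (by norm_num : (1 / 2 : ℝ) ≠ 0) e2
    have e4 : h' y * k₀ = k₀ * h' y := hmem' (h y)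
    rw [mul_add, ← mul_assoc, e4] at e3
    rw [e1, e1, ← mul_assoc]
    congr 1
    have e5 : fderiv ℝ h' y u - h' y * β y u =
        -(k₀ * (fderiv ℝ h' y (j u) - h' y * β y (j u))) := by
      rw [mul_sub, neg_sub, ← mul_assoc, sub_eq_sub_iff_add_eq_add, e3, add_comm]
    rw [e5, mul_neg, hk₀', neg_neg]

end ConnectionForms

/-! ### Curvature along a slice and the Nijenhuis tensor of the normal bundle -/

section SliceCurvature

variable {E' F : Type*} [NormedAddCommGroup E'] [NormedSpace ℝ E']
  [NormedAddCommGroup F] [NormedSpace ℝ F]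
  {J : E' × F → E' × F →L[ℝ] E' × F} {Γ : E' × F → E' × F →L[ℝ] E' × F →L[ℝ] E' × F} {y : E'}

theorem snd_symbol_slice (hs : ∀ u u', (Γ (y, 0) (u, 0) (u', 0)).2 = 0) (u : E') (v : E' × F) :
    (Γ (y, 0) (u, 0) v).2 = normalSymbol Γ y u v.2 := by
  have : v = (v.1, 0) + (0, v.2) := by simp
  conv_lhs => rw [this, map_add]
  rw [Prod.snd_add, hs, zero_add, normalSymbol_apply]

/-- Derivatives along the slice of functions on the ambient space. -/
theorem fderiv_comp_slice {W W' : Type*} [NormedAddCommGroup W] [NormedSpace ℝ W]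
    [NormedAddCommGroup W'] [NormedSpace ℝ W'] {f : E' × F → W} (hf : DifferentiableAt ℝ f (y, 0))
    (A : W →L[ℝ] W') {g : E' → W'} (hg : ∀ᶠ y' in 𝓝 y, A (f (y', 0)) = g y') (u : E') :
    fderiv ℝ g y u = A (fderiv ℝ f (y, 0) (u, 0)) := by
  have h1 : HasFDerivAt (fun y' : E' => A (f (y', 0)))
      (A.comp ((fderiv ℝ f (y, 0)).comp (ContinuousLinearMap.inl ℝ E' F))) y :=
    A.hasFDerivAt.comp y (hf.hasFDerivAt.comp y
      ((ContinuousLinearMap.inl ℝ E' F).hasFDerivAt (x := y)))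
  have h2 : (fun y' : E' => A (f (y', 0))) =ᶠ[𝓝 y] g := hg
  rw [← h2.fderiv_eq, h1.fderiv]
  rfl

set_option synthInstance.maxHeartbeats 200000 in
/-- The Gauss equation: for a connection which leaves the slice totally geodesic, the normal
component of the curvature along the slice is the curvature of the induced connection. -/
theorem snd_curvatureSymbol (hΓ : ContDiffAt ℝ ∞ Γ (y, 0))
    (hs : ∀ᶠ y' in 𝓝 y, ∀ u u', (Γ (y', 0) (u, 0) (u', 0)).2 = 0) (u u' : E') (v : E' × F) :
    (curvatureSymbol Γ (y, 0) (u, 0) (u', 0) v).2 = formCurvature (normalSymbol Γ) y u u' v.2 := by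
  have hγ : DifferentiableAt ℝ (normalSymbol Γ) y :=
    (contDiffAt_normalSymbol hΓ).differentiableAt (by simp)
  have hd : ∀ u u', (fderiv ℝ Γ (y, 0) (u, 0) (u', 0) v).2 =
      fderiv ℝ (normalSymbol Γ) y u u' v.2 := by
    intro u u'
    have h1 := fderiv_comp_slice (hΓ.differentiableAt (by simp))
      (((ContinuousLinearMap.snd ℝ E' F).comp (ContinuousLinearMap.apply ℝ (E' × F) v)).comp
        (ContinuousLinearMap.apply ℝ (E' × F →L[ℝ] E' × F) ((u', 0) : E' × F)))
      (g := fun y => normalSymbol Γ y u' v.2)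
      (by filter_upwards [hs] with y' hy' using snd_symbol_slice hy' u' v) u
    rw [fderiv_fun_apply_const (f := fun y => normalSymbol Γ y u')
      (hγ.clm_apply (differentiableAt_const u')),
      fderiv_fun_apply_const hγ] at h1
    exact h1.symm
  have hsy := hs.self_of_nhds
  simp only [curvatureSymbol, Prod.snd_add, Prod.snd_sub, hd, snd_symbol_slice hsy]
  simp only [formCurvature, add_apply, sub_apply, mul_apply_eq_comp]
  abel

set_option synthInstance.maxHeartbeats 200000 in
theorem curvatureSymbol_eq_zero_of_slice (hΓ : DifferentiableAt ℝ Γ (y, 0))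
    (hs : ∀ᶠ y' in 𝓝 y, ∀ u u', Γ (y', 0) (u, 0) (u', 0) = 0) (u u' u'' : E') :
    curvatureSymbol Γ (y, 0) (u, 0) (u', 0) (u'', 0) = 0 := by
  have hd : ∀ u u' u'' : E', fderiv ℝ Γ (y, 0) (u, 0) (u', 0) (u'', 0) = 0 := by
    intro u u' u''
    have hd1 : DifferentiableAt ℝ (fun z => Γ z (u', 0)) (y, 0) :=
      hΓ.clm_apply (differentiableAt_const _)
    have h1 := fderiv_comp_slice (hd1.clm_apply (differentiableAt_const ((u'', 0) : E' × F)))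
      (ContinuousLinearMap.id ℝ (E' × F)) (g := fun _ => (0 : E' × F))
      (by filter_upwards [hs] with y' hy' using hy' u' u'') u
    rw [fderiv_fun_const, ContinuousLinearMap.id_apply, fderiv_fun_apply_const hd1,
      fderiv_fun_apply_const hΓ] at h1
    exact h1.symm
  have hsy := hs.self_of_nhds
  rw [curvatureSymbol, hd, hd, hsy, hsy, map_zero, map_zero, sub_self, add_zero, sub_zero]

theorem fderiv_normalPart (hJ : DifferentiableAt ℝ J (y, 0)) (h : PreservesSlice J y)
    (hΓ : IsMinimalSymbolAt J (Γ (y, 0)) (y, 0))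
    (hs : ∀ u u', (Γ (y, 0) (u, 0) (u', 0)).2 = 0) (u : E') :
    fderiv ℝ (normalPart J) y u =
      normalPart J y * normalSymbol Γ y u - normalSymbol Γ y u * normalPart J y := by
  refine ContinuousLinearMap.ext fun w => ?_
  have h1 := congrArg Prod.snd (hΓ.parallel (u, 0) (0, w))
  rw [Prod.snd_add, snd_symbol_slice hs, h.snd_apply, h.snd_apply] at h1
  have h2 := fderiv_comp_slice hJ
    ((ContinuousLinearMap.compL ℝ F (E' × F) F (ContinuousLinearMap.snd ℝ E' F)).comp
      ((ContinuousLinearMap.compL ℝ F (E' × F) (E' × F)).flip (ContinuousLinearMap.inr ℝ E' F)))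
    (g := normalPart J) (Filter.Eventually.of_forall fun _ => rfl) u
  have h3 : fderiv ℝ (normalPart J) y u w = (fderiv ℝ J (y, 0) (u, 0) (0, w)).2 := by
    rw [h2]; rfl
  rw [h3, eq_sub_of_add_eq h1]
  rfl

variable {j : E' → E' →L[ℝ] E'} {C : E' → E' →L[ℝ] F →L[ℝ] F} {k : E' → F →L[ℝ] F}
  {γ : E' → E' →L[ℝ] F →L[ℝ] F}

set_option synthInstance.maxHeartbeats 200000 in
theorem fderiv_splitMatrix_const (j₀ : E' →L[ℝ] E') {z : E' × F}
    (hC : ContDiffAt ℝ ∞ C z.1) (hk : ContDiffAt ℝ ∞ k z.1) (X Y : E' × F) :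
    fderiv ℝ (splitMatrix (fun _ => j₀) C k) z X Y =
      (0, fderiv ℝ k z.1 X.1 Y.2 + (fderiv ℝ C z.1 X.1 Y.1 z.2 + C z.1 Y.1 X.2)) := by
  have hd : DifferentiableAt ℝ (splitMatrix (fun _ => j₀) C k) z :=
    (contDiffAt_splitMatrix contDiffAt_const hC hk).differentiableAt (by simp)
  have hC' : HasFDerivAt (fun z : E' × F => C z.1 Y.1) _ z :=
    HasFDerivAt.comp (g := fun y => C y Y.1) z
      ((hC.differentiableAt (by simp)).hasFDerivAt.clm_apply (hasFDerivAt_const Y.1 z.1))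
      hasFDerivAt_fst
  have hk' : HasFDerivAt (fun z : E' × F => k z.1 Y.2) _ z :=
    HasFDerivAt.comp (g := fun y => k y Y.2) z
      ((hk.differentiableAt (by simp)).hasFDerivAt.clm_apply (hasFDerivAt_const Y.2 z.1))
      hasFDerivAt_fst
  have h1 : HasFDerivAt (fun z : E' × F => splitMatrix (fun _ => j₀) C k z Y) _ z :=
    (hasFDerivAt_const (j₀ Y.1) z).prodMk (hk'.add (hC'.clm_apply hasFDerivAt_snd))
  rw [← fderiv_fun_apply_const hd, h1.fderiv]
  ext
  · simp
  · simp [add_comm]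

set_option synthInstance.maxHeartbeats 200000 in
theorem fderiv_normalTwist_const (j₀ : E' →L[ℝ] E') (hk : ContDiffAt ℝ ∞ k y)
    (hγ : ContDiffAt ℝ ∞ γ y) (a u : E') (w : F) :
    fderiv ℝ (normalTwist (fun _ => j₀) k γ) y a u w =
      fderiv ℝ k y a (γ y u w) + k y (fderiv ℝ γ y a u w) - fderiv ℝ γ y a (j₀ u) w := by
  have hd : DifferentiableAt ℝ (normalTwist (fun _ => j₀) k γ) y :=
    (contDiffAt_normalTwist contDiffAt_const hk hγ).differentiableAt (by simp)
  have hkd := hk.differentiableAt (n := ∞) (by simp)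
  have hγd := hγ.differentiableAt (n := ∞) (by simp)
  have happ : ∀ u, DifferentiableAt ℝ (fun y => γ y u w) y := fun u =>
    (hγd.clm_apply (differentiableAt_const u)).clm_apply (differentiableAt_const w)
  rw [← fderiv_fun_apply_const hd, ← 
    fderiv_fun_apply_const (f := fun y => normalTwist (fun _ => j₀) k γ y u)
      (hd.clm_apply (differentiableAt_const u))]
  have hev : ∀ u, fderiv ℝ (fun y => γ y u w) y a = fderiv ℝ γ y a u w := fun u => by
    rw [fderiv_fun_apply_const (f := fun y => γ y u) (hγd.clm_apply (differentiableAt_const u)),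
      fderiv_fun_apply_const hγd]
  change fderiv ℝ (fun y => k y (γ y u w) - γ y (j₀ u) w) y a = _
  rw [fderiv_fun_sub (f := fun y => k y (γ y u w)) (hkd.clm_apply (happ u)) (happ _),
    fderiv_clm_apply hkd (happ u)]
  simp only [sub_apply, add_apply, ContinuousLinearMap.comp_apply,
    ContinuousLinearMap.flip_apply, hev]
  abel

/-- The vertical component of the Nijenhuis tensor of the structure on the normal bundle, on the
coordinate vectors `(u, 0)` and `(u', 0)`, is the antilinear part of the curvature of the induced
connection. The hypothesis `hpar` says that `k` is parallel. -/
theorem snd_nijenhuisSymbol_splitMatrix {j₀ : E' →L[ℝ] E'}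
    (hk : ContDiffAt ℝ ∞ k y) (hγ : ContDiffAt ℝ ∞ γ y) (hk2 : ∀ w, k y (k y w) = -w)
    (hpar : ∀ u, fderiv ℝ k y u = k y * γ y u - γ y u * k y) (w : F) (u u' : E') :
    (nijenhuisSymbol (splitMatrix (fun _ => j₀) (normalTwist (fun _ => j₀) k γ) k) (y, w)
      (u, 0) (u', 0)).2 = formCurvatureAntilinear j₀ k γ y u u' w := by
  have hC := contDiffAt_normalTwist (j := fun _ => j₀) contDiffAt_const hk hγ
  have hpar' : ∀ u w, fderiv ℝ k y u w = k y (γ y u w) - γ y u (k y w) := fun u w => by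
    rw [hpar]; rfl
  simp only [nijenhuisSymbol, fderiv_splitMatrix_const j₀ (z := (y, w)) hC hk, splitMatrix_apply,
    fderiv_normalTwist_const j₀ hk hγ, normalTwist_apply, map_zero, zero_add, hpar',
    Prod.snd_add, Prod.snd_sub, add_zero, map_add, map_sub, hk2, zero_apply]
  simp only [formCurvatureAntilinear, formCurvature, add_apply, sub_apply,
    map_add, map_sub, mul_apply_eq_comp]
  abel

end SliceCurvature

/-! ### Holomorphic coordinates -/

section HolomorphicCoordinates

variable {V W : Type*} [NormedAddCommGroup V] [NormedSpace ℝ V]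
  [NormedAddCommGroup W] [NormedSpace ℝ W]

theorem Filter.EventuallyEq.nijenhuisSymbol_eq {K K' : V → V →L[ℝ] V} {z : V} (h : K =ᶠ[𝓝 z] K')
    (X Y : V) : nijenhuisSymbol K z X Y = nijenhuisSymbol K' z X Y := by
  simp only [nijenhuisSymbol, h.fderiv_eq, h.self_of_nhds]

/-- The Nijenhuis tensor of an integrable structure vanishes. -/
theorem nijenhuisSymbol_eq_zero {K : V → V →L[ℝ] V} {z : V} {G : V → W} {J₀ : W →L[ℝ] W}
    (hK : DifferentiableAt ℝ K z) (hG : ContDiffAt ℝ ∞ G z)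
    (hinj : Function.Injective (fderiv ℝ G z))
    (hGK : ∀ᶠ z' in 𝓝 z, ∀ v, fderiv ℝ G z' (K z' v) = J₀ (fderiv ℝ G z' v)) (X Y : V) :
    nijenhuisSymbol K z X Y = 0 := by
  have hD : DifferentiableAt ℝ (fderiv ℝ G) z :=
    (hG.fderiv_right (m := ∞) (by simp)).differentiableAt (by simp)
  have hsymm : ∀ u v, fderiv ℝ (fderiv ℝ G) z u v = fderiv ℝ (fderiv ℝ G) z v u :=
    (hG.isSymmSndFDerivAt (by simpa using ENat.LEInfty.out)).eq
  have h1 : ∀ u v, fderiv ℝ G z (fderiv ℝ K z u v) =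
      J₀ (fderiv ℝ (fderiv ℝ G) z u v) - fderiv ℝ (fderiv ℝ G) z u (K z v) := by
    intro u v
    have h2 : (fun z' => (fderiv ℝ G z').comp (K z')) =ᶠ[𝓝 z] fun z' => J₀.comp (fderiv ℝ G z') := by
      filter_upwards [hGK] with z' hz' using ContinuousLinearMap.ext hz'
    have h3 := congrArg (fun A : V →L[ℝ] V →L[ℝ] W => A u v) (h2.fderiv_eq (𝕜 := ℝ))
    rw [fderiv_clm_comp hD hK, fderiv_clm_comp (differentiableAt_const _) hD] at h3
    simp only [fderiv_fun_const] at h3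
    simp at h3
    rw [← h3]
    abel
  apply hinj
  rw [map_zero]
  simp only [nijenhuisSymbol, map_add, map_sub, hGK.self_of_nhds, h1]
  rw [hsymm (K z X) (K z Y), hsymm (K z X) Y, hsymm (K z Y) X, hsymm X Y]
  abel

/-- The inverse function theorem, with control on the domain. -/
theorem exists_isSmoothCoord_of_injective_fderiv [FiniteDimensional ℝ V] {f : V → V} {z : V}
    (hf : ∀ᶠ z' in 𝓝 z, ContDiffAt ℝ ∞ f z') (hinj : Function.Injective (fderiv ℝ f z))
    {p : V → Prop} (hp : ∀ᶠ z' in 𝓝 z, p z') :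
    ∃ θ : OpenPartialHomeomorph V V, IsSmoothCoord 𝓘(ℝ, V) θ ∧ z ∈ θ.source ∧ (θ : V → V) = f ∧
      ∀ z' ∈ θ.source, p z' := by
  have : CompleteSpace V := FiniteDimensional.complete ℝ V
  have hfz := hf.self_of_nhds
  let A : V ≃L[ℝ] V := (LinearEquiv.ofInjectiveEndo (fderiv ℝ f z).toLinearMap
    hinj).toContinuousLinearEquiv
  have hA : (A : V →L[ℝ] V) = fderiv ℝ f z := rfl
  have hA' : HasFDerivAt f (A : V →L[ℝ] V) z := (hfz.differentiableAt (by simp)).hasFDerivAt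
  have hinv : ∀ᶠ z' in 𝓝 z, fderiv ℝ f z' ∈ range ((↑) : (V ≃L[ℝ] V) → V →L[ℝ] V) :=
    (hfz.fderiv_right (m := ∞) (by simp)).continuousAt.eventually
      (by rw [← hA]; exact ContinuousLinearEquiv.nhds A)
  obtain ⟨s, hs, hso, hzs⟩ := eventually_nhds_iff.1 (hf.and (hinv.and hp))
  let θ := hfz.toOpenPartialHomeomorph f hA' (by simp)
  have hθz : z ∈ θ.source := hfz.mem_toOpenPartialHomeomorph_source hA' (by simp)
  refine ⟨θ.restrOpen s hso, ?_, ⟨hθz, hzs⟩, rfl, fun z' hz' => (hs z' hz'.2).2.2⟩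
  rw [isSmoothCoord_iff_contDiffOn]
  refine ⟨fun z' hz' => (hs z' hz'.2).1.contDiffWithinAt, fun y hy => ?_⟩
  have hy' := (θ.restrOpen s hso).map_target hy
  obtain ⟨h1, ⟨B, hB⟩, -⟩ := hs _ hy'.2
  refine ((θ.restrOpen s hso).contDiffAt_symm hy (f₀' := B) ?_ h1).contDiffWithinAt
  rw [hB]
  exact (h1.differentiableAt (by simp)).hasFDerivAt

variable {E : Type*} [NormedAddCommGroup E] [NormedSpace ℝ E]
  {H : Type*} [TopologicalSpace H] {I : ModelWithCorners ℝ E H}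
  {M : Type*} [TopologicalSpace M] [ChartedSpace H M] {K : EndField I M}

theorem IsSmoothCoord.coordDeriv_trans {Ψ : OpenPartialHomeomorph M V} (h : IsSmoothCoord I Ψ)
    {θ : OpenPartialHomeomorph V W} (hθ : IsSmoothCoord 𝓘(ℝ, V) θ) {x : M} (hx : x ∈ Ψ.source)
    (hx' : Ψ x ∈ θ.source) (v : TangentSpace I x) :
    coordDeriv I (Ψ.trans θ) x v = fderiv ℝ θ (Ψ x) (coordDeriv I Ψ x v) := by
  have h1 : mfderiv I 𝓘(ℝ, W) (θ ∘ Ψ) x =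
      (mfderiv 𝓘(ℝ, V) 𝓘(ℝ, W) θ (Ψ x)).comp (mfderiv I 𝓘(ℝ, V) Ψ x) :=
    mfderiv_comp x (hθ.mdifferentiableAt hx') (h.mdifferentiableAt hx)
  rw [mfderiv_eq_fderiv] at h1
  exact DFunLike.congr_fun h1 v

variable (K) in
/-- `Ψ` are holomorphic coordinates for `K`: in these coordinates `K` is the constant complex
structure `J₀`. -/
structure IsHolomorphicCoord (J₀ : V →L[ℝ] V) (Ψ : OpenPartialHomeomorph M V) : Prop where
  coord : IsSmoothCoord I Ψ
  sq : ∀ w, J₀ (J₀ w) = -w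
  map_apply : ∀ y ∈ Ψ.source, ∀ v : TangentSpace I y,
    coordDeriv I Ψ y (K y v) = J₀ (coordDeriv I Ψ y v)

theorem isIntegrable_iff [IsManifold I ∞ M] [I.Boundaryless] :
    IsIntegrable K ↔ ∀ x : M, ∃ (Ψ : OpenPartialHomeomorph M E) (J₀ : E →L[ℝ] E),
      x ∈ Ψ.source ∧ IsHolomorphicCoord K J₀ Ψ := by
  constructor
  · intro h x
    obtain ⟨e, he, hx, J₀, hsq, hJ₀⟩ := h x
    exact ⟨e.trans I.toHomeomorph.toOpenPartialHomeomorph, J₀, by simpa using hx,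
      isSmoothCoord_iff_mem_maximalAtlas.2 he, hsq, fun y hy => hJ₀ y (by simpa using hy)⟩
  · intro h x
    obtain ⟨Ψ, J₀, hx, hΨ⟩ := h x
    let e := Ψ.trans I.toHomeomorph.symm.toOpenPartialHomeomorph
    have he : e.trans I.toHomeomorph.toOpenPartialHomeomorph = Ψ := by
      rw [OpenPartialHomeomorph.trans_assoc, ← Homeomorph.trans_toOpenPartialHomeomorph,
        Homeomorph.symm_trans_self, Homeomorph.refl_toOpenPartialHomeomorph,
        OpenPartialHomeomorph.trans_refl]
    have hcoe : (e.extend I : M → E) = Ψ := by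
      conv_rhs => rw [← he]
      rfl
    have hsrc : e.source = Ψ.source := by simp [e]
    refine ⟨e, isSmoothCoord_iff_mem_maximalAtlas.1 (by rw [he]; exact hΨ.coord), by rwa [hsrc],
      J₀, hΨ.sq, fun y hy v => ?_⟩
    rw [hsrc] at hy
    rw [hcoe]
    exact hΨ.map_apply y hy v

theorem exists_isHolomorphicCoord [FiniteDimensional ℝ V] {Ψ : OpenPartialHomeomorph M V}
    (h : IsSmoothCoord I Ψ) {x : M} (hx : x ∈ Ψ.source) {f : V → V} {J₀ : V →L[ℝ] V}
    (hJ₀ : ∀ w, J₀ (J₀ w) = -w) (hf : ∀ᶠ z in 𝓝 (Ψ x), ContDiffAt ℝ ∞ f z)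
    (hinj : Function.Injective (fderiv ℝ f (Ψ x)))
    (hfK : ∀ᶠ z in 𝓝 (Ψ x), ∀ v, fderiv ℝ f z (coordEnd I Ψ K z v) = J₀ (fderiv ℝ f z v)) :
    ∃ Ψ' : OpenPartialHomeomorph M V, x ∈ Ψ'.source ∧ IsHolomorphicCoord K J₀ Ψ' := by
  obtain ⟨θ, hθ, hzθ, rfl, hp⟩ := exists_isSmoothCoord_of_injective_fderiv hf hinj hfK
  refine ⟨Ψ.trans θ, ⟨hx, hzθ⟩, h.trans hθ, hJ₀, fun y hy v => ?_⟩
  rw [h.coordDeriv_trans hθ hy.1 hy.2, h.coordDeriv_trans hθ hy.1 hy.2, ← h.coordEnd_apply hy.1,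
    hp (Ψ y) hy.2]

/-- Holomorphic coordinates as a map of the model vector space, in other coordinates. -/
theorem IsHolomorphicCoord.fderiv_change {χ : OpenPartialHomeomorph M W} {J₀ : W →L[ℝ] W}
    (hχ : IsHolomorphicCoord K J₀ χ) {Ψ : OpenPartialHomeomorph M V} (h : IsSmoothCoord I Ψ)
    {z : V} (hz : z ∈ (Ψ.symm.trans χ).source) :
    Function.Injective (fderiv ℝ (χ ∘ Ψ.symm) z) ∧
      ∀ v, fderiv ℝ (χ ∘ Ψ.symm) z (coordEnd I Ψ K z v) = J₀ (fderiv ℝ (χ ∘ Ψ.symm) z v) := by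
  have hz' : z ∈ Ψ.target := hz.1
  have hs := Ψ.map_target hz'
  have hχs : Ψ.symm z ∈ χ.source := hz.2
  rw [← h.coordDeriv_coordInv_change hχ.coord hz]
  refine ⟨fun a b hab => ?_, fun v => ?_⟩
  · have := hχ.coord.coordDeriv_injective hχs hab
    have := congrArg (coordDeriv I Ψ (Ψ.symm z)) this
    exact (h.coordDeriv_coordInv hs a).symm.trans (this.trans (h.coordDeriv_coordInv hs b))
  · change coordDeriv I χ (Ψ.symm z) (coordInv I Ψ (Ψ.symm z) (coordDeriv I Ψ (Ψ.symm z)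
      (K (Ψ.symm z) (coordInv I Ψ (Ψ.symm z) v)))) = _
    rw [h.coordInv_coordDeriv hs, hχ.map_apply _ hχs]
    rfl

end HolomorphicCoordinates

/-! ### Holomorphic coordinates of the normal bundle from a holomorphic frame -/

section FrameCoordinates

variable {E' F : Type*} [NormedAddCommGroup E'] [NormedSpace ℝ E']
  [NormedAddCommGroup F] [NormedSpace ℝ F]

theorem fderiv_frame {g : E' → F →L[ℝ] F} {z : E' × F} (hg : DifferentiableAt ℝ g z.1) :
    DifferentiableAt ℝ (fun z : E' × F => (z.1, g z.1 z.2)) z ∧ ∀ v : E' × F,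
      fderiv ℝ (fun z : E' × F => (z.1, g z.1 z.2)) z v =
        (v.1, fderiv ℝ g z.1 v.1 z.2 + g z.1 v.2) := by
  have h1 : HasFDerivAt (fun z : E' × F => g z.1) _ z :=
    HasFDerivAt.comp (g := g) z hg.hasFDerivAt hasFDerivAt_fst
  have h2 : HasFDerivAt (fun z : E' × F => (z.1, g z.1 z.2)) _ z :=
    hasFDerivAt_fst.prodMk (h1.clm_apply hasFDerivAt_snd)
  refine ⟨h2.differentiableAt, fun v => ?_⟩
  rw [h2.fderiv]
  ext
  · simp
  · simp [add_comm]

/-- Over a base with constant complex structure `j₀`, the total space of a complex vector bundle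
with connection `γ` whose curvature has no antilinear part has holomorphic coordinates near every
point: the fibre coordinates in a holomorphic frame. -/
theorem exists_holomorphic_splitMatrix [FiniteDimensional ℝ E'] [FiniteDimensional ℝ F]
    {j₀ : E' →L[ℝ] E'} (hj : ∀ v, j₀ (j₀ v) = -v) {k : E' → F →L[ℝ] F}
    {γ : E' → E' →L[ℝ] F →L[ℝ] F} {z₀ : E' × F}
    (hk : ∀ᶠ y in 𝓝 z₀.1, ContDiffAt ℝ ∞ k y) (hγ : ∀ᶠ y in 𝓝 z₀.1, ContDiffAt ℝ ∞ γ y)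
    (hk2 : ∀ᶠ y in 𝓝 z₀.1, ∀ w, k y (k y w) = -w)
    (hpar : ∀ᶠ y in 𝓝 z₀.1, ∀ u, fderiv ℝ k y u = k y * γ y u - γ y u * k y)
    (hR : ∀ᶠ y in 𝓝 z₀.1, ∀ u v, formCurvatureAntilinear j₀ k γ y u v = 0) :
    ∃ (f : E' × F → E' × F) (J₀ : E' × F →L[ℝ] E' × F), (∀ v, J₀ (J₀ v) = -v) ∧
      (∀ᶠ z in 𝓝 z₀, ContDiffAt ℝ ∞ f z) ∧ Function.Injective (fderiv ℝ f z₀) ∧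
      ∀ᶠ z in 𝓝 z₀, ∀ v,
        fderiv ℝ f z (splitMatrix (fun _ => j₀) (normalTwist (fun _ => j₀) k γ) k z v) =
          J₀ (fderiv ℝ f z v) := by
  have hk2' : ∀ᶠ y in 𝓝 z₀.1, k y * k y = -1 := by
    filter_upwards [hk2] with y hy using ContinuousLinearMap.ext hy
  obtain ⟨g, hg, hgu, hgk⟩ := exists_holomorphic_frame hj hk hγ hk2' hpar hR
  have hfst : Filter.Tendsto (Prod.fst : E' × F → E') (𝓝 z₀) (𝓝 z₀.1) := continuousAt_fst
  have hd : ∀ {y : E'}, ContDiffAt ℝ ∞ g y → DifferentiableAt ℝ g y :=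
    fun h => h.differentiableAt (by simp)
  refine ⟨fun z => (z.1, g z.1 z.2), j₀.prodMap (k z₀.1), fun v => ?_, ?_, ?_, ?_⟩
  · ext
    · simp [hj]
    · simp [hk2.self_of_nhds]
  · filter_upwards [hfst.eventually hg] with z hz
    exact contDiffAt_fst.prodMk ((hz.comp z contDiffAt_fst).clm_apply contDiffAt_snd)
  · refine (injective_iff_map_eq_zero _).2 fun v hv => ?_
    rw [(fderiv_frame (hd hg.self_of_nhds)).2 v] at hv
    have hv1 : v.1 = 0 := congrArg Prod.fst hv
    have hv2 := congrArg Prod.snd hv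
    simp only [hv1, map_zero, zero_apply, zero_add, Prod.snd_zero] at hv2
    obtain ⟨G, hG⟩ := hgu
    have hv3 : v.2 = (↑G⁻¹ : F →L[ℝ] F) (g z₀.1 v.2) := by
      rw [← hG, ← mul_apply_eq_comp, Units.inv_mul]
      rfl
    rw [hv2, map_zero] at hv3
    exact Prod.ext hv1 hv3
  · filter_upwards [hfst.eventually hg, hfst.eventually hgk] with z h1 h2 v
    obtain ⟨h3, h4⟩ := h2
    rw [(fderiv_frame (hd h1)).2, (fderiv_frame (hd h1)).2, splitMatrix_apply]
    have h5 : ∀ w, g z.1 (k z.1 w) = k z₀.1 (g z.1 w) := fun w => DFunLike.congr_fun h3 w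
    have h6 : fderiv ℝ g z.1 (j₀ v.1) z.2 - g z.1 (γ z.1 (j₀ v.1) z.2) =
        k z₀.1 (fderiv ℝ g z.1 v.1 z.2 - g z.1 (γ z.1 v.1 z.2)) :=
      DFunLike.congr_fun (h4 v.1) z.2
    refine Prod.ext rfl ?_
    change fderiv ℝ g z.1 (j₀ v.1) z.2 + g z.1 (k z.1 v.2 + normalTwist (fun _ => j₀) k γ z.1 v.1 z.2)
      = k z₀.1 (fderiv ℝ g z.1 v.1 z.2 + g z.1 v.2)
    rw [normalTwist_apply, map_add, map_sub, h5, h5, eq_add_of_sub_eq h6, map_sub, map_add]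
    abel

end FrameCoordinates

/-! ### Integrability of the structure of the normal bundle -/

section Integrability

variable {E E' F : Type*} [NormedAddCommGroup E] [NormedSpace ℝ E] [FiniteDimensional ℝ E]
  [NormedAddCommGroup E'] [NormedSpace ℝ E'] [FiniteDimensional ℝ E']
  [NormedAddCommGroup F] [NormedSpace ℝ F] [FiniteDimensional ℝ F]
  {M : Type*} [TopologicalSpace M] [ChartedSpace E M] [IsManifold 𝓘(ℝ, E) ∞ M]
  {L : Type*} [TopologicalSpace L] [ChartedSpace E' L] [IsManifold 𝓘(ℝ, E') ∞ L]
  {ι : L → M} {hι : IsImmersionOfComplement F 𝓘(ℝ, E') 𝓘(ℝ, E) ∞ ι}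
  {J : EndField 𝓘(ℝ, E) M}
  {p : L} {φ : OpenPartialHomeomorph L E'} {Ψ : OpenPartialHomeomorph M (E' × F)}

theorem IsHolomorphicCoord.restrOpen {K : EndField 𝓘(ℝ, E') L} {j₀ : E' →L[ℝ] E'}
    (h : IsHolomorphicCoord K j₀ φ) {s : Set L} (hs : IsOpen s) :
    IsHolomorphicCoord K j₀ (φ.restrOpen s hs) where
  coord := h.coord.restrOpen hs
  sq := h.sq
  map_apply y hy v := h.map_apply y hy.1 v

namespace IsSliceCoord

theorem coordEnd_restrictedStructure (h : IsSliceCoord hι p φ Ψ)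
    (hPH : ∀ x : L, ∀ v ∈ tangentImage (E := E) (E' := E') ι x,
      J (ι x) v ∈ tangentImage (E := E) (E' := E') ι x) {y : E'} (hy : y ∈ φ.target) :
    coordEnd 𝓘(ℝ, E') φ (restrictedStructure J ι) y =
      tangentialPart (coordEnd 𝓘(ℝ, E) Ψ J) y := by
  have hs := φ.map_target hy
  refine ContinuousLinearMap.ext fun u => ?_
  have h1 := h.coordDeriv_restrictedStructure hs hPH (coordInv 𝓘(ℝ, E') φ (φ.symm y) u)
  rwa [h.coordL.coordDeriv_coordInv hs, φ.right_inv hy] at h1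

theorem tangentialPart_eq_const (h : IsSliceCoord hι p φ Ψ)
    (hPH : ∀ x : L, ∀ v ∈ tangentImage (E := E) (E' := E') ι x,
      J (ι x) v ∈ tangentImage (E := E) (E' := E') ι x) {j₀ : E' →L[ℝ] E'}
    (hφ : IsHolomorphicCoord (restrictedStructure J ι : EndField 𝓘(ℝ, E') L) j₀ φ) {y : E'}
    (hy : y ∈ φ.target) : tangentialPart (coordEnd 𝓘(ℝ, E) Ψ J) y = j₀ := by
  have hs := φ.map_target hy
  rw [← h.coordEnd_restrictedStructure hPH hy]
  refine ContinuousLinearMap.ext fun u => ?_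
  have h1 := hφ.map_apply _ hs (coordInv 𝓘(ℝ, E') φ (φ.symm y) u)
  rwa [h.coordL.coordDeriv_coordInv hs] at h1

/-- The normal component of the antilinear part of the curvature along the submanifold. -/
theorem snd_coordDeriv_curvatureAntilinear (h : IsSliceCoord hι p φ Ψ) (hJ : IsAlmostComplex J)
    (hPH : ∀ x : L, ∀ v ∈ tangentImage (E := E) (E' := E') ι x,
      J (ι x) v ∈ tangentImage (E := E) (E' := E') ι x) {U : Set M} (hU : IsOpen U)
    {cov : ConnectionOp 𝓘(ℝ, E) M} {Γ : E' × F → E' × F →L[ℝ] E' × F →L[ℝ] E' × F}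
    (hΓ : HasSymbolOn 𝓘(ℝ, E) Ψ cov U Γ) {x : L} (hx : x ∈ φ.source) (hxU : ι x ∈ U)
    (hΓs : ContDiffAt ℝ ∞ Γ (φ x, 0))
    (hsl : ∀ᶠ y in 𝓝 (φ x), ∀ u u', (Γ (y, 0) (u, 0) (u', 0)).2 = 0)
    {X Y Z : Π y : M, TangentSpace 𝓘(ℝ, E) y} (hX : CMDiffAt ∞ (T% X) (ι x))
    (hY : CMDiffAt ∞ (T% Y) (ι x)) (hZ : CMDiffAt ∞ (T% Z) (ι x)) {u u' : E'}
    (hXu : coordDeriv 𝓘(ℝ, E) Ψ (ι x) (X (ι x)) = (u, 0))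
    (hYu : coordDeriv 𝓘(ℝ, E) Ψ (ι x) (Y (ι x)) = (u', 0)) :
    (coordDeriv 𝓘(ℝ, E) Ψ (ι x) (curvatureAntilinear J cov X Y Z (ι x))).2 =
      (1 / 4 : ℝ) • formCurvatureAntilinear (tangentialPart (coordEnd 𝓘(ℝ, E) Ψ J) (φ x))
        (normalPart (coordEnd 𝓘(ℝ, E) Ψ J)) (normalSymbol Γ) (φ x) u u'
        (coordDeriv 𝓘(ℝ, E) Ψ (ι x) (Z (ι x))).2 := by
  have hs := h.mem_source hx
  have hm := h.map_eq x hx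
  have hpres := h.preservesSlice hPH (φ.map_source hx)
  have happ : ∀ v, coordDeriv 𝓘(ℝ, E) Ψ (ι x) (J (ι x) v) =
      coordEnd 𝓘(ℝ, E) Ψ J (φ x, 0) (coordDeriv 𝓘(ℝ, E) Ψ (ι x) v) := fun v => by
    rw [← hm, h.coordM.coordEnd_apply hs]
  have hJX : ∀ {X : Π y : M, TangentSpace 𝓘(ℝ, E) y} {u : E'},
      coordDeriv 𝓘(ℝ, E) Ψ (ι x) (X (ι x)) = (u, 0) →
      coordDeriv 𝓘(ℝ, E) Ψ (ι x) (J.app X (ι x)) =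
        (tangentialPart (coordEnd 𝓘(ℝ, E) Ψ J) (φ x) u, 0) := by
    intro X u hXu
    rw [EndField.app, happ, hXu, hpres.apply_inl]
  have hR : ∀ {X Y : Π y : M, TangentSpace 𝓘(ℝ, E) y} {u u' : E'},
      CMDiffAt ∞ (T% X) (ι x) → CMDiffAt ∞ (T% Y) (ι x) →
      coordDeriv 𝓘(ℝ, E) Ψ (ι x) (X (ι x)) = (u, 0) →
      coordDeriv 𝓘(ℝ, E) Ψ (ι x) (Y (ι x)) = (u', 0) →
      (coordDeriv 𝓘(ℝ, E) Ψ (ι x) (curvature cov X Y Z (ι x))).2 =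
        formCurvature (normalSymbol Γ) (φ x) u u' (coordDeriv 𝓘(ℝ, E) Ψ (ι x) (Z (ι x))).2 := by
    intro X Y u u' hX hY hXu hYu
    rw [hΓ.coordDeriv_curvature h.coordM hU hxU hs
      (by rw [hm]; exact hΓs.differentiableAt (by simp)) hX hY hZ,
      IsSmoothCoord.coordField_apply hs, IsSmoothCoord.coordField_apply hs,
      IsSmoothCoord.coordField_apply hs, hXu, hYu, hm, snd_curvatureSymbol hΓs hsl]
  have hX' := hJ.contMDiffAt_app h.coordM hs hX
  have hY' := hJ.contMDiffAt_app h.coordM hs hY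
  rw [curvatureAntilinear, map_smul, map_sub, map_add, map_add, happ, happ, Prod.smul_snd,
    Prod.snd_sub, Prod.snd_add, Prod.snd_add, hpres.snd_apply, hpres.snd_apply, hR hX hY hXu hYu,
    hR hX' hY (hJX hXu) hYu, hR hX hY' hXu (hJX hYu), hR hX' hY' (hJX hXu) (hJX hYu)]
  rfl

/-- The structure of the normal bundle when the coordinates of the submanifold are holomorphic. -/
theorem normalStructure_eq (h : IsSliceCoord hι p φ Ψ) (hJ : IsAlmostComplex J)
    (hPH : ∀ x : L, ∀ v ∈ tangentImage (E := E) (E' := E') ι x,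
      J (ι x) v ∈ tangentImage (E := E) (E' := E') ι x) {j₀ : E' →L[ℝ] E'}
    (hφ : IsHolomorphicCoord (restrictedStructure J ι : EndField 𝓘(ℝ, E') L) j₀ φ)
    {Γ : E' × F → E' × F →L[ℝ] E' × F →L[ℝ] E' × F} {z : E' × F} (hz : z.1 ∈ φ.target)
    (hΓ : IsMinimalSymbolAt (coordEnd 𝓘(ℝ, E) Ψ J) (Γ (z.1, 0)) (z.1, 0)) :
    normalStructure (coordEnd 𝓘(ℝ, E) Ψ J) z =
      splitMatrix (fun _ => j₀) (normalTwist (fun _ => j₀) (normalPart (coordEnd 𝓘(ℝ, E) Ψ J))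
        (normalSymbol Γ)) (normalPart (coordEnd 𝓘(ℝ, E) Ψ J)) z := by
  have h1 := normalTwist_eq_of_isMinimalSymbolAt (h.preservesSlice hPH hz)
    (isMinimalSymbolAt_minimalSymbol hJ h.coordM (h.map_mem_target hz)) hΓ
  have h2 := h.tangentialPart_eq_const hPH hφ hz
  simp only [normalStructure, splitMatrix, h1, h2]
  simp only [normalTwist, h2]

end IsSliceCoord

namespace HasSliceExpression

variable {Jhat : EndField (𝓘(ℝ, E').prod 𝓘(ℝ, F)) (TotalSpace F (NormalFibre hι))}

/-- If the structure of the normal bundle is integrable, so is its restriction to the zero section: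
composing holomorphic coordinates of the total space with a complex linear projection gives
holomorphic coordinates of the zero section. -/
theorem isIntegrable_restrictedStructure (hh : HasSliceExpression hι J Jhat)
    (hJ : IsAlmostComplex J) (hemb : IsEmbedding ι)
    (hPH : ∀ x : L, ∀ v ∈ tangentImage (E := E) (E' := E') ι x,
      J (ι x) v ∈ tangentImage (E := E) (E' := E') ι x) (hint : IsIntegrable Jhat) :
    IsIntegrable (restrictedStructure J ι : EndField 𝓘(ℝ, E') L) := by
  rw [isIntegrable_iff] at hint ⊢
  intro x
  obtain ⟨φ, Ψ, h, hp⟩ := exists_isSliceCoord_self hι hemb x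
  have hN := h.isSmoothCoord_normalCoord
  have hy₀ := φ.map_source hp
  have hpres : ∀ {y}, y ∈ φ.target → PreservesSlice (coordEnd 𝓘(ℝ, E) Ψ J) y :=
    fun hy => h.preservesSlice hPH hy
  obtain ⟨χ, J₀, ha, hχ⟩ := hint ((normalCoord hι x φ).symm (φ x, 0))
  let S := ((normalCoord hι x φ).symm.trans χ).source
  have hS : IsOpen S := ((normalCoord hι x φ).symm.trans χ).open_source
  have hz₀ : (φ x, (0 : F)) ∈ S := ⟨h.mem_normalCoord_target.2 hy₀, ha⟩
  let G : E' × F → E' × F := χ ∘ (normalCoord hι x φ).symm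
  have hG : ∀ {z}, z ∈ S → ContDiffAt ℝ ∞ G z := fun hz => hN.contDiffAt_change hχ.coord hz
  have hGK : ∀ {z}, z ∈ S → ∀ v, fderiv ℝ G z (normalStructure (coordEnd 𝓘(ℝ, E) Ψ J) z v) =
      J₀ (fderiv ℝ G z v) := fun {z} hz v => by
    rw [← hh.coordEnd_eq h (h.mem_normalCoord_target.1 hz.1)]
    exact (hχ.fderiv_change hN hz).2 v
  have hinj : Function.Injective (fderiv ℝ G (φ x, 0)) := (hχ.fderiv_change hN hz₀).1
  -- `P` is the first component of the inverse of the differential of `G` at the base point; it is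
  -- complex linear because the projection of the normal bundle is
  let A : (E' × F) ≃L[ℝ] E' × F := (LinearEquiv.ofInjectiveEndo (fderiv ℝ G (φ x, 0)).toLinearMap
    hinj).toContinuousLinearEquiv
  let P : E' × F →L[ℝ] E' := (ContinuousLinearMap.fst ℝ E' F).comp (A.symm : E' × F →L[ℝ] E' × F)
  set j := tangentialPart (coordEnd 𝓘(ℝ, E) Ψ J) with hj
  have hPA : ∀ v, P (fderiv ℝ G (φ x, 0) v) = v.1 := fun v =>
    congrArg Prod.fst (A.symm_apply_apply v)
  have hPJ : ∀ v, P (J₀ v) = j (φ x) (P v) := by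
    intro v
    obtain ⟨s, rfl⟩ := A.surjective v
    change P (J₀ (fderiv ℝ G (φ x, 0) s)) = j (φ x) (P (fderiv ℝ G (φ x, 0) s))
    rw [← hGK hz₀, hPA, hPA]
    rfl
  have hS' : ∀ᶠ y in 𝓝 (φ x), (y, (0 : F)) ∈ S :=
    (contDiffAt_slice (F := F) (φ x)).continuousAt.eventually (hS.mem_nhds hz₀)
  let f : E' → E' := fun y => P (G (y, 0))
  have hf : ∀ {y}, (y, (0 : F)) ∈ S → ∀ u, fderiv ℝ f y u = P (fderiv ℝ G (y, 0) (u, 0)) :=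
    fun hy u => fderiv_comp_slice ((hG hy).differentiableAt (by simp)) P
      (Filter.Eventually.of_forall fun _ => rfl) u
  have hsq := hJ.coordEnd_sq h.coordM (h.map_mem_target hy₀)
  suffices hs : ∃ φ' : OpenPartialHomeomorph L E', x ∈ φ'.source ∧
      IsHolomorphicCoord (restrictedStructure J ι : EndField 𝓘(ℝ, E') L) (j (φ x)) φ' by
    obtain ⟨φ', hx', hφ'⟩ := hs
    exact ⟨φ', _, hx', hφ'⟩
  refine exists_isHolomorphicCoord h.coordL hp (f := f) ((hpres hy₀).tangentialPart_sq hsq) ?_ ?_ ?_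
  · filter_upwards [hS'] with y hy
    exact P.contDiff.contDiffAt.comp y (ContDiffAt.comp (g := G) y (hG hy) (contDiffAt_slice y))
  · intro u v huv
    rw [hf hz₀, hf hz₀, hPA, hPA] at huv
    exact huv
  · filter_upwards [hS', φ.open_target.mem_nhds hy₀] with y hy hyt u
    rw [hf hy, hf hy, ← hPJ, ← hGK hy, h.coordEnd_restrictedStructure hPH hyt]
    congr 2
    refine Prod.ext rfl ?_
    simp [normalStructure, splitMatrix_apply]

/-- If the structure of the normal bundle is integrable, the minimal connection of slice
coordinates which are holomorphic on the submanifold is flat on the submanifold, and its curvature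
satisfies the integrability condition for the normal bundle. -/
theorem exists_flat_of_isIntegrable [T2Space M] (hh : HasSliceExpression hι J Jhat)
    (hJ : IsAlmostComplex J) (hemb : IsEmbedding ι)
    (hPH : ∀ x : L, ∀ v ∈ tangentImage (E := E) (E' := E') ι x,
      J (ι x) v ∈ tangentImage (E := E) (E' := E') ι x) (hint : IsIntegrable Jhat) (x : L) :
    ∃ (U : Set M) (cov : ConnectionOp 𝓘(ℝ, E) M),
      IsOpen U ∧ ι x ∈ U ∧ IsMinimalConnectionOn J U cov ∧
      IsTotallyGeodesicOn (E' := E') ι U cov ∧ IsFlatAlong (E' := E') ι U cov ∧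
      NormalCurvatureAntilinearVanishes hι J U cov := by
  obtain ⟨φ', j₀, hx', hφ'⟩ :=
    isIntegrable_iff.1 (hh.isIntegrable_restrictedStructure hJ hemb hPH hint) x
  obtain ⟨φ, Ψ, h, hp, s, hs, rfl⟩ := exists_isSliceCoord hι hemb hφ'.coord hx'
  set φ := φ'.restrOpen s hs
  have hφ : IsHolomorphicCoord (restrictedStructure J ι : EndField 𝓘(ℝ, E') L) j₀ φ :=
    hφ'.restrOpen hs
  have hN := h.isSmoothCoord_normalCoord
  rw [isIntegrable_iff] at hint
  set Jc := coordEnd 𝓘(ℝ, E) Ψ J with hJc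
  have hJs : ∀ {y}, y ∈ φ.target → ContDiffAt ℝ ∞ Jc (y, 0) := fun hy =>
    hJ.contDiffAt_coordEnd h.coordM (h.map_mem_target hy)
  have hpres : ∀ {y}, y ∈ φ.target → PreservesSlice Jc y := fun hy => h.preservesSlice hPH hy
  have htan : ∀ {y}, y ∈ φ.target → ∀ u, Jc (y, 0) (u, 0) = (j₀ u, 0) := fun hy u => by
    rw [(hpres hy).apply_inl, h.tangentialPart_eq_const hPH hφ hy]
  -- the Christoffel symbol vanishes on tangent vectors of the slice
  have hΓ0 : ∀ {y}, y ∈ φ.target → ∀ u u', minimalSymbol Jc (y, 0) (u, 0) (u', 0) = 0 := by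
    intro y hy u u'
    have hd : ∀ u u' : E', fderiv ℝ Jc (y, 0) (u, 0) (u', 0) = 0 := by
      intro u u'
      have h1 := fderiv_comp_slice ((hJs hy).differentiableAt (by simp))
        (ContinuousLinearMap.apply ℝ (E' × F) ((u', 0) : E' × F)) (g := fun _ => (j₀ u', 0))
        (by filter_upwards [φ.open_target.mem_nhds hy] with y' hy' using htan hy' u') u
      rw [fderiv_fun_const] at h1
      exact h1.symm
    rw [minimalSymbol_apply, htan hy, hd, hd, hd]
    simp
  have hΓs : ∀ {y}, y ∈ φ.target → ContDiffAt ℝ ∞ (minimalSymbol Jc) (y, 0) :=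
    fun hy => contDiffAt_minimalSymbol (hJs hy)
  have hΓ := hasSymbolOn_minimalConnection (J := J) h.coordM Ψ.source
  have htg := h.isTotallyGeodesicOn_minimalConnection hJ hPH
  have hsrc : ∀ {z : L}, ι z ∈ Ψ.source → z ∈ φ.source := fun {z} hz => by
    rw [← h.preimage_source]; exact hz
  refine ⟨Ψ.source, minimalConnection J Ψ, Ψ.open_source, h.mem_source hp,
    isMinimalConnectionOn_minimalConnection hJ h.coordM, htg, ?_, ?_⟩
  · intro X Y Z hX hY hZ z hz hXt hYt hZt
    have hzs := hsrc hz
    have hy := φ.map_source hzs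
    have hm := h.map_eq z hzs
    have hn := Ψ.open_source.mem_nhds hz
    rw [h.mem_tangentImage_iff hzs] at hXt hYt hZt
    have hpr : ∀ {W : Π y : M, TangentSpace 𝓘(ℝ, E) y},
        (coordDeriv 𝓘(ℝ, E) Ψ (ι z) (W (ι z))).2 = 0 →
        coordField 𝓘(ℝ, E) Ψ W (Ψ (ι z)) = ((coordDeriv 𝓘(ℝ, E) Ψ (ι z) (W (ι z))).1, 0) :=
      fun hW => by rw [IsSmoothCoord.coordField_apply hz]; exact Prod.ext rfl hW
    apply h.coordM.coordDeriv_injective hz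
    rw [hΓ.coordDeriv_curvature h.coordM Ψ.open_source hz hz
      (by rw [hm]; exact (hΓs hy).differentiableAt (by simp)) (hX.contMDiffAt hn)
      (hY.contMDiffAt hn) (hZ.contMDiffAt hn), hpr hXt, hpr hYt, hpr hZt, hm, map_zero]
    refine curvatureSymbol_eq_zero_of_slice ((hΓs hy).differentiableAt (by simp)) ?_ _ _ _
    filter_upwards [φ.open_target.mem_nhds hy] with y' hy' using hΓ0 hy'
  · intro X Y Z hX hY hZ z hz hXt hYt
    have hzs := hsrc hz
    have hy := φ.map_source hzs
    have hn := Ψ.open_source.mem_nhds hz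
    rw [h.mem_tangentImage_iff hzs] at hXt hYt
    have hmin := isMinimalSymbolAt_minimalSymbol hJ h.coordM (h.map_mem_target hy)
    have hsl : ∀ᶠ y in 𝓝 (φ z), ∀ u u', (minimalSymbol Jc (y, 0) (u, 0) (u', 0)).2 = 0 := by
      filter_upwards [φ.open_target.mem_nhds hy] with y hy' u u'
      rw [hΓ0 hy', Prod.snd_zero]
    rw [h.normalMk_eq_zero_iff hzs, h.snd_coordDeriv_curvatureAntilinear hJ hPH Ψ.open_source hΓ hzs
      hz (hΓs hy) hsl (hX.contMDiffAt hn) (hY.contMDiffAt hn) (hZ.contMDiffAt hn)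
      (Prod.ext rfl hXt) (Prod.ext rfl hYt), h.tangentialPart_eq_const hPH hφ hy]
    set w := (coordDeriv 𝓘(ℝ, E) Ψ (ι z) (Z (ι z))).2
    have hsq := hJ.coordEnd_sq h.coordM (h.map_mem_target hy)
    rw [← snd_nijenhuisSymbol_splitMatrix (contDiffAt_normalPart (hJs hy))
      (contDiffAt_normalSymbol (hΓs hy)) ((hpres hy).normalPart_sq hsq)
      (fderiv_normalPart ((hJs hy).differentiableAt (by simp)) (hpres hy) hmin hsl.self_of_nhds)]
    have hev : coordEnd (𝓘(ℝ, E').prod 𝓘(ℝ, F)) (normalCoord hι x φ) Jhat =ᶠ[𝓝 (φ z, w)]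
        splitMatrix (fun _ => j₀) (normalTwist (fun _ => j₀) (normalPart Jc)
          (normalSymbol (minimalSymbol Jc))) (normalPart Jc) := by
      have ho : IsOpen (Prod.fst ⁻¹' φ.target : Set (E' × F)) :=
        φ.open_target.preimage continuous_fst
      filter_upwards [ho.mem_nhds (show (φ z, w).1 ∈ φ.target from hy)] with q hq
      rw [hh.coordEnd_eq h hq]
      exact h.normalStructure_eq hJ hPH hφ hq
        (isMinimalSymbolAt_minimalSymbol hJ h.coordM (h.map_mem_target hq))
    obtain ⟨χ, J₀, ha, hχ⟩ := hint ((normalCoord hι x φ).symm (φ z, w))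
    have hz₀ : (φ z, w) ∈ ((normalCoord hι x φ).symm.trans χ).source :=
      ⟨h.mem_normalCoord_target.2 hy, ha⟩
    have hd : DifferentiableAt ℝ (coordEnd (𝓘(ℝ, E').prod 𝓘(ℝ, F)) (normalCoord hι x φ) Jhat)
        (φ z, w) :=
      ((hh.isAlmostComplex hJ hemb hPH).contDiffAt_coordEnd hN
        (h.mem_normalCoord_target.2 hy)).differentiableAt (by simp)
    rw [← Filter.EventuallyEq.nijenhuisSymbol_eq hev,
      nijenhuisSymbol_eq_zero hd (hN.contDiffAt_change hχ.coord hz₀) (hχ.fderiv_change hN hz₀).1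
        (J₀ := J₀), Prod.snd_zero, smul_zero]
    filter_upwards [((normalCoord hι x φ).symm.trans χ).open_source.mem_nhds hz₀] with q hq
      using (hχ.fderiv_change hN hq).2

/-- The normal bundle is integrable if the submanifold is and the curvature condition holds: near any
of its points a holomorphic frame completes holomorphic coordinates of the submanifold to
holomorphic coordinates of the total space. -/
theorem isIntegrable [T2Space M] (hh : HasSliceExpression hι J Jhat)
    (hJ : IsAlmostComplex J) (hemb : IsEmbedding ι)
    (hPH : ∀ x : L, ∀ v ∈ tangentImage (E := E) (E' := E') ι x,
      J (ι x) v ∈ tangentImage (E := E) (E' := E') ι x)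
    (hint : IsIntegrable (restrictedStructure J ι : EndField 𝓘(ℝ, E') L))
    (hR : ∀ x : L, ∃ (U : Set M) (cov : ConnectionOp 𝓘(ℝ, E) M),
      IsOpen U ∧ ι x ∈ U ∧ IsMinimalConnectionOn J U cov ∧
      IsTotallyGeodesicOn (E' := E') ι U cov ∧ NormalCurvatureAntilinearVanishes hι J U cov) :
    IsIntegrable Jhat := by
  rw [isIntegrable_iff]
  intro a
  obtain ⟨φ', j₀, hx', hφ'⟩ := isIntegrable_iff.1 hint a.proj
  obtain ⟨φ, Ψ, h, hp, s, hs, rfl⟩ := exists_isSliceCoord hι hemb hφ'.coord hx'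
  set φ := φ'.restrOpen s hs
  have hφ : IsHolomorphicCoord (restrictedStructure J ι : EndField 𝓘(ℝ, E') L) j₀ φ :=
    hφ'.restrOpen hs
  have hN := h.isSmoothCoord_normalCoord
  obtain ⟨U, cov, hU, haU, hmin, htg, hcurv⟩ := hR a.proj
  obtain ⟨Γ, hΓ, hΓs⟩ := exists_symbol h.coordM hU hmin.isCovariantDerivativeOn hmin.smooth
  set Jc := coordEnd 𝓘(ℝ, E) Ψ J with hJc
  -- the points of the slice in `U`
  have hev : ∀ᶠ y in 𝓝 (φ a.proj), ∃ x ∈ φ.source, ι x ∈ U ∧ φ x = y := by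
    have h1 : Filter.Tendsto (fun y => ι (φ.symm y)) (𝓝 (φ a.proj)) (𝓝 (ι a.proj)) := by
      have := φ.continuousAt_symm (φ.map_source hp)
      rw [ContinuousAt, φ.left_inv hp] at this
      exact (hι.contMDiff a.proj).continuousAt.tendsto.comp this
    filter_upwards [φ.open_target.mem_nhds (φ.map_source hp), h1.eventually (hU.mem_nhds haU)]
      with y hy hyU
    exact ⟨φ.symm y, φ.map_target hy, hyU, φ.right_inv hy⟩
  have hpt : ∀ {x : L}, x ∈ φ.source → ι x ∈ U →
      ContDiffAt ℝ ∞ Jc (φ x, 0) ∧ ContDiffAt ℝ ∞ Γ (φ x, 0) ∧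
        IsMinimalSymbolAt Jc (Γ (φ x, 0)) (φ x, 0) ∧
        (∀ u u', (Γ (φ x, 0) (u, 0) (u', 0)).2 = 0) := by
    intro x hx hxU
    have hxs := h.mem_source hx
    have h1 := hΓs _ hxU hxs
    have h2 := hΓ.isMinimalSymbolAt hJ h.coordM hxU hxs hmin
    rw [h.map_eq x hx] at h1 h2
    exact ⟨hJ.contDiffAt_coordEnd h.coordM (h.map_mem_target (φ.map_source hx)), h1, h2,
      h.symbol_slice hΓ htg hx hxU⟩
  have hslice : ∀ᶠ y in 𝓝 (φ a.proj), ∀ u u', (Γ (y, 0) (u, 0) (u', 0)).2 = 0 := by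
    filter_upwards [hev] with y hy
    obtain ⟨x, hx, hxU, rfl⟩ := hy
    exact (hpt hx hxU).2.2.2
  suffices hfr : ∃ (f : E' × F → E' × F) (J₀ : E' × F →L[ℝ] E' × F), (∀ v, J₀ (J₀ v) = -v) ∧
      (∀ᶠ z in 𝓝 (normalCoord hι a.proj φ a), ContDiffAt ℝ ∞ f z) ∧
      Function.Injective (fderiv ℝ f (normalCoord hι a.proj φ a)) ∧
      ∀ᶠ z in 𝓝 (normalCoord hι a.proj φ a), ∀ v,
        fderiv ℝ f z (splitMatrix (fun _ => j₀) (normalTwist (fun _ => j₀) (normalPart Jc)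
          (normalSymbol Γ)) (normalPart Jc) z v) = J₀ (fderiv ℝ f z v) by
    obtain ⟨f, J₀, hJ₀, hf, hfi, hfJ⟩ := hfr
    obtain ⟨χ, hχa, hχ⟩ := exists_isHolomorphicCoord (K := Jhat) hN
      (h.mem_normalCoord_source.2 hp) hJ₀ hf hfi (by
        have hfst : Filter.Tendsto (Prod.fst : E' × F → E') (𝓝 (normalCoord hι a.proj φ a))
          (𝓝 (φ a.proj)) := continuousAt_fst
        filter_upwards [hfJ, hfst.eventually hev] with z hz hz' v
        obtain ⟨x, hx, hxU, hxz⟩ := hz'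
        have hzt : z.1 ∈ φ.target := hxz ▸ φ.map_source hx
        rw [← hz, hh.coordEnd_eq h hzt, h.normalStructure_eq hJ hPH hφ hzt (Γ := Γ)]
        rw [← hxz]
        exact (hpt hx hxU).2.2.1)
    exact ⟨χ, J₀, hχa, hχ⟩
  refine exists_holomorphic_splitMatrix hφ.sq ?_ ?_ ?_ ?_ ?_
  · filter_upwards [hev] with y hy
    obtain ⟨x, hx, hxU, rfl⟩ := hy
    exact contDiffAt_normalPart (hpt hx hxU).1
  · filter_upwards [hev] with y hy
    obtain ⟨x, hx, hxU, rfl⟩ := hy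
    exact contDiffAt_normalSymbol (hpt hx hxU).2.1
  · filter_upwards [hev] with y hy
    obtain ⟨x, hx, hxU, rfl⟩ := hy
    exact (h.preservesSlice hPH (φ.map_source hx)).normalPart_sq
      (hJ.coordEnd_sq h.coordM (h.map_mem_target (φ.map_source hx)))
  · filter_upwards [hev] with y hy
    obtain ⟨x, hx, hxU, rfl⟩ := hy
    obtain ⟨h1, -, h3, h4⟩ := hpt hx hxU
    exact fderiv_normalPart (h1.differentiableAt (by simp))
      (h.preservesSlice hPH (φ.map_source hx)) h3 h4
  · filter_upwards [hev, hslice.eventually_nhds] with y hy hsl u u'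
    obtain ⟨x, hx, hxU, rfl⟩ := hy
    have hxs := h.mem_source hx
    have hm := h.map_eq x hx
    refine ContinuousLinearMap.ext fun w => ?_
    obtain ⟨X, hX, hXc⟩ := exists_field_const h.coordM hxs ((u, 0) : E' × F)
    obtain ⟨Y, hY, hYc⟩ := exists_field_const h.coordM hxs ((u', 0) : E' × F)
    obtain ⟨Z, hZ, hZc⟩ := exists_field_const h.coordM hxs ((0, w) : E' × F)
    have hXx := hXc.self_of_nhds
    have hYx := hYc.self_of_nhds
    have hZx := hZc.self_of_nhds
    rw [IsSmoothCoord.coordField_apply hxs] at hXx hYx hZx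
    have h1 := hcurv X Y Z (fun z _ => (hX z).contMDiffWithinAt)
      (fun z _ => (hY z).contMDiffWithinAt) (fun z _ => (hZ z).contMDiffWithinAt) x hxU
      (by rw [h.mem_tangentImage_iff hx, hXx]) (by rw [h.mem_tangentImage_iff hx, hYx])
    rw [h.normalMk_eq_zero_iff hx, h.snd_coordDeriv_curvatureAntilinear hJ hPH hU hΓ hx hxU
      (hpt hx hxU).2.1 hsl (hX _) (hY _) (hZ _) hXx hYx, hZx,
      h.tangentialPart_eq_const hPH hφ (φ.map_source hx)] at h1
    exact (smul_eq_zero.1 h1).resolve_left (by norm_num)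

end HasSliceExpression

end Integrability

end AlmostComplexNormalBundle

end

theorem mainTheorem2
    {E E' F : Type*} [NormedAddCommGroup E] [NormedSpace ℝ E] [FiniteDimensional ℝ E]
    [NormedAddCommGroup E'] [NormedSpace ℝ E'] [FiniteDimensional ℝ E']
    [NormedAddCommGroup F] [NormedSpace ℝ F]
    {M : Type*} [TopologicalSpace M] [ChartedSpace E M] [IsManifold 𝓘(ℝ, E) ∞ M]
    [T2Space M] [SigmaCompactSpace M]
    {L : Type*} [TopologicalSpace L] [ChartedSpace E' L] [IsManifold 𝓘(ℝ, E') ∞ L]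
    (J : EndField 𝓘(ℝ, E) M) (hJ : IsAlmostComplex J)
    (ι : L → M) (hι : IsImmersionOfComplement F 𝓘(ℝ, E') 𝓘(ℝ, E) ∞ ι) (hemb : IsEmbedding ι)
    (hPH : ∀ x : L, ∀ v ∈ tangentImage (E := E) (E' := E') ι x,
      J (ι x) v ∈ tangentImage (E := E) (E' := E') ι x) :
    (∃ (U : Set M) (cov : ConnectionOp 𝓘(ℝ, E) M),
      IsOpen U ∧ range ι ⊆ U ∧ (IsClosed (range ι) → U = univ) ∧
        IsMinimalConnectionOn J U cov ∧ IsTotallyGeodesicOn (E' := E') ι U cov) ∧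
    ∃ Jhat : EndField (𝓘(ℝ, E').prod 𝓘(ℝ, F)) (TotalSpace F (NormalFibre hι)),
      IsAlmostComplex Jhat ∧
      (∀ (U : Set M) (cov : ConnectionOp 𝓘(ℝ, E) M), IsOpen U →
        IsMinimalConnectionOn J U cov → IsTotallyGeodesicOn (E' := E') ι U cov →
        ∀ a : TotalSpace F (NormalFibre hι), ι a.proj ∈ U →
          (∀ u : TangentSpace 𝓘(ℝ, E') a.proj, ∃! ξ, IsHorizontalLift hι cov a u ξ) ∧
          ∀ K : TangentSpace (𝓘(ℝ, E').prod 𝓘(ℝ, F)) a →L[ℝ]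
              TangentSpace (𝓘(ℝ, E').prod 𝓘(ℝ, F)) a,
            IsSplitStructureAt hι J cov a K ↔ K = Jhat a) ∧
      IsPseudoholomorphic Jhat (restrictedStructure J ι : EndField 𝓘(ℝ, E') L)
        (TotalSpace.proj : TotalSpace F (NormalFibre hι) → L) ∧
      IsPseudoholomorphic (restrictedStructure J ι : EndField 𝓘(ℝ, E') L) Jhat
        (zeroSection F (NormalFibre hι)) ∧
      (IsIntegrable Jhat ↔
        IsIntegrable (restrictedStructure J ι : EndField 𝓘(ℝ, E') L) ∧
        ∀ x : L, ∃ (U : Set M) (cov : ConnectionOp 𝓘(ℝ, E) M),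
          IsOpen U ∧ ι x ∈ U ∧ IsMinimalConnectionOn J U cov ∧
          IsTotallyGeodesicOn (E' := E') ι U cov ∧ IsFlatAlong (E' := E') ι U cov ∧
          NormalCurvatureAntilinearVanishes hι J U cov) := by
  refine ⟨exists_isMinimalConnectionOn_isTotallyGeodesicOn hJ hι hemb hPH, ?_⟩
  rcases isEmpty_or_nonempty L with hL | ⟨⟨p⟩⟩
  · -- the model `F` of the fibres is unconstrained, and there are no points
    exact ⟨fun a => isEmptyElim a.proj, ⟨fun a => isEmptyElim a.proj, fun a => isEmptyElim a.proj⟩,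
      fun _ _ _ _ _ a => isEmptyElim a.proj,
      ⟨fun a => isEmptyElim a.proj, fun a => isEmptyElim a.proj⟩,
      ⟨fun x => isEmptyElim x, fun x => isEmptyElim x⟩,
      fun _ => ⟨fun x => isEmptyElim x, fun x => isEmptyElim x⟩,
      fun _ a => isEmptyElim a.proj⟩
  have := finiteDimensional_of_isImmersionOfComplement hι p
  obtain ⟨Jhat, hh⟩ := exists_hasSliceExpression hJ hι hemb hPH
  refine ⟨Jhat, hh.isAlmostComplex hJ hemb hPH, fun U cov hU hmin htg a ha =>
    ⟨HasSliceExpression.existsUnique_isHorizontalLift hemb hU hmin htg ha,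
      hh.isSplitStructureAt_iff hJ hemb hPH hU hmin htg ha⟩,
    hh.isPseudoholomorphic_proj hemb hPH, hh.isPseudoholomorphic_zeroSection hemb hPH,
    fun hint => ⟨hh.isIntegrable_restrictedStructure hJ hemb hPH hint,
      hh.exists_flat_of_isIntegrable hJ hemb hPH hint⟩, fun ⟨hint, hR⟩ => ?_⟩
  refine hh.isIntegrable hJ hemb hPH hint fun x => ?_
  obtain ⟨U, cov, hU, hx, hmin, htg, -, hcurv⟩ := hR x
  exact ⟨U, cov, hU, hx, hmin, htg, hcurv⟩
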